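/- Theorem 6.7. All spaces are real. For normed spaces $X,Y$, the Banach--Mazur distance $d_{BM}(X,Y)\in[1,\infty]$ is the infimum of the $C\ge 1$ for which there is a linear isomorphism $T\colon X\to Y$ with $\|T\|\cdot\|T^{-1}\|\le C$ (and $\infty$ if there is none). A Banach space is Hilbertian if it is at finite Banach--Mazur distance from a Hilbert space. For a finite-dimensional normed space $F$ let $d_2(F)=d_{BM}(F,\ell_2^{\dim F})$; a Banach space $X$ is $d_2$-large if $\sup_F d_2(F)=\infty$, where $F$ ranges over the finite-dimensional subspaces of $X$ (equivalently, if $X$ is non-Hilbertian), and $X$ is $d_2$-minimal if it is $d_2$-large and embeds isomorphically into each of its $d_2$-large closed subspaces. An unconditional FDD of $X$ is a sequence $(F_n)_{n\in\mathbb N}$ of nonzero finite-dimensional subspaces of $X$ such that every $x\in X$ can be written in a unique way as $x=\sum_{n=0}^\infty x_n$ with $x_n\in F_n$ for all $n$, and such that every convergent series $\sum_n x_n$ with $x_n\in F_n$ for all $n$ converges unconditionally. Let $X$ be a $d_2$-minimal Banach space. 1. $X$ has a non-Hilbertian closed subspace with a Schauder basis. 2. If $X$ has an unconditional FDD, then $X$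 has a non-Hilbertian closed subspace with an unconditional Schauder basis. -/

import Mathlib

open Filter Topology
open scoped ENNReal NNReal

universe u v

/-- A `C`-isomorphism between two normed spaces: an isomorphism `T` with `‖T‖ * ‖T⁻¹‖ ≤ C`. -/
def IsCIsomorphism {X : Type u} {Y : Type v} [NormedAddCommGroup X] [NormedSpace ℝ X]
    [NormedAddCommGroup Y] [NormedSpace ℝ Y] (C : ℝ≥0) (T : X ≃L[ℝ] Y) : Prop :=
  ‖(T : X →L[ℝ] Y)‖ * ‖(T.symm : Y →L[ℝ] X)‖ ≤ C

/-- The Banach-Mazur distance: the infimum of the `C ≥ 1` for which there is a `C`-isomorphism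
(it is `∞` when the two spaces are not isomorphic). -/
noncomputable def banachMazurDist (X : Type u) (Y : Type v)
    [NormedAddCommGroup X] [NormedSpace ℝ X] [NormedAddCommGroup Y] [NormedSpace ℝ Y] : ℝ≥0∞ :=
  ⨅ (C : ℝ≥0) (_ : 1 ≤ C) (_ : ∃ T : X ≃L[ℝ] Y, IsCIsomorphism C T), (C : ℝ≥0∞)

/-- A space is Hilbertian if it is at finite Banach-Mazur distance from some Hilbert space
(of finite or infinite dimension). -/
def IsHilbertian (X : Type u) [NormedAddCommGroup X] [NormedSpace ℝ X] : Prop :=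
  ∃ (H : Type u) (_ : NormedAddCommGroup H) (_ : InnerProductSpace ℝ H) (_ : CompleteSpace H),
    banachMazurDist X H < ∞

/-- The Hilbertian degree `d₂(F) = d_BM(F, ℓ₂^{dim F})` of a finite-dimensional space `F`. -/
noncomputable def hilbertianDegree (F : Type u) [NormedAddCommGroup F] [NormedSpace ℝ F] : ℝ≥0∞ :=
  banachMazurDist F (EuclideanSpace ℝ (Fin (Module.finrank ℝ F)))

/-- `X` is `d₂`-small if `d₂` is bounded on the finite-dimensional subspaces of `X`. -/
def IsD2Small (X : Type u) [NormedAddCommGroup X] [NormedSpace ℝ X] : Prop :=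
  (⨆ (F : Submodule ℝ X) (_ : FiniteDimensional ℝ F), hilbertianDegree F) < ∞

/-- `X` is `d₂`-large if it is not `d₂`-small. -/
def IsD2Large (X : Type u) [NormedAddCommGroup X] [NormedSpace ℝ X] : Prop :=
  ¬ IsD2Small X

/-- `X` embeds isomorphically into `Y`: it is isomorphic to a linear subspace of `Y`. -/
def EmbedsIsomorphically (X : Type u) (Y : Type v) [NormedAddCommGroup X] [NormedSpace ℝ X]
    [NormedAddCommGroup Y] [NormedSpace ℝ Y] : Prop :=
  ∃ Z : Submodule ℝ Y, Nonempty (X ≃L[ℝ] Z)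

/-- `X` is `d₂`-minimal if it is `d₂`-large and embeds isomorphically into every `d₂`-large closed
subspace of itself. -/
def IsD2Minimal (X : Type u) [NormedAddCommGroup X] [NormedSpace ℝ X] : Prop :=
  IsD2Large X ∧
    ∀ Y : Submodule ℝ X, IsClosed (Y : Set X) → IsD2Large Y → EmbedsIsomorphically X Y

/-- The series `∑ uₙ` converges to `x`, in the sense of ordered partial sums. -/
def SeriesConvergesTo {X : Type u} [NormedAddCommGroup X] (w : ℕ → X) (x : X) : Prop :=
  Tendsto (fun n : ℕ => ∑ i ∈ Finset.range n, w i) atTop (𝓝 x)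

/-- `(Fₙ)` is a finite-dimensional decomposition (FDD) of `X`: the `Fₙ` are nonzero
finite-dimensional subspaces, and every `x` is in a unique way the sum of a convergent series
`∑ xₙ` with `xₙ ∈ Fₙ`. -/
structure IsFDD {X : Type u} [NormedAddCommGroup X] [NormedSpace ℝ X]
    (F : ℕ → Submodule ℝ X) : Prop where
  finiteDimensional : ∀ n, FiniteDimensional ℝ (F n)
  ne_bot : ∀ n, F n ≠ ⊥
  existsUnique_expansion : ∀ x : X, ∃! w : ℕ → X, (∀ n, w n ∈ F n) ∧ SeriesConvergesTo w x

/-- An unconditional FDD: an FDD such that every convergent series `∑ xₙ` with `xₙ ∈ Fₙ`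
converges unconditionally. -/
structure IsUFDD {X : Type u} [NormedAddCommGroup X] [NormedSpace ℝ X]
    (F : ℕ → Submodule ℝ X) : Prop extends IsFDD F where
  unconditional : ∀ w : ℕ → X, (∀ n, w n ∈ F n) → (∃ x, SeriesConvergesTo w x) → Summable w

/-! Hilbertian constants are measured by quadratic forms (`HilbertComparable`), which pull back
along linear maps and add up over splittings. The proof is by contradiction: suppose that every
basic sequence of X, or every unconditional one for the second claim, has Hilbertian span.

This assumption is uniform far out along a decomposition: otherwise ever worse finite families,
placed further and further out, concatenate to one sequence of the same kind with non-Hilbertian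
span (`exists_uniform_hilbertComparable_schauder`, `exists_uniform_hilbertComparable_uncond`).

Minimality keeps X from being asymptotically Hilbertian (`IsD2Minimal.exists_finrank`). Otherwise
sparse bad blocks H_i span a large subspace, into which X embeds. Choose a bad finite-dimensional E
just before H_i is placed, and place H_i beyond the point where subspaces of dimension at most dim E
are K-Hilbertian. The image of E splits into a part in the earlier blocks, whose Hilbertian constant
was known when E was chosen, and a far part that is K-Hilbertian; so E was not so bad. Hence for
each K some fixed dimension m has non-K-Hilbertian subspaces in all tails, and compactness yields
successive copies of one non-K-Hilbertian norm p on ℝ^m (`exists_successive_copies`).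

Next come ℓ₂-sums of copies of p. With an unconditional FDD, a tail of the FDD is already an
ℓ₂-decomposition (`exists_isL2Decomp_tail`). In general one takes differences of copies: in iterated
ultrafilter limits, deleting coordinates does not increase the norm, so vectors picked from
well-chosen differences are basic and unconditional, and the uniform assumption makes their norm an
ℓ₂-norm (`exists_l2_copies`).

Finally, with one copy T_ω of p for each sign pattern ω, the vectors Σ_ω ε_i(ω) T_ω x_i form an
unconditional family whose norms reproduce Rademacher averages. As its span is uniformly Hilbertian,
p has type 2 and cotype 2, and Kwapień's theorem makes p Hilbertian with a constant fixed before p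
was chosen, a contradiction (`hilbertComparable_of_copies`). -/

/-- The function `p` is comparable, up to the factor `c` on squares, with the square root of a
quadratic form. -/
def HilbertComparable {V : Type*} [AddCommGroup V] [Module ℝ V] (p : V → ℝ) (c : ℝ) : Prop :=
  ∃ B : V →ₗ[ℝ] V →ₗ[ℝ] ℝ, ∀ x, p x ^ 2 ≤ B x x ∧ B x x ≤ c * p x ^ 2

/-- The norm of the subspace `E` is comparable with a Hilbertian one, up to `c` on squares. -/
abbrev Submodule.HilbertComparable {X : Type*} [NormedAddCommGroup X] [NormedSpace ℝ X]
    (E : Submodule ℝ X) (c : ℝ) : Prop :=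
  _root_.HilbertComparable (fun x : E => ‖(x : X)‖) c

/-! ### Stability of Hilbertian constants -/

namespace HilbertComparable

variable {V W : Type*} [AddCommGroup V] [Module ℝ V] [AddCommGroup W] [Module ℝ W]

theorem comp {p : W → ℝ} {c : ℝ} (h : HilbertComparable p c) (f : V →ₗ[ℝ] W) :
    HilbertComparable (fun x => p (f x)) c := by
  obtain ⟨B, hB⟩ := h
  exact ⟨B.compl₁₂ f f, fun x => by simpa using hB (f x)⟩

theorem mono {p : V → ℝ} {c d : ℝ} (h : HilbertComparable p c) (hcd : c ≤ d) :
    HilbertComparable p d := by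
  obtain ⟨B, hB⟩ := h
  refine ⟨B, fun x => ⟨(hB x).1, (hB x).2.trans ?_⟩⟩
  gcongr

/-- The form is the sum of the two given forms, with (q + r)² ≤ 2(q² + r²). It is used when a vector
splits linearly into two controlled parts with norms q and r. -/
theorem two_piece {p q r : V → ℝ} {c d a b : ℝ} (hq : HilbertComparable q c)
    (hr : HilbertComparable r d) (hc : 0 ≤ c) (hd : 0 ≤ d)
    (hp0 : ∀ x, 0 ≤ p x) (hq0 : ∀ x, 0 ≤ q x) (hr0 : ∀ x, 0 ≤ r x)
    (hpqr : ∀ x, p x ≤ a * (q x + r x))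
    (hqp : ∀ x, q x ≤ b * p x) (hrp : ∀ x, r x ≤ b * p x) :
    HilbertComparable p (2 * a ^ 2 * b ^ 2 * (c + d)) := by
  obtain ⟨B, hB⟩ := hq
  obtain ⟨D, hD⟩ := hr
  refine ⟨(2 * a ^ 2) • (B + D), fun x => ?_⟩
  have h1 : p x ^ 2 ≤ (a * (q x + r x)) ^ 2 := pow_le_pow_left₀ (hp0 x) (hpqr x) 2
  have h2 : q x ^ 2 ≤ (b * p x) ^ 2 := pow_le_pow_left₀ (hq0 x) (hqp x) 2
  have h3 : r x ^ 2 ≤ (b * p x) ^ 2 := pow_le_pow_left₀ (hr0 x) (hrp x) 2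
  have hx := hB x
  have hx' := hD x
  simp only [LinearMap.smul_apply, LinearMap.add_apply, smul_eq_mul]
  have ha : 0 ≤ 2 * a ^ 2 := by positivity
  constructor
  · have : (q x + r x) ^ 2 ≤ 2 * (q x ^ 2 + r x ^ 2) := by nlinarith [sq_nonneg (q x - r x)]
    calc p x ^ 2 ≤ a ^ 2 * (q x + r x) ^ 2 := by rw [← mul_pow]; exact h1
      _ ≤ a ^ 2 * (2 * (q x ^ 2 + r x ^ 2)) := by gcongr
      _ = 2 * a ^ 2 * (q x ^ 2 + r x ^ 2) := by ring
      _ ≤ _ := by gcongr <;> [exact hx.1; exact hx'.1]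
  · calc 2 * a ^ 2 * (B x x + D x x) ≤ 2 * a ^ 2 * (c * (b * p x) ^ 2 + d * (b * p x) ^ 2) := by
          gcongr
          · exact hx.2.trans (by gcongr)
          · exact hx'.2.trans (by gcongr)
      _ = _ := by ring

theorem of_le_of_le {p q : V → ℝ} {c a b : ℝ} (hq : HilbertComparable q c) (hc : 0 ≤ c)
    (hp0 : ∀ x, 0 ≤ p x) (hq0 : ∀ x, 0 ≤ q x)
    (hpq : ∀ x, p x ≤ a * q x) (hqp : ∀ x, q x ≤ b * p x) :
    HilbertComparable p (a ^ 2 * b ^ 2 * c) := by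
  obtain ⟨B, hB⟩ := hq
  refine ⟨a ^ 2 • B, fun x => ?_⟩
  have h1 : p x ^ 2 ≤ (a * q x) ^ 2 := pow_le_pow_left₀ (hp0 x) (hpq x) 2
  have h2 : q x ^ 2 ≤ (b * p x) ^ 2 := pow_le_pow_left₀ (hq0 x) (hqp x) 2
  have hx := hB x
  simp only [LinearMap.smul_apply, smul_eq_mul]
  constructor
  · calc p x ^ 2 ≤ a ^ 2 * q x ^ 2 := by rw [← mul_pow]; exact h1
      _ ≤ _ := by gcongr; exact hx.1
  · calc a ^ 2 * B x x ≤ a ^ 2 * (c * (b * p x) ^ 2) := by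
          gcongr; exact hx.2.trans (by gcongr)
      _ = _ := by ring

end HilbertComparable

/-! ### Quadratic forms, Banach–Mazur distance and finite-dimensional subspaces -/

section NormedSpace

variable {X : Type u} [NormedAddCommGroup X] [NormedSpace ℝ X]

/-- Pull back the inner product along T and scale it by ‖T⁻¹‖², so that it dominates the squared
norm. -/
theorem HilbertComparable.of_equiv {V : Type*} [NormedAddCommGroup V] [NormedSpace ℝ V]
    {H : Type*} [NormedAddCommGroup H] [InnerProductSpace ℝ H] {C : ℝ≥0} (T : V ≃L[ℝ] H)
    (hT : IsCIsomorphism C T) : HilbertComparable (fun x : V => ‖x‖) ((C : ℝ) ^ 2) := by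
  refine ⟨(‖(T.symm : H →L[ℝ] V)‖ ^ 2) • ((innerₗ H).compl₁₂ T.toLinearEquiv.toLinearMap
    T.toLinearEquiv.toLinearMap), fun x => ?_⟩
  have h1 : ‖x‖ ≤ ‖(T.symm : H →L[ℝ] V)‖ * ‖T x‖ := by
    simpa using (T.symm : H →L[ℝ] V).le_opNorm (T x)
  have h2 : ‖T x‖ ≤ ‖(T : V →L[ℝ] H)‖ * ‖x‖ := (T : V →L[ℝ] H).le_opNorm x
  have e : inner ℝ (T x) (T x) = ‖T x‖ ^ 2 := real_inner_self_eq_norm_sq _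
  simp only [LinearMap.smul_apply, LinearMap.compl₁₂_apply, innerₗ_apply_apply, smul_eq_mul,
    LinearEquiv.coe_coe, ContinuousLinearEquiv.coe_toLinearEquiv, e]
  have hT' : ‖(T : V →L[ℝ] H)‖ * ‖(T.symm : H →L[ℝ] V)‖ ≤ C := hT
  constructor
  · rw [← mul_pow]; gcongr
  · calc ‖(T.symm : H →L[ℝ] V)‖ ^ 2 * ‖T x‖ ^ 2
        ≤ ‖(T.symm : H →L[ℝ] V)‖ ^ 2 * (‖(T : V →L[ℝ] H)‖ * ‖x‖) ^ 2 := by gcongr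
      _ = (‖(T : V →L[ℝ] H)‖ * ‖(T.symm : H →L[ℝ] V)‖) ^ 2 * ‖x‖ ^ 2 := by ring
      _ ≤ _ := by gcongr

theorem exists_isCIsomorphism_of_banachMazurDist_lt {Y : Type*} [NormedAddCommGroup Y]
    [NormedSpace ℝ Y] {C : ℝ≥0} (h : banachMazurDist X Y < C) :
    ∃ T : X ≃L[ℝ] Y, IsCIsomorphism C T := by
  unfold banachMazurDist at h
  simp only [iInf_lt_iff] at h
  obtain ⟨D, -, ⟨T, hT⟩, hD⟩ := h
  exact ⟨T, le_trans hT (by exact_mod_cast hD.le)⟩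

theorem IsHilbertian.exists_hilbertComparable (h : IsHilbertian X) :
    ∃ c, HilbertComparable (fun x : X => ‖x‖) c := by
  obtain ⟨H, _, _, _, hH⟩ := h
  obtain ⟨C, hC⟩ := ENNReal.lt_iff_exists_nnreal_btwn.1 hH
  obtain ⟨T, hT⟩ := exists_isCIsomorphism_of_banachMazurDist_lt hC.1
  exact ⟨_, HilbertComparable.of_equiv T hT⟩

theorem isD2Large_of_forall_exists (h : ∀ c : ℝ, ∃ F : Submodule ℝ X, FiniteDimensional ℝ F ∧
    ¬ F.HilbertComparable c) : IsD2Large X := by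
  intro hs
  obtain ⟨C, hC⟩ := ENNReal.lt_iff_exists_nnreal_btwn.1 hs
  obtain ⟨F, hF, hFC⟩ := h ((C : ℝ) ^ 2)
  have : hilbertianDegree F < C :=
    lt_of_le_of_lt (le_iSup₂ (f := fun (F : Submodule ℝ X) (_ : FiniteDimensional ℝ F) =>
      hilbertianDegree F) F hF) hC.1
  obtain ⟨T, hT⟩ := exists_isCIsomorphism_of_banachMazurDist_lt this
  exact hFC (HilbertComparable.of_equiv T hT)

theorem LinearMap.exists_equiv_euclideanSpace {V : Type*} [AddCommGroup V] [Module ℝ V]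
    [FiniteDimensional ℝ V] (B : V →ₗ[ℝ] V →ₗ[ℝ] ℝ) (hB : ∀ x, x ≠ 0 → 0 < B x x) :
    ∃ f : V ≃ₗ[ℝ] EuclideanSpace ℝ (Fin (Module.finrank ℝ V)), ∀ x, ‖f x‖ ^ 2 = B x x := by
  let core : InnerProductSpace.Core ℝ V :=
    -- The form need not be symmetric; symmetrizing does not change its diagonal.
    { inner := fun x y => (B x y + B y x) / 2
      conj_inner_symm := fun x y => by simp [add_comm]
      re_inner_nonneg := fun x => by
        simp only [RCLike.re_to_real]
        rcases eq_or_ne x 0 with rfl | hx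
        · simp
        · linarith [hB x hx]
      add_left := fun x y z => by simp; ring
      smul_left := fun x y r => by simp; ring
      definite := fun x hx => by
        by_contra hx0
        have h3 : (B x x + B x x) / 2 = 0 := hx
        linarith [hB x hx0] }
  let n1 : NormedAddCommGroup V := core.toNormedAddCommGroup
  let i1 : InnerProductSpace ℝ V := InnerProductSpace.ofCore core.toCore
  refine ⟨(stdOrthonormalBasis ℝ V).repr.toLinearEquiv, fun x => ?_⟩
  have : ‖(stdOrthonormalBasis ℝ V).repr x‖ ^ 2 = B x x := by
    rw [LinearIsometryEquiv.norm_map, ← real_inner_self_eq_norm_sq]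
    change (B x x + B x x) / 2 = _
    ring
  exact this

/-- Since B is positive definite, it is the squared Euclidean norm in suitable coordinates; the two
bounds on B then control T⁻¹ by 1 and T by √c. -/
theorem HilbertComparable.exists_equiv {V : Type*} [NormedAddCommGroup V] [NormedSpace ℝ V]
    [FiniteDimensional ℝ V] {c : ℝ}
    (h : HilbertComparable (fun x : V => ‖x‖) c) :
    ∃ T : V ≃L[ℝ] EuclideanSpace ℝ (Fin (Module.finrank ℝ V)),
      ‖(T : V →L[ℝ] EuclideanSpace ℝ (Fin (Module.finrank ℝ V)))‖ *
        ‖(T.symm : EuclideanSpace ℝ (Fin (Module.finrank ℝ V)) →L[ℝ] V)‖ ≤ √c := by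
  obtain ⟨B, hB⟩ := h
  obtain ⟨f, hf⟩ := LinearMap.exists_equiv_euclideanSpace B fun x hx =>
    (pow_pos (norm_pos_iff.2 hx) 2).trans_le (hB x).1
  refine ⟨f.toContinuousLinearEquiv, ?_⟩
  have h1 : ‖(f.toContinuousLinearEquiv :
      V →L[ℝ] EuclideanSpace ℝ (Fin (Module.finrank ℝ V)))‖ ≤ √c := by
    refine ContinuousLinearMap.opNorm_le_bound _ (Real.sqrt_nonneg _) fun x => ?_
    rcases lt_or_ge c 0 with hc | hc
    · have h0 : ‖x‖ ^ 2 ≤ c * ‖x‖ ^ 2 := (hB x).1.trans (hB x).2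
      have : ‖x‖ ^ 2 ≤ 0 := by nlinarith [sq_nonneg ‖x‖]
      have : x = 0 := by simpa using this.antisymm (by positivity)
      subst this
      simp
    · refine (pow_le_pow_iff_left₀ (by positivity) (by positivity) two_ne_zero).1 ?_
      rw [mul_pow, Real.sq_sqrt hc]
      exact (hf x).le.trans (hB x).2
  have h2 : ‖(f.toContinuousLinearEquiv.symm :
      EuclideanSpace ℝ (Fin (Module.finrank ℝ V)) →L[ℝ] V)‖ ≤ 1 := by
    refine ContinuousLinearMap.opNorm_le_bound _ zero_le_one fun y => ?_
    refine (pow_le_pow_iff_left₀ (by positivity) (by positivity) two_ne_zero).1 ?_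
    have := (hB (f.symm y)).1
    rw [← hf] at this
    simpa using this
  calc _ ≤ √c * 1 := by gcongr
    _ = _ := mul_one _

theorem IsD2Large.exists_not_hilbertComparable (h : IsD2Large X) (c : ℝ) :
    ∃ F : Submodule ℝ X, FiniteDimensional ℝ F ∧ ¬ F.HilbertComparable c := by
  by_contra! hcon
  refine h (lt_of_le_of_lt (iSup₂_le fun F hF => ?_)
    (ENNReal.coe_lt_top (r := max 1 (Real.toNNReal √c))))
  obtain ⟨T, hT⟩ := HilbertComparable.exists_equiv (V := F) (hcon F hF)
  unfold hilbertianDegree banachMazurDist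
  refine iInf_le_of_le (max 1 (Real.toNNReal √c)) (iInf_le_of_le (le_max_left _ _)
    (iInf_le_of_le ⟨T, hT.trans ?_⟩ le_rfl))
  simp [Real.coe_toNNReal']

theorem Submodule.HilbertComparable.comp_linearMap {V : Type*} [AddCommGroup V] [Module ℝ V]
    {E : Submodule ℝ X} {c : ℝ} (h : E.HilbertComparable c) (f : V →ₗ[ℝ] X)
    (hf : ∀ x, f x ∈ E) : _root_.HilbertComparable (fun x => ‖f x‖) c := by
  simpa using _root_.HilbertComparable.comp h (f.codRestrict E hf)

theorem Submodule.HilbertComparable.anti {E F : Submodule ℝ X} {c : ℝ}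
    (h : E.HilbertComparable c) (hF : F ≤ E) : F.HilbertComparable c :=
  h.comp_linearMap F.subtype fun x => hF x.2

/-- Pulling back along a linear section of the map onto its range transfers the form without
assuming injectivity. -/
theorem Submodule.hilbertComparable_of_range {V : Type*} [AddCommGroup V] [Module ℝ V]
    {c : ℝ} (f : V →ₗ[ℝ] X) (h : _root_.HilbertComparable (fun x => ‖f x‖) c) :
    (LinearMap.range f).HilbertComparable c := by
  obtain ⟨g, hg⟩ := LinearMap.exists_rightInverse_of_surjective f.rangeRestrict
    (LinearMap.range_rangeRestrict f)
  have := h.comp g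
  convert this using 2 with x
  have := congrArg Subtype.val (LinearMap.congr_fun hg x)
  simp at this
  rw [this]

theorem Submodule.exists_hilbertComparable (E : Submodule ℝ X) [FiniteDimensional ℝ E] :
    ∃ c, 0 ≤ c ∧ E.HilbertComparable c := by
  let T : E ≃L[ℝ] EuclideanSpace ℝ (Fin (Module.finrank ℝ E)) := toEuclidean
  let C : ℝ≥0 := ‖(T : E →L[ℝ] EuclideanSpace ℝ (Fin (Module.finrank ℝ E)))‖₊ *
    ‖(T.symm : EuclideanSpace ℝ (Fin (Module.finrank ℝ E)) →L[ℝ] E)‖₊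
  refine ⟨(C : ℝ) ^ 2, by positivity, ?_⟩
  exact _root_.HilbertComparable.of_equiv T (by simp [IsCIsomorphism, C])

theorem exists_hilbertComparable_of_isHilbertian_of_le {Y E : Submodule ℝ X} (hY : IsHilbertian Y)
    (hE : E ≤ Y) : ∃ c, E.HilbertComparable c := by
  obtain ⟨c, hc⟩ := hY.exists_hilbertComparable
  exact ⟨c, Submodule.HilbertComparable.anti (E := Y) hc hE⟩

/-- A linear map into a sum of two subspaces splits. -/
theorem LinearMap.exists_eq_add_of_mem_sup {V : Type*} [AddCommGroup V] [Module ℝ V]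
    {A B : Submodule ℝ X} (h : V →ₗ[ℝ] X) (hh : ∀ x, h x ∈ A ⊔ B) :
    ∃ f g : V →ₗ[ℝ] X, (∀ x, f x ∈ A) ∧ (∀ x, g x ∈ B) ∧ ∀ x, h x = f x + g x := by
  let s : A × B →ₗ[ℝ] (A ⊔ B : Submodule ℝ X) :=
    (A.subtype.coprod B.subtype).codRestrict (A ⊔ B) fun x =>
      Submodule.add_mem_sup x.1.2 x.2.2
  have hsv : ∀ z : A × B, ((s z : (A ⊔ B : Submodule ℝ X)) : X) = z.1 + z.2 := fun z => rfl
  have hs : Function.Surjective s := by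
    rintro ⟨x, hx⟩
    obtain ⟨y, hy, z, hz, rfl⟩ := Submodule.mem_sup.1 hx
    exact ⟨(⟨y, hy⟩, ⟨z, hz⟩), Subtype.ext (hsv _)⟩
  obtain ⟨k, hk⟩ := Module.projective_lifting_property s (h.codRestrict _ hh) hs
  refine ⟨A.subtype ∘ₗ LinearMap.fst ℝ A B ∘ₗ k, B.subtype ∘ₗ LinearMap.snd ℝ A B ∘ₗ k,
    fun x => by simp, fun x => by simp, fun x => ?_⟩
  exact (congrArg Subtype.val (LinearMap.congr_fun hk x)).symm.trans (hsv _)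

/-- A linear map from a finite-dimensional space into the closure of a subspace can be perturbed
to a linear map into that subspace. -/
theorem LinearMap.exists_perturbation {V : Type*} [NormedAddCommGroup V] [NormedSpace ℝ V]
    [FiniteDimensional ℝ V] (W : Submodule ℝ X) (f : V →ₗ[ℝ] X)
    (hf : ∀ x, f x ∈ W.topologicalClosure) {ε : ℝ} (hε : 0 < ε) :
    ∃ g : V →ₗ[ℝ] X, (∀ x, g x ∈ W) ∧ ∀ x, ‖g x - f x‖ ≤ ε * ‖x‖ := by
  let b := Module.finBasis ℝ V
  let φ : Fin (Module.finrank ℝ V) → V →L[ℝ] ℝ := fun i => LinearMap.toContinuousLinearMap (b.coord i)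
  let M := ∑ i, ‖φ i‖
  have hM : 0 ≤ M := Finset.sum_nonneg fun i _ => norm_nonneg _
  have hδ : 0 < ε / (M + 1) := by positivity
  have : ∀ i, ∃ w ∈ W, ‖w - f (b i)‖ ≤ ε / (M + 1) := by
    intro i
    obtain ⟨w, hw, hwd⟩ := Metric.mem_closure_iff.1 (hf (b i)) _ hδ
    exact ⟨w, hw, by rw [dist_comm, dist_eq_norm] at hwd; exact hwd.le⟩
  choose w hw hwd using this
  refine ⟨b.constr ℝ w, fun x => ?_, fun x => ?_⟩
  · rw [Module.Basis.constr_apply_fintype]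
    exact W.sum_mem fun i _ => W.smul_mem _ (hw i)
  · have h1 : b.constr ℝ w x - f x = ∑ i, φ i x • (w i - f (b i)) := by
      have h2 : f x = ∑ i, b.repr x i • f (b i) := by
        simp_rw [← map_smul, ← map_sum, b.sum_repr]
      rw [h2]
      simp [smul_sub, φ, Finset.sum_sub_distrib, Module.Basis.constr_apply_fintype]
    rw [h1]
    calc ‖∑ i, φ i x • (w i - f (b i))‖ ≤ ∑ i, ‖φ i x • (w i - f (b i))‖ := norm_sum_le _ _
      _ ≤ ∑ i, (‖φ i‖ * ‖x‖) * (ε / (M + 1)) := by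
          refine Finset.sum_le_sum fun i _ => ?_
          rw [norm_smul]
          gcongr
          · exact (φ i).le_opNorm x
          · exact hwd i
      _ = M * (ε / (M + 1)) * ‖x‖ := by rw [← Finset.sum_mul, ← Finset.sum_mul]; ring
      _ ≤ ε * ‖x‖ := by
          gcongr
          rw [mul_div_assoc', div_le_iff₀ (by positivity)]
          nlinarith

end NormedSpace

/-! ### Decompositions with bounded projections, and the bases they give -/

section Decomposition

variable {X : Type u} [NormedAddCommGroup X] [NormedSpace ℝ X] {ι : Type*}

/-- Projecting the algebraic sum of the `F i` onto the part indexed by `A` is well defined and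
bounded by `C`. -/
def ProjBound (F : ι → Submodule ℝ X) (A : Set ι) (C : ℝ) : Prop :=
  ∀ x ∈ ⨆ i ∈ A, F i, ∀ y ∈ ⨆ i ∈ Aᶜ, F i, ‖x‖ ≤ C * ‖x + y‖

/-- The initial projections of `(F n)` are bounded by `C`. -/
def IsSchauderDecomp (F : ℕ → Submodule ℝ X) (C : ℝ) : Prop :=
  ∀ n, ProjBound F (Set.Iio n) C

/-- All the projections of `(F i)` are bounded by `C`. -/
def IsUncondDecomp (F : ι → Submodule ℝ X) (C : ℝ) : Prop :=
  ∀ A, ProjBound F A C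

theorem IsUncondDecomp.isSchauderDecomp {F : ℕ → Submodule ℝ X} {C : ℝ} (h : IsUncondDecomp F C) :
    IsSchauderDecomp F C := fun _ => h _

theorem ProjBound.mono {F G : ι → Submodule ℝ X} {A : Set ι} {C D : ℝ} (h : ProjBound F A C)
    (hG : ∀ i, G i ≤ F i) (hCD : C ≤ D) : ProjBound G A D := fun x hx y hy =>
  (h x (iSup₂_mono (fun i _ => hG i) hx) y (iSup₂_mono (fun i _ => hG i) hy)).trans (by gcongr)

theorem IsUncondDecomp.mono {F G : ι → Submodule ℝ X} {C D : ℝ} (h : IsUncondDecomp F C)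
    (hG : ∀ i, G i ≤ F i) (hCD : C ≤ D) : IsUncondDecomp G D := fun n => (h n).mono hG hCD

theorem ProjBound.comp_of_mapsTo {κ : Type*} {F : ι → Submodule ℝ X} {G : κ → Submodule ℝ X}
    {A : Set ι} {A' : Set κ} {C : ℝ} (h : ProjBound F A C)
    (h1 : ∀ j ∈ A', G j ≤ ⨆ i ∈ A, F i) (h2 : ∀ j ∈ A'ᶜ, G j ≤ ⨆ i ∈ Aᶜ, F i) :
    ProjBound G A' C := fun x hx y hy =>
  h x ((iSup₂_le h1 : _ ≤ ⨆ i ∈ A, F i) hx) y ((iSup₂_le h2 : _ ≤ ⨆ i ∈ Aᶜ, F i) hy)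

/-- Successive blocks of a decomposition form a decomposition. -/
theorem IsSchauderDecomp.blocks {F G : ℕ → Submodule ℝ X} {C : ℝ} (h : IsSchauderDecomp F C)
    {a : ℕ → ℕ} (ha : Monotone a) (hG : ∀ j, G j ≤ ⨆ i ∈ Set.Ico (a j) (a (j + 1)), F i) :
    IsSchauderDecomp G C := by
  intro n
  refine (h (a n)).comp_of_mapsTo (fun j hj => (hG j).trans ?_) (fun j hj => (hG j).trans ?_)
  · refine biSup_mono fun i hi => ?_
    exact lt_of_lt_of_le hi.2 (ha (Nat.succ_le_of_lt hj))
  · refine biSup_mono fun i hi => ?_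
    simp only [Set.compl_Iio, Set.mem_Ici] at hj ⊢
    exact (ha hj).trans hi.1

theorem IsUncondDecomp.blocks {F G : ℕ → Submodule ℝ X} {C : ℝ} (h : IsUncondDecomp F C)
    {a : ℕ → ℕ} (ha : Monotone a) (hG : ∀ j, G j ≤ ⨆ i ∈ Set.Ico (a j) (a (j + 1)), F i) :
    IsUncondDecomp G C := by
  intro A
  refine (h (⋃ j ∈ A, Set.Ico (a j) (a (j + 1)))).comp_of_mapsTo
    (fun j hj => (hG j).trans ?_) (fun j hj => (hG j).trans ?_)
  · exact biSup_mono fun i hi => Set.mem_biUnion hj hi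
  · refine biSup_mono fun i hi => ?_
    simp only [Set.mem_compl_iff, Set.mem_iUnion, not_exists]
    intro k hk hik
    have hjk : j ≠ k := fun h => hj (h ▸ hk)
    rcases lt_or_gt_of_ne hjk with h | h
    · have := ha (Nat.succ_le_of_lt h); have := hi.2; have := hik.1; simp at *; omega
    · have := ha (Nat.succ_le_of_lt h); have := hi.1; have := hik.2; simp at *; omega

theorem linearCombination_mem_biSup_span {e : ι → X} {A : Set ι} (a : ι →₀ ℝ)
    (ha : ∀ i, a i ≠ 0 → i ∈ A) :
    Finsupp.linearCombination ℝ e a ∈ ⨆ i ∈ A, Submodule.span ℝ {e i} := by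
  rw [Finsupp.linearCombination_apply]
  refine Submodule.sum_mem _ fun i hi => Submodule.smul_mem _ _ ?_
  exact (le_biSup (fun i => Submodule.span ℝ {e i}) (ha i (Finsupp.mem_support_iff.1 hi)))
    (Submodule.mem_span_singleton_self _)

theorem ProjBound.norm_filter_le {e : ι → X} {A : Set ι} {C : ℝ} [DecidablePred (· ∈ A)]
    (h : ProjBound (fun i => Submodule.span ℝ {e i}) A C) (a : ι →₀ ℝ) :
    ‖Finsupp.linearCombination ℝ e (a.filter (· ∈ A))‖ ≤
      C * ‖Finsupp.linearCombination ℝ e a‖ := by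
  have h1 := h _ (linearCombination_mem_biSup_span (e := e) (A := A) (a.filter (· ∈ A)) ?_) _
    (linearCombination_mem_biSup_span (e := e) (A := Aᶜ) (a.filter (· ∉ A)) ?_)
  · rwa [← map_add, Finsupp.filter_add_filter_not] at h1
  · intro i hi
    by_contra hA
    exact hi (by simp [hA])
  · intro i hi
    by_contra hA
    exact hi (Finsupp.filter_apply_neg _ _ (by simpa using hA))

/-- A single term is the difference of two consecutive initial projections. -/
theorem IsSchauderDecomp.norm_coeff_le {e : ℕ → X} {C : ℝ}
    (h : IsSchauderDecomp (fun i => Submodule.span ℝ {e i}) C) (a : ℕ →₀ ℝ) (i : ℕ) :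
    ‖a i • e i‖ ≤ 2 * C * ‖Finsupp.linearCombination ℝ e a‖ := by
  classical
  have h1 := (h (i + 1)).norm_filter_le a
  have h2 := (h i).norm_filter_le a
  have h3 : a i • e i = Finsupp.linearCombination ℝ e (a.filter (· ∈ Set.Iio (i + 1))) -
      Finsupp.linearCombination ℝ e (a.filter (· ∈ Set.Iio i)) := by
    rw [← map_sub, ← Finsupp.linearCombination_single ℝ (a i) i]
    congr 1
    ext j
    simp only [Finsupp.single_apply, Finsupp.sub_apply, Finsupp.filter_apply, Set.mem_Iio]
    rcases lt_trichotomy i j with hj | rfl | hj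
    · simp [hj.ne, show ¬ j < i + 1 by omega, show ¬ j < i by omega]
    · simp
    · simp [hj.ne', show j < i + 1 by omega, hj]
  rw [h3]
  refine (norm_sub_le _ _).trans ?_
  rw [two_mul, add_mul]
  exact add_le_add h1 h2

theorem IsSchauderDecomp.linearIndependent {e : ℕ → X} {C : ℝ} (he : ∀ k, e k ≠ 0)
    (h : IsSchauderDecomp (fun i => Submodule.span ℝ {e i}) C) : LinearIndependent ℝ e := by
  rw [linearIndependent_iff]
  intro a ha
  ext i
  have := h.norm_coeff_le a i
  rw [ha, norm_zero, mul_zero, norm_le_zero_iff] at this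
  simpa [he i] using this

/-- The coordinates are bounded on the span of the sequence, and Hahn–Banach extends them to X. -/
theorem exists_coord_of_isSchauderDecomp {e : ℕ → X} {C : ℝ} (he : ∀ k, e k ≠ 0)
    (h : IsSchauderDecomp (fun i => Submodule.span ℝ {e i}) C) :
    ∃ φ : ℕ → StrongDual ℝ X, ∀ i (a : ℕ →₀ ℝ), φ i (Finsupp.linearCombination ℝ e a) = a i := by
  have hli := h.linearIndependent he
  have : ∀ i, ∃ φ : StrongDual ℝ X, ∀ a : ℕ →₀ ℝ, φ (Finsupp.linearCombination ℝ e a) = a i := by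
    intro i
    let b := Module.Basis.span hli
    have hb : ∀ v, Finsupp.linearCombination ℝ e (b.repr v) = (v : X) := by
      intro v
      have := congrArg (Submodule.subtype _) (b.linearCombination_repr v)
      rw [Finsupp.apply_linearCombination] at this
      refine Eq.trans ?_ this
      congr 2
      ext j
      simp [b, Module.Basis.span_apply]
    let f : Submodule.span ℝ (Set.range e) →L[ℝ] ℝ := (b.coord i).mkContinuous (2 * C / ‖e i‖)
      (fun v => by
        have := h.norm_coeff_le (b.repr v) i
        rw [hb, norm_smul] at this
        rw [Module.Basis.coord_apply, div_mul_eq_mul_div, le_div_iff₀ (norm_pos_iff.2 (he i))]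
        exact this)
    obtain ⟨g, hg, -⟩ := exists_extension_norm_eq _ f
    refine ⟨g, fun a => ?_⟩
    have hmem : Finsupp.linearCombination ℝ e a ∈ Submodule.span ℝ (Set.range e) :=
      Finsupp.mem_span_range_iff_exists_finsupp.2 ⟨a, rfl⟩
    have h1 := hg ⟨_, hmem⟩
    have h2 : b.repr ⟨_, hmem⟩ = a := hli (hb _)
    rw [h1]
    simp [f, h2]
  choose φ hφ using this
  exact ⟨φ, hφ⟩

/-- The projections onto finite sets are bounded along L and are eventually the identity on each
vector of the dense span; hence they converge pointwise to the identity on the closure. The general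
filter L serves ordered and unconditional sums at once. -/
theorem exists_generalSchauderBasis {e : ℕ → X} {C D : ℝ} (he : ∀ k, e k ≠ 0)
    (h : IsSchauderDecomp (fun i => Submodule.span ℝ {e i}) C) (L : SummationFilter ℕ)
    (hL : L.filter ≤ atTop)
    (hD : ∀ᶠ A : Finset ℕ in L.filter, ProjBound (fun i => Submodule.span ℝ {e i}) (A : Set ℕ) D) :
    Nonempty (GeneralSchauderBasis ℕ ℝ (Submodule.span ℝ (Set.range e)).topologicalClosure L) := by
  classical
  obtain ⟨φ, hφ⟩ := exists_coord_of_isSchauderDecomp he h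
  let Y := (Submodule.span ℝ (Set.range e)).topologicalClosure
  have heY : ∀ i, e i ∈ Y := fun i =>
    Submodule.le_topologicalClosure _ (Submodule.subset_span ⟨i, rfl⟩)
  have hD' : ∀ᶠ A in L.filter, ∀ x ∈ Y, ‖∑ i ∈ A, φ i x • e i‖ ≤ D * ‖x‖ := by
    filter_upwards [hD] with A hA x hx
    have hcl : IsClosed {x : X | ‖∑ i ∈ A, φ i x • e i‖ ≤ D * ‖x‖} :=
      isClosed_le (by fun_prop) (by fun_prop)
    refine closure_minimal (s := (Submodule.span ℝ (Set.range e) : Set X)) (fun v hv => ?_) hcl hx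
    obtain ⟨a, rfl⟩ := Finsupp.mem_span_range_iff_exists_finsupp.1 hv
    have h1 : ‖Finsupp.linearCombination ℝ e (a.filter (· ∈ A))‖ ≤
      D * ‖Finsupp.linearCombination ℝ e a‖ := by
        let _ : DecidablePred (· ∈ (A : Set ℕ)) := fun i => Finset.decidableMem' i A
        exact hA.norm_filter_le a
    rw [Finsupp.linearCombination_apply, Finsupp.sum_of_support_subset (s := A)] at h1
    · simp only [← Finsupp.linearCombination_apply, Set.mem_ofPred_eq, hφ] at h1 ⊢
      convert h1 using 2
      · refine Finset.sum_congr rfl fun i hi => ?_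
        rw [Finsupp.filter_apply_pos _ _ (by simpa using hi)]
    · intro i hi
      simp at hi
      simp [hi.2]
    · simp
  refine ⟨⟨fun i => ⟨e i, heY i⟩, fun i => (φ i).comp Y.subtypeL, fun i j => ?_, fun x => ?_⟩⟩
  · have := hφ i (Finsupp.single j 1)
    simp only [Finsupp.linearCombination_single, one_smul] at this
    simp [this, Finsupp.single_apply, Pi.single_apply, eq_comm]
  · change Tendsto _ _ _
    rw [tendsto_subtype_rng, Metric.tendsto_nhds]
    intro ε hε
    have hD0 : 0 < |D| + 1 := by positivity
    obtain ⟨v, hv, hxv⟩ := Metric.mem_closure_iff.1 x.2 (ε / (|D| + 1 + 1)) (by positivity)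
    obtain ⟨a, rfl⟩ := Finsupp.mem_span_range_iff_exists_finsupp.1 hv
    filter_upwards [hD', hL (eventually_ge_atTop a.support)] with A hA hAa
    set v := a.sum fun i c => c • e i with hvdef
    have hvA : ∑ i ∈ A, φ i v • e i = v := by
      simp only [hvdef, ← Finsupp.linearCombination_apply, hφ]
      rw [Finsupp.linearCombination_apply, Finsupp.sum_of_support_subset _ hAa]
      simp
    have hvY : v ∈ Y := Submodule.le_topologicalClosure _ hv
    have h1 := hA _ (Y.sub_mem x.2 hvY)
    have h2 : ((∑ i ∈ A, ((φ i).comp Y.subtypeL) x • (⟨e i, heY i⟩ : Y) : Y) : X) - x =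
        ∑ i ∈ A, φ i (x - v) • e i - (x - v) := by
      simp only [map_sub, sub_smul, Finset.sum_sub_distrib, hvA]
      simp
    rw [dist_eq_norm, h2]
    rw [dist_eq_norm] at hxv
    calc _ ≤ ‖∑ i ∈ A, φ i (x - v) • e i‖ + ‖(x : X) - v‖ := norm_sub_le _ _
      _ ≤ |D| * ‖(x : X) - v‖ + ‖(x : X) - v‖ := by
          gcongr
          exact h1.trans (by gcongr; exact le_abs_self D)
      _ < ε := by
          rw [lt_div_iff₀ (by positivity)] at hxv
          nlinarith [norm_nonneg ((x : X) - v)]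

theorem exists_schauderBasis {e : ℕ → X} {C : ℝ} (he : ∀ k, e k ≠ 0)
    (h : IsSchauderDecomp (fun i => Submodule.span ℝ {e i}) C) :
    Nonempty (SchauderBasis ℝ (Submodule.span ℝ (Set.range e)).topologicalClosure) := by
  refine exists_generalSchauderBasis he h _ ?_ (D := C) ?_
  · rw [SummationFilter.conditional_filter_eq_map_range]
    exact tendsto_finset_range
  · rw [SummationFilter.conditional_filter_eq_map_range, eventually_map]
    refine Eventually.of_forall fun n => ?_
    simpa using h n

theorem exists_unconditionalSchauderBasis {e : ℕ → X} {C : ℝ} (he : ∀ k, e k ≠ 0)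
    (h : IsUncondDecomp (fun i => Submodule.span ℝ {e i}) C) :
    Nonempty (UnconditionalSchauderBasis ℕ ℝ
      (Submodule.span ℝ (Set.range e)).topologicalClosure) :=
  exists_generalSchauderBasis he h.isSchauderDecomp _ (by simp) (D := C)
    (Eventually.of_forall fun A => h _)

end Decomposition

/-! ### Sign averages and rotation-invariant averages -/

section Kwapien

open MeasureTheory

/-- The sign attached to a Boolean. -/
def boolSign (b : Bool) : ℝ := cond b 1 (-1)

theorem boolSign_mul_self (b : Bool) : boolSign b * boolSign b = 1 := by
  cases b <;> simp [boolSign]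

theorem boolSign_not (b : Bool) : boolSign (!b) = -boolSign b := by
  cases b <;> simp [boolSign]

/-- Off the diagonal, flipping the sign at i alone changes the sign of every summand. -/
theorem sum_boolSign_mul_boolSign {ι : Type*} [Fintype ι] [DecidableEq ι] (i j : ι) :
    ∑ ω : ι → Bool, boolSign (ω i) * boolSign (ω j) =
      if i = j then (Fintype.card (ι → Bool) : ℝ) else 0 := by
  split_ifs with h
  · subst h
    simp [boolSign_mul_self]
  · let flip : (ι → Bool) ≃ (ι → Bool) :=
      { toFun := fun ω => Function.update ω i (!ω i)
        invFun := fun ω => Function.update ω i (!ω i)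
        left_inv := fun ω => by simp
        right_inv := fun ω => by simp }
    have h1 := Equiv.sum_comp flip fun ω => boolSign (ω i) * boolSign (ω j)
    have h2 : ∀ ω, boolSign (flip ω i) * boolSign (flip ω j) =
        -(boolSign (ω i) * boolSign (ω j)) := fun ω => by
      simp [flip, Function.update_of_ne (Ne.symm h), boolSign_not]
    simp only [h2, Finset.sum_neg_distrib] at h1
    linarith

/-- Averaging a quadratic form over signs removes the cross terms. -/
theorem sum_sign_bilin {V ι : Type*} [AddCommGroup V] [Module ℝ V] [Fintype ι] [DecidableEq ι]
    (B : V →ₗ[ℝ] V →ₗ[ℝ] ℝ) (x : ι → V) :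
    ∑ ω : ι → Bool, B (∑ i, boolSign (ω i) • x i) (∑ i, boolSign (ω i) • x i) =
      Fintype.card (ι → Bool) * ∑ i, B (x i) (x i) := by
  have h1 : ∀ ω : ι → Bool, B (∑ i, boolSign (ω i) • x i) (∑ i, boolSign (ω i) • x i) =
      ∑ i, ∑ j, (boolSign (ω i) * boolSign (ω j)) * B (x i) (x j) := fun ω => by
    simp only [map_sum, map_smul, LinearMap.sum_apply, LinearMap.smul_apply, smul_eq_mul, Finset.mul_sum]
    rw [Finset.sum_comm]
    refine Finset.sum_congr rfl fun i _ => Finset.sum_congr rfl fun j _ => ?_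
    ring
  simp only [h1]
  rw [Finset.sum_comm, Finset.mul_sum]
  refine Finset.sum_congr rfl fun i _ => ?_
  rw [Finset.sum_comm]
  simp only [← Finset.sum_mul, sum_boolSign_mul_boolSign, ite_mul, zero_mul]
  simp

/-- The maps φ ↦ (φ(x i)) and φ ↦ (φ(y i)) have equal norms, so one is the other followed by an
isometry of the range. In finite dimension this extends to an isometry of the whole space, whose
inverse is U. -/
theorem exists_linearIsometryEquiv_of_sum_sq_eq {V ι : Type*} [AddCommGroup V] [Module ℝ V]
    [Fintype ι] (x y : ι → V)
    (h : ∀ φ : V →ₗ[ℝ] ℝ, ∑ i, φ (x i) ^ 2 = ∑ i, φ (y i) ^ 2) :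
    ∃ U : EuclideanSpace ℝ ι ≃ₗᵢ[ℝ] EuclideanSpace ℝ ι,
      ∀ g, ∑ i, (U g) i • x i = ∑ i, g i • y i := by
  let ev : (ι → V) → Module.Dual ℝ V →ₗ[ℝ] EuclideanSpace ℝ ι := fun z =>
    (WithLp.linearEquiv 2 ℝ (ι → ℝ)).symm.toLinearMap ∘ₗ
      LinearMap.pi fun i => Module.Dual.eval ℝ V (z i)
  have hev : ∀ z φ i, ev z φ i = φ (z i) := fun z φ i => rfl
  have hnorm : ∀ φ, ‖ev y φ‖ = ‖ev x φ‖ := fun φ => by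
    rw [← pow_left_inj₀ (norm_nonneg _) (norm_nonneg _) two_ne_zero,
      EuclideanSpace.real_norm_sq_eq, EuclideanSpace.real_norm_sq_eq]
    simp only [hev, h]
  obtain ⟨s, hs⟩ := LinearMap.exists_rightInverse_of_surjective (ev x).rangeRestrict
    (LinearMap.range_rangeRestrict _)
  have hs' : ∀ z, ev x (s z) = z := fun z =>
    congrArg Subtype.val (LinearMap.congr_fun hs z)
  let L0 : LinearMap.range (ev x) →ₗᵢ[ℝ] EuclideanSpace ℝ ι :=
    ⟨ev y ∘ₗ s, fun z => by
      rw [LinearMap.comp_apply, hnorm, hs']; rfl⟩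
  have hL : ∀ φ, L0.extend (ev x φ) = ev y φ := fun φ => by
    have h1 := L0.extend_apply ⟨ev x φ, LinearMap.mem_range_self _ φ⟩
    refine Eq.trans h1 ?_
    change ev y (s _) = _
    rw [← sub_eq_zero, ← map_sub, ← norm_eq_zero, hnorm, map_sub, hs', sub_self, norm_zero]
  let U := L0.extend.toLinearIsometryEquiv rfl
  refine ⟨U.symm, fun g => ?_⟩
  rw [← sub_eq_zero, ← Module.forall_dual_apply_eq_zero_iff ℝ]
  intro φ
  have key : ∀ z (k : EuclideanSpace ℝ ι), φ (∑ i, k i • z i) = inner ℝ (ev z φ) k := fun z k => by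
    simp [PiLp.inner_apply, hev]
  rw [map_sub, key, key, ← U.inner_map_map]
  change inner ℝ (L0.extend _) (U (U.symm g)) - _ = 0
  rw [hL, LinearIsometryEquiv.apply_symm_apply, sub_self]

variable {V : Type*} [NormedAddCommGroup V] [NormedSpace ℝ V]

theorem setIntegral_closedBall_comp_isometry {ι : Type*} [Fintype ι]
    (U : EuclideanSpace ℝ ι ≃ₗᵢ[ℝ] EuclideanSpace ℝ ι) (f : EuclideanSpace ℝ ι → ℝ) :
    ∫ g in Metric.closedBall 0 1, f (U g) = ∫ g in Metric.closedBall 0 1, f g := by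
  have := U.measurePreserving.setIntegral_preimage_emb
    U.toHomeomorph.measurableEmbedding f (Metric.closedBall 0 1)
  rw [← this]
  congr 2
  change _ = U ⁻¹' _
  rw [LinearIsometryEquiv.preimage_closedBall, map_zero]

theorem integrableOn_closedBall {ι : Type*} [Fintype ι] {f : EuclideanSpace ℝ ι → ℝ}
    (hf : Continuous f) : IntegrableOn f (Metric.closedBall 0 1) :=
  hf.continuousOn.integrableOn_compact (isCompact_closedBall 0 1)

theorem setIntegral_sq_coord_pos {ι : Type*} [Fintype ι] (i : ι) :
    0 < ∫ g : EuclideanSpace ℝ ι in Metric.closedBall 0 1, g i ^ 2 := by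
  classical
  rw [setIntegral_pos_iff_support_of_nonneg_ae (Eventually.of_forall fun g => sq_nonneg _)
    (integrableOn_closedBall (by fun_prop))]
  refine lt_of_lt_of_le (IsOpen.measure_pos volume
    (U := {g : EuclideanSpace ℝ ι | g i ≠ 0} ∩ Metric.ball 0 1) ?_ ?_) (measure_mono ?_)
  · exact (isOpen_ne_fun (by fun_prop) (by fun_prop)).inter Metric.isOpen_ball
  · refine ⟨EuclideanSpace.single i (1 / 2), ?_, ?_⟩
    · simp
    · simp; norm_num
  · rintro g ⟨h1, h2⟩
    exact ⟨by simpa using h1, Metric.ball_subset_closedBall h2⟩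

theorem setIntegral_sq_coord_eq {ι : Type*} [Fintype ι] (i j : ι) :
    ∫ g : EuclideanSpace ℝ ι in Metric.closedBall 0 1, g i ^ 2 =
      ∫ g : EuclideanSpace ℝ ι in Metric.closedBall 0 1, g j ^ 2 := by
  classical
  rw [← setIntegral_closedBall_comp_isometry
    (LinearIsometryEquiv.piLpCongrLeft 2 ℝ ℝ (Equiv.swap i j))]
  simp [LinearIsometryEquiv.piLpCongrLeft_apply, Equiv.piCongrLeft']

/-- A seminorm for which Rademacher averages are equivalent to square sums is also such for
rotation invariant averages. -/
theorem setIntegral_closedBall_bounds {ι : Type*} [Fintype ι] [DecidableEq ι] (p : Seminorm ℝ V)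
    (hp : Continuous p) {a : ℝ}
    (h : ∀ x : ι → V,
      ∑ ω : ι → Bool, p (∑ i, boolSign (ω i) • x i) ^ 2 ≤
        a * (Fintype.card (ι → Bool) * ∑ i, p (x i) ^ 2) ∧
      Fintype.card (ι → Bool) * ∑ i, p (x i) ^ 2 ≤
        a * ∑ ω : ι → Bool, p (∑ i, boolSign (ω i) • x i) ^ 2)
    {c : ℝ} (hc : ∀ i, ∫ g : EuclideanSpace ℝ ι in Metric.closedBall 0 1, g i ^ 2 = c)
    (x : ι → V) :
    (∫ g : EuclideanSpace ℝ ι in Metric.closedBall 0 1, p (∑ i, g i • x i) ^ 2) ≤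
        a * (c * ∑ i, p (x i) ^ 2) ∧
      c * ∑ i, p (x i) ^ 2 ≤
        a * ∫ g : EuclideanSpace ℝ ι in Metric.closedBall 0 1, p (∑ i, g i • x i) ^ 2 := by
  set I := ∫ g : EuclideanSpace ℝ ι in Metric.closedBall 0 1, p (∑ i, g i • x i) ^ 2 with hI
  have hN : (0 : ℝ) < Fintype.card (ι → Bool) := by exact_mod_cast Fintype.card_pos
  -- Coordinate reflections preserve the ball, so signs may be inserted for free. Averaging over
  -- them allows the hypothesis to be applied pointwise in g to the vectors g i • x i.
  have hflip : ∀ ω : ι → Bool, I = ∫ g : EuclideanSpace ℝ ι in Metric.closedBall 0 1,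
      p (∑ i, boolSign (ω i) • g i • x i) ^ 2 := fun ω => by
    let U : EuclideanSpace ℝ ι ≃ₗᵢ[ℝ] EuclideanSpace ℝ ι :=
      LinearIsometryEquiv.piLpCongrRight 2 fun i =>
        cond (ω i) (LinearIsometryEquiv.refl ℝ ℝ) (LinearIsometryEquiv.neg ℝ)
    rw [hI, ← setIntegral_closedBall_comp_isometry U]
    refine integral_congr_ae (Eventually.of_forall fun g => ?_)
    simp only
    congr 2
    refine Finset.sum_congr rfl fun i _ => ?_
    simp only [U, LinearIsometryEquiv.piLpCongrRight_apply, boolSign]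
    cases ω i <;> simp
  have hint : ∀ ω : ι → Bool, IntegrableOn (fun g : EuclideanSpace ℝ ι =>
      p (∑ i, boolSign (ω i) • g i • x i) ^ 2) (Metric.closedBall 0 1) := fun ω =>
    integrableOn_closedBall (by fun_prop)
  have hsum : Fintype.card (ι → Bool) * I = ∫ g : EuclideanSpace ℝ ι in Metric.closedBall 0 1,
      ∑ ω : ι → Bool, p (∑ i, boolSign (ω i) • g i • x i) ^ 2 := by
    rw [integral_finsetSum _ fun ω _ => hint ω, ← Finset.card_univ, ← nsmul_eq_mul,
      ← Finset.sum_const]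
    exact Finset.sum_congr rfl fun ω _ => hflip ω
  have hsq : ∫ g : EuclideanSpace ℝ ι in Metric.closedBall 0 1, ∑ i, p (g i • x i) ^ 2 =
      c * ∑ i, p (x i) ^ 2 := by
    rw [integral_finsetSum _ fun i _ => integrableOn_closedBall (by fun_prop), Finset.mul_sum]
    refine Finset.sum_congr rfl fun i _ => ?_
    rw [← hc i, ← integral_mul_const]
    refine integral_congr_ae (Eventually.of_forall fun g => ?_)
    simp only [map_smul_eq_mul, mul_pow, Real.norm_eq_abs, sq_abs]
  constructor
  · have : Fintype.card (ι → Bool) * I ≤ Fintype.card (ι → Bool) * (a * (c * ∑ i, p (x i) ^ 2)) := by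
      calc Fintype.card (ι → Bool) * I ≤ ∫ g : EuclideanSpace ℝ ι in Metric.closedBall 0 1,
            a * (Fintype.card (ι → Bool) * ∑ i, p (g i • x i) ^ 2) := by
            rw [hsum]
            refine setIntegral_mono (integrableOn_closedBall (by fun_prop))
              (integrableOn_closedBall (by fun_prop)) fun g => (h fun i => g i • x i).1
        _ = _ := by
            rw [integral_const_mul, integral_const_mul, hsq]; ring
    exact le_of_mul_le_mul_left this hN
  · have : Fintype.card (ι → Bool) * (c * ∑ i, p (x i) ^ 2) ≤ Fintype.card (ι → Bool) * (a * I) := by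
      calc Fintype.card (ι → Bool) * (c * ∑ i, p (x i) ^ 2)
          = ∫ g : EuclideanSpace ℝ ι in Metric.closedBall 0 1,
            Fintype.card (ι → Bool) * ∑ i, p (g i • x i) ^ 2 := by
            rw [integral_const_mul, hsq]
        _ ≤ ∫ g : EuclideanSpace ℝ ι in Metric.closedBall 0 1,
            a * ∑ ω : ι → Bool, p (∑ i, boolSign (ω i) • g i • x i) ^ 2 :=
            setIntegral_mono (integrableOn_closedBall (by fun_prop))
              (integrableOn_closedBall (by fun_prop)) fun g => (h fun i => g i • x i).2
        _ = _ := by rw [integral_const_mul, ← hsum]; ring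
    exact le_of_mul_le_mul_left this hN

/-- Families with the same second moments have comparable square sums. -/
theorem sum_sq_le_of_same_moments {ι : Type*} [Fintype ι] [DecidableEq ι] (p : Seminorm ℝ V)
    (hp : Continuous p) {a : ℝ} (ha : 0 ≤ a)
    (h : ∀ x : ι → V,
      ∑ ω : ι → Bool, p (∑ i, boolSign (ω i) • x i) ^ 2 ≤
        a * (Fintype.card (ι → Bool) * ∑ i, p (x i) ^ 2) ∧
      Fintype.card (ι → Bool) * ∑ i, p (x i) ^ 2 ≤
        a * ∑ ω : ι → Bool, p (∑ i, boolSign (ω i) • x i) ^ 2)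
    (x y : ι → V) (hxy : ∀ φ : V →ₗ[ℝ] ℝ, ∑ i, φ (x i) ^ 2 = ∑ i, φ (y i) ^ 2) :
    ∑ i, p (y i) ^ 2 ≤ a ^ 2 * ∑ i, p (x i) ^ 2 := by
  rcases isEmpty_or_nonempty ι with hι | ⟨⟨i0⟩⟩
  · simp
  obtain ⟨U, hU⟩ := exists_linearIsometryEquiv_of_sum_sq_eq x y hxy
  have hc := fun i => setIntegral_sq_coord_eq i i0
  have hc0 := setIntegral_sq_coord_pos i0
  set c := ∫ g : EuclideanSpace ℝ ι in Metric.closedBall 0 1, g i0 ^ 2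
  have hx := (setIntegral_closedBall_bounds p hp h hc x).1
  have hy := (setIntegral_closedBall_bounds p hp h hc y).2
  -- The family y is a rotation of x, so both families have the same ball average; this links the
  -- upper bound for x to the lower bound for y.
  have hI := setIntegral_closedBall_comp_isometry U fun g => p (∑ i, g i • x i) ^ 2
  simp only [hU] at hI
  rw [hI] at hy
  have : c * ∑ i, p (y i) ^ 2 ≤ c * (a ^ 2 * ∑ i, p (x i) ^ 2) :=
    calc _ ≤ _ := hy
      _ ≤ a * (a * (c * ∑ i, p (x i) ^ 2)) := by gcongr
      _ = _ := by ring
  exact le_of_mul_le_mul_left this hc0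

end Kwapien

/-! ### Kwapień's theorem by extending a positive functional -/

section KwapienSeparation

/-- Quadratic Rademacher averages of `p` are comparable with square sums. -/
def RademacherComparable {V : Type*} [AddCommGroup V] [Module ℝ V] (p : V → ℝ) (a : ℝ) : Prop :=
  ∀ (n : ℕ) (x : Fin n → V),
    ∑ ω : Fin n → Bool, p (∑ i, boolSign (ω i) • x i) ^ 2 ≤
        a * (Fintype.card (Fin n → Bool) * ∑ i, p (x i) ^ 2) ∧
      Fintype.card (Fin n → Bool) * ∑ i, p (x i) ^ 2 ≤
        a * ∑ ω : Fin n → Bool, p (∑ i, boolSign (ω i) • x i) ^ 2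

theorem RademacherComparable.fintype {V : Type*} [AddCommGroup V] [Module ℝ V] {p : V → ℝ} {a : ℝ}
    (h : RademacherComparable p a) {ι : Type*} [Fintype ι] [DecidableEq ι] (x : ι → V) :
    ∑ ω : ι → Bool, p (∑ i, boolSign (ω i) • x i) ^ 2 ≤
        a * (Fintype.card (ι → Bool) * ∑ i, p (x i) ^ 2) ∧
      Fintype.card (ι → Bool) * ∑ i, p (x i) ^ 2 ≤
        a * ∑ ω : ι → Bool, p (∑ i, boolSign (ω i) • x i) ^ 2 := by
  let e := (Fintype.equivFin ι).symm
  have h1 := h _ (x ∘ e)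
  let E : (Fin (Fintype.card ι) → Bool) ≃ (ι → Bool) := Equiv.arrowCongr e (Equiv.refl Bool)
  have h2 : ∑ ω : ι → Bool, p (∑ i, boolSign (ω i) • x i) ^ 2 =
      ∑ ω : Fin (Fintype.card ι) → Bool, p (∑ i, boolSign (ω i) • (x ∘ e) i) ^ 2 := by
    rw [← Equiv.sum_comp E]
    refine Finset.sum_congr rfl fun ω _ => ?_
    rw [← Equiv.sum_comp e fun i => boolSign (E ω i) • x i]
    simp [E]
  have h3 : ∑ i, p (x i) ^ 2 = ∑ i, p ((x ∘ e) i) ^ 2 :=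
    (Equiv.sum_comp e fun i => p (x i) ^ 2).symm
  rw [h2, h3, ← Fintype.card_congr E]
  exact h1

variable {V : Type*} [NormedAddCommGroup V] [NormedSpace ℝ V]

/-- Evaluation of a tensor at `φ ⊗ φ`. -/
noncomputable def tensorSq (φ : V →ₗ[ℝ] ℝ) : TensorProduct ℝ V V →ₗ[ℝ] ℝ :=
  TensorProduct.lift ((LinearMap.mul ℝ ℝ).compl₁₂ φ φ)

@[simp]
theorem tensorSq_tmul (φ : V →ₗ[ℝ] ℝ) (u v : V) : tensorSq φ (TensorProduct.tmul ℝ u v) = φ u * φ v := by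
  simp [tensorSq]

/-- `z` is dominated by a representation of its tensor part as a difference of sums of squares. -/
def IsSquareDominated (p : V → ℝ) (A : ℝ) (z : TensorProduct ℝ V V × ℝ) : Prop :=
  ∃ (ι : Type) (_ : Fintype ι) (x y : ι → V),
    (∀ φ : V →ₗ[ℝ] ℝ, tensorSq φ z.1 = ∑ i, φ (x i) ^ 2 - ∑ i, φ (y i) ^ 2) ∧
      A * ∑ i, p (x i) ^ 2 - ∑ i, p (y i) ^ 2 ≤ z.2

/-- The cone of square dominated pairs. -/
def squareCone (p : Seminorm ℝ V) (A : ℝ) : PointedCone ℝ (TensorProduct ℝ V V × ℝ) where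
  carrier := {z | IsSquareDominated p A z}
  add_mem' := by
    rintro z z' ⟨ι, _, x, y, h1, h2⟩ ⟨ι', _, x', y', h1', h2'⟩
    refine ⟨ι ⊕ ι', inferInstance, Sum.elim x x', Sum.elim y y', fun φ => ?_, ?_⟩
    · simp only [Prod.fst_add, map_add, h1, h1', Fintype.sum_sum_type, Sum.elim_inl, Sum.elim_inr]
      ring
    · simp only [Prod.snd_add, Fintype.sum_sum_type, Sum.elim_inl, Sum.elim_inr]
      linarith
  zero_mem' := ⟨Empty, inferInstance, Empty.elim, Empty.elim, by simp, by simp⟩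
  smul_mem' := by
    rintro ⟨c, hc⟩ z ⟨ι, _, x, y, h1, h2⟩
    refine ⟨ι, inferInstance, fun i => √c • x i, fun i => √c • y i, fun φ => ?_, ?_⟩
    · have : (⟨c, hc⟩ : {c : ℝ // 0 ≤ c}) • z = c • z := rfl
      simp only [this, Prod.smul_fst, map_smul, smul_eq_mul, h1, mul_pow, Real.sq_sqrt hc,
        ← Finset.mul_sum]
      ring
    · have : (⟨c, hc⟩ : {c : ℝ // 0 ≤ c}) • z = c • z := rfl
      simp only [this, Prod.smul_snd, map_smul_eq_mul, smul_eq_mul, mul_pow, Real.norm_eq_abs,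
        sq_abs, Real.sq_sqrt hc, ← Finset.mul_sum]
      have := mul_le_mul_of_nonneg_left h2 hc
      linarith

/-- Polarization: φ(u)φ(v) is a difference of the squares of φ((u + v)/2) and φ((u - v)/2). This
gives the absorption condition needed for the extension theorem. -/
theorem exists_tensorSq_eq (t : TensorProduct ℝ V V) :
    ∃ (ι : Type) (_ : Fintype ι) (x y : ι → V),
      ∀ φ : V →ₗ[ℝ] ℝ, tensorSq φ t = ∑ i, φ (x i) ^ 2 - ∑ i, φ (y i) ^ 2 := by
  induction t using TensorProduct.induction_on with
  | zero => exact ⟨Empty, inferInstance, Empty.elim, Empty.elim, by simp⟩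
  | tmul u v =>
    refine ⟨Unit, inferInstance, fun _ => (1 / 2 : ℝ) • (u + v), fun _ => (1 / 2 : ℝ) • (u - v),
      fun φ => ?_⟩
    simp
    ring
  | add t t' ht ht' =>
    obtain ⟨ι, _, x, y, h⟩ := ht
    obtain ⟨ι', _, x', y', h'⟩ := ht'
    refine ⟨ι ⊕ ι', inferInstance, Sum.elim x x', Sum.elim y y', fun φ => ?_⟩
    simp only [map_add, h, h', Fintype.sum_sum_type, Sum.elim_inl, Sum.elim_inr]
    ring

/-- **Kwapień's theorem**: a seminorm of type 2 and cotype 2 is Hilbertian. -/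
theorem RademacherComparable.hilbertComparable (p : Seminorm ℝ V) (hp : Continuous p) {a : ℝ}
    (ha : 0 ≤ a) (h : RademacherComparable p a) : HilbertComparable p (a ^ 2) := by
  -- On the line {0} × ℝ the functional (0, r) ↦ r is nonnegative on the cone, because a zero tensor
  -- part means equal second moments. A positive extension g yields the form -g(x ⊗ x, 0).
  let f : (TensorProduct ℝ V V × ℝ) →ₗ.[ℝ] ℝ := (LinearMap.snd ℝ (TensorProduct ℝ V V) ℝ).toPMap
    (LinearMap.range (LinearMap.inr ℝ (TensorProduct ℝ V V) ℝ))
  obtain ⟨g, hg, hgs⟩ := riesz_extension (squareCone p (a ^ 2)) f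
    (by
      rintro ⟨_, r, rfl⟩ ⟨ι, _, x, y, h1, h2⟩
      classical
      have := sum_sq_le_of_same_moments p hp ha (fun x => h.fintype x) x y fun φ => by
        have := h1 φ
        simp only [LinearMap.inr_apply, map_zero] at this
        linarith
      change 0 ≤ r
      simp only [LinearMap.inr_apply] at h2
      linarith)
    (by
      rintro ⟨t, r⟩
      obtain ⟨ι, _, x, y, h1⟩ := exists_tensorSq_eq t
      refine ⟨⟨(0, a ^ 2 * ∑ i, p (x i) ^ 2 - ∑ i, p (y i) ^ 2 - r), _, rfl⟩, ι, inferInstance, x, y,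
        fun φ => ?_, ?_⟩
      · simpa using h1 φ
      · simp)
  have hg2 : ∀ r, g (0, r) = r := fun r => hg ⟨(0, r), r, rfl⟩
  have hsplit : ∀ t r, g (t, r) = g (t, 0) + r := fun t r => by
    rw [← hg2 r, ← map_add]
    simp [hg2]
  refine ⟨-(TensorProduct.mk ℝ V V).compr₂ (g ∘ₗ LinearMap.inl ℝ _ ℝ) , fun x => ⟨?_, ?_⟩⟩
  -- The two bounds are positivity of g at (-x ⊗ x, -p(x)²) and at (x ⊗ x, a² p(x)²), both of which
  -- lie in the cone.
  · have := hgs (-(TensorProduct.tmul ℝ x x), -p x ^ 2)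
      ⟨Unit, inferInstance, fun _ => 0, fun _ => x, fun φ => by simp; ring, by simp⟩
    rw [hsplit, ← neg_zero, ← Prod.neg_mk, map_neg] at this
    simp
    simp at this
    linarith
  · have := hgs (TensorProduct.tmul ℝ x x, a ^ 2 * p x ^ 2)
      ⟨Unit, inferInstance, fun _ => x, fun _ => 0, fun φ => by simp; ring, by simp⟩
    rw [hsplit] at this
    simp
    linarith

end KwapienSeparation

/-! ### Type 2 and cotype 2 from ℓ₂-sums of copies -/

section Copies

variable {X : Type u} [NormedAddCommGroup X] [NormedSpace ℝ X]

/-- In a Hilbertian space, norms of unconditional sums are comparable with square sums. -/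
theorem sum_sq_comparable_of_unconditional {ι : Type*} [Fintype ι] [DecidableEq ι] (x : ι → X)
    {M : ℝ} (hM : ∀ ω ω' : ι → Bool,
      ‖∑ i, boolSign (ω i) • x i‖ ≤ M * ‖∑ i, boolSign (ω' i) • x i‖) {c : ℝ} (hc : 0 ≤ c)
    (h : (Submodule.span ℝ (Set.range x)).HilbertComparable c) :
    ‖∑ i, x i‖ ^ 2 ≤ M ^ 2 * c * ∑ i, ‖x i‖ ^ 2 ∧
      ∑ i, ‖x i‖ ^ 2 ≤ M ^ 2 * c * ‖∑ i, x i‖ ^ 2 := by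
  obtain ⟨B, hB⟩ := h
  let x' : ι → Submodule.span ℝ (Set.range x) := fun i => ⟨x i, Submodule.subset_span ⟨i, rfl⟩⟩
  -- Averaging B over all signs leaves only its diagonal, and unconditionality replaces each signed
  -- sum by the unsigned one at the cost of M.
  have hsum := sum_sign_bilin B x'
  have hco : ∀ ω : ι → Bool, ((∑ i, boolSign (ω i) • x' i : Submodule.span ℝ (Set.range x)) : X) =
      ∑ i, boolSign (ω i) • x i := fun ω => by simp [x']
  have hB' : ∀ ω : ι → Bool, ‖∑ i, boolSign (ω i) • x i‖ ^ 2 ≤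
      B (∑ i, boolSign (ω i) • x' i) (∑ i, boolSign (ω i) • x' i) ∧
      B (∑ i, boolSign (ω i) • x' i) (∑ i, boolSign (ω i) • x' i) ≤
        c * ‖∑ i, boolSign (ω i) • x i‖ ^ 2 := fun ω => by
    have := hB (∑ i, boolSign (ω i) • x' i)
    simp only [hco] at this
    exact this
  have hN : (0 : ℝ) < Fintype.card (ι → Bool) := by exact_mod_cast Fintype.card_pos
  have h1 : ∑ i, x i = ∑ i, boolSign ((fun _ => true : ι → Bool) i) • x i := by simp [boolSign]
  have hconst : ∀ r : ℝ, Fintype.card (ι → Bool) * r = ∑ _ω : ι → Bool, r := fun r => by simp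
  constructor
  · refine le_of_mul_le_mul_left ?_ hN
    calc Fintype.card (ι → Bool) * ‖∑ i, x i‖ ^ 2
        = ∑ ω : ι → Bool, ‖∑ i, x i‖ ^ 2 := hconst _
      _ ≤ ∑ ω : ι → Bool, M ^ 2 *
          B (∑ i, boolSign (ω i) • x' i) (∑ i, boolSign (ω i) • x' i) := by
          refine Finset.sum_le_sum fun ω _ => ?_
          calc ‖∑ i, x i‖ ^ 2 ≤ (M * ‖∑ i, boolSign (ω i) • x i‖) ^ 2 := by
                rw [h1]; gcongr; exact hM _ _
            _ = M ^ 2 * ‖∑ i, boolSign (ω i) • x i‖ ^ 2 := by ring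
            _ ≤ _ := by gcongr; exact (hB' ω).1
      _ = M ^ 2 * (Fintype.card (ι → Bool) * ∑ i, B (x' i) (x' i)) := by
          rw [← Finset.mul_sum, hsum]
      _ ≤ M ^ 2 * (Fintype.card (ι → Bool) * ∑ i, c * ‖x i‖ ^ 2) := by
          gcongr with i
          exact (hB (x' i)).2
      _ = _ := by rw [← Finset.mul_sum]; ring
  · refine le_of_mul_le_mul_left ?_ hN
    calc Fintype.card (ι → Bool) * ∑ i, ‖x i‖ ^ 2
        ≤ Fintype.card (ι → Bool) * ∑ i, B (x' i) (x' i) := by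
          gcongr with i
          exact (hB (x' i)).1
      _ = ∑ ω : ι → Bool, B (∑ i, boolSign (ω i) • x' i) (∑ i, boolSign (ω i) • x' i) := hsum.symm
      _ ≤ ∑ ω : ι → Bool, c * (M * ‖∑ i, x i‖) ^ 2 := by
          refine Finset.sum_le_sum fun ω _ => (hB' ω).2.trans ?_
          rw [h1]; gcongr; exact hM _ _
      _ = Fintype.card (ι → Bool) * (c * (M * ‖∑ i, x i‖) ^ 2) := (hconst _).symm
      _ = _ := by ring

theorem projBound_span_of {ι : Type*} {u : ι → X} {A : Set ι} {C : ℝ}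
    (h : ∀ α β : ι →₀ ℝ, (∀ i ∉ A, α i = 0) → (∀ i ∈ A, β i = 0) →
      ‖Finsupp.linearCombination ℝ u α‖ ≤ C * ‖Finsupp.linearCombination ℝ u (α + β)‖) :
    ProjBound (fun i => Submodule.span ℝ {u i}) A C := by
  have key : ∀ A : Set ι, ∀ x ∈ ⨆ i ∈ A, Submodule.span ℝ {u i}, ∃ α : ι →₀ ℝ,
      (∀ i ∉ A, α i = 0) ∧ Finsupp.linearCombination ℝ u α = x := by
    intro A x hx
    have : (⨆ i ∈ A, Submodule.span ℝ {u i}) = Submodule.span ℝ (u '' A) := by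
      rw [Submodule.span_eq_iSup_of_singleton_spans, iSup_image]
    rw [this, Finsupp.mem_span_image_iff_linearCombination] at hx
    obtain ⟨α, hα, rfl⟩ := hx
    refine ⟨α, fun i hi => ?_, rfl⟩
    by_contra h0
    exact hi ((Finsupp.mem_supported _ _).1 hα (by simpa using h0))
  intro x hx y hy
  obtain ⟨α, hα, rfl⟩ := key A x hx
  obtain ⟨β, hβ, rfl⟩ := key Aᶜ y hy
  rw [← map_add]
  exact h α β hα fun i hi => hβ i (by simpa using hi)

/-- If `X` contains `ℓ₂`-sums of copies of the norm `p` and the unconditional sequences of `X` are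
uniformly Hilbertian, then `p` is Hilbertian, with a uniform constant. -/
theorem hilbertComparable_of_copies {V : Type*} [NormedAddCommGroup V] [NormedSpace ℝ V]
    (p : Seminorm ℝ V) (hp : Continuous p) (hp0 : ∀ x, p x = 0 → x = 0) {a D : ℝ} (ha : 1 ≤ a)
    (hD0 : 0 ≤ D) (W : Submodule ℝ X)
    (hT : ∀ N : ℕ, ∃ T : Fin N → V →ₗ[ℝ] X, (∀ k y, T k y ∈ W) ∧ ∀ y : Fin N → V,
      ‖∑ k, T k (y k)‖ ^ 2 ≤ a * ∑ k, p (y k) ^ 2 ∧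
        ∑ k, p (y k) ^ 2 ≤ a * ‖∑ k, T k (y k)‖ ^ 2)
    (hD : ∀ (d : ℕ) (u : Fin d → X), (∀ i, u i ≠ 0) → (∀ i, u i ∈ W) →
      IsUncondDecomp (fun i => Submodule.span ℝ {u i}) a →
        (Submodule.span ℝ (Set.range u)).HilbertComparable D) :
    HilbertComparable p ((a ^ 4 * D) ^ 2) := by
  have ha0 : 0 ≤ a := by linarith
  refine RademacherComparable.hilbertComparable p hp (by positivity) fun n => ?_
  -- Only families of nonzero vectors fall under `hD`; both inequalities are closed conditions, so
  -- density gives the rest.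
  suffices hne : ∀ x : Fin n → V, (∀ i, x i ≠ 0) →
      ∑ ω : Fin n → Bool, p (∑ i, boolSign (ω i) • x i) ^ 2 ≤
        a ^ 4 * D * (Fintype.card (Fin n → Bool) * ∑ i, p (x i) ^ 2) ∧
      Fintype.card (Fin n → Bool) * ∑ i, p (x i) ^ 2 ≤
        a ^ 4 * D * ∑ ω : Fin n → Bool, p (∑ i, boolSign (ω i) • x i) ^ 2 by
    intro x
    rcases subsingleton_or_nontrivial V with hV | hV
    · have : ∀ v : V, p v = 0 := fun v => by rw [Subsingleton.elim v 0, map_zero]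
      simp [this]
    · have hdense : Dense (Set.univ.pi fun _ : Fin n => ({0}ᶜ : Set V)) :=
        dense_pi _ fun i _ => dense_compl_singleton 0
      have hcl : IsClosed {x : Fin n → V |
          ∑ ω : Fin n → Bool, p (∑ i, boolSign (ω i) • x i) ^ 2 ≤
            a ^ 4 * D * (Fintype.card (Fin n → Bool) * ∑ i, p (x i) ^ 2) ∧
          Fintype.card (Fin n → Bool) * ∑ i, p (x i) ^ 2 ≤
            a ^ 4 * D * ∑ ω : Fin n → Bool, p (∑ i, boolSign (ω i) • x i) ^ 2} :=
        IsClosed.and (isClosed_le (by fun_prop) (by fun_prop))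
          (isClosed_le (by fun_prop) (by fun_prop))
      exact (hcl.closure_subset_iff.2 fun x hx => hne x fun i => by
        simpa using hx i (Set.mem_univ i)) (hdense x)
  intro x hx
  obtain ⟨T₀, hT₀W, hT₀⟩ := hT (Fintype.card (Fin n → Bool))
  let e := Fintype.equivFin (Fin n → Bool)
  let T : (Fin n → Bool) → V →ₗ[ℝ] X := fun ω => T₀ (e ω)
  have hTb : ∀ y : (Fin n → Bool) → V, ‖∑ ω, T ω (y ω)‖ ^ 2 ≤ a * ∑ ω, p (y ω) ^ 2 ∧
      ∑ ω, p (y ω) ^ 2 ≤ a * ‖∑ ω, T ω (y ω)‖ ^ 2 := fun y => by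
    have := hT₀ fun k => y (e.symm k)
    have h1 : ∑ ω, T ω (y ω) = ∑ k, T₀ k (y (e.symm k)) := by
      rw [← Equiv.sum_comp e]; simp [T]
    have h2 : ∑ ω, p (y ω) ^ 2 = ∑ k, p (y (e.symm k)) ^ 2 :=
      (Equiv.sum_comp e.symm fun ω => p (y ω) ^ 2).symm
    rw [h1, h2]
    exact this
  -- One copy of p is used for each sign pattern, so that ‖Σ α i • u i‖² is, up to a, the sum `R α`
  -- of p(Σ α i ε i x i)² over all patterns.
  let u : Fin n → X := fun i => ∑ ω, boolSign (ω i) • T ω (x i)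
  let R : (Fin n → ℝ) → ℝ := fun α =>
    ∑ ω : Fin n → Bool, p (∑ i, α i • boolSign (ω i) • x i) ^ 2
  have hlc : ∀ α : Fin n → ℝ, ∑ i, α i • u i =
      ∑ ω, T ω (∑ i, α i • boolSign (ω i) • x i) := fun α => by
    simp only [u, Finset.smul_sum, map_sum, map_smul]
    exact Finset.sum_comm
  have hR : ∀ α : Fin n → ℝ, ‖∑ i, α i • u i‖ ^ 2 ≤ a * R α ∧
      R α ≤ a * ‖∑ i, α i • u i‖ ^ 2 := fun α => by
    rw [hlc]; exact hTb _
  have hRflip : ∀ (σ : Fin n → Bool) (α : Fin n → ℝ), R (fun i => boolSign (σ i) * α i) = R α := by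
    intro σ α
    let E : (Fin n → Bool) ≃ (Fin n → Bool) :=
      { toFun := fun ω i => σ i == ω i
        invFun := fun ω i => σ i == ω i
        left_inv := fun ω => by ext i; simp
        right_inv := fun ω => by ext i; simp }
    have hE : ∀ ω i, boolSign (E ω i) = boolSign (σ i) * boolSign (ω i) := fun ω i => by
      simp only [E, Equiv.coe_fn_mk, boolSign]
      cases σ i <;> cases ω i <;> simp
    simp only [R]
    rw [← Equiv.sum_comp E fun ω => p (∑ i, α i • boolSign (ω i) • x i) ^ 2]
    refine Finset.sum_congr rfl fun ω _ => ?_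
    congr 2
    refine Finset.sum_congr rfl fun i _ => ?_
    rw [hE, smul_smul, smul_smul]
    congr 1
    ring
  -- `R` is invariant under sign changes, so α is the midpoint of α + β and α - β, which have the
  -- same value of `R`; convexity concludes.
  have hRproj : ∀ (α β : Fin n → ℝ) (A : Set (Fin n)), (∀ i ∉ A, α i = 0) → (∀ i ∈ A, β i = 0) →
      R α ≤ R (α + β) := by
    classical
    intro α β A hα hβ
    have h1 : R (α - β) = R (α + β) := by
      rw [← hRflip (fun i => decide (i ∈ A)) (α + β)]
      congr 1
      ext i
      by_cases hi : i ∈ A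
      · simp [hi, boolSign, hβ i hi]
      · simp [hi, boolSign, hα i hi]
    have h2 : ∀ ω : Fin n → Bool, p (∑ i, α i • boolSign (ω i) • x i) ^ 2 ≤
        (p (∑ i, (α + β) i • boolSign (ω i) • x i) ^ 2 +
          p (∑ i, (α - β) i • boolSign (ω i) • x i) ^ 2) / 2 := fun ω => by
      have h3 : ∑ i, α i • boolSign (ω i) • x i = (1 / 2 : ℝ) •
          (∑ i, (α + β) i • boolSign (ω i) • x i + ∑ i, (α - β) i • boolSign (ω i) • x i) := by
        rw [← Finset.sum_add_distrib, Finset.smul_sum]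
        refine Finset.sum_congr rfl fun i _ => ?_
        simp only [Pi.add_apply, Pi.sub_apply]
        module
      set s := ∑ i, (α + β) i • boolSign (ω i) • x i
      set t := ∑ i, (α - β) i • boolSign (ω i) • x i
      have h4 : p (∑ i, α i • boolSign (ω i) • x i) ≤ (p s + p t) / 2 := by
        rw [h3, map_smul_eq_mul]
        have := map_add_le_add p s t
        norm_num
        linarith
      have h5 := pow_le_pow_left₀ (apply_nonneg p _) h4 2
      nlinarith [sq_nonneg (p s - p t)]
    calc R α ≤ ∑ ω : Fin n → Bool, (p (∑ i, (α + β) i • boolSign (ω i) • x i) ^ 2 +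
          p (∑ i, (α - β) i • boolSign (ω i) • x i) ^ 2) / 2 := Finset.sum_le_sum fun ω _ => h2 ω
      _ = (R (α + β) + R (α - β)) / 2 := by rw [← Finset.sum_div, Finset.sum_add_distrib]
      _ = R (α + β) := by rw [h1]; ring
  have hsq : ∀ s t : ℝ, 0 ≤ s → 0 ≤ t → s ^ 2 ≤ a * (a * t ^ 2) → s ≤ a * t := fun s t hs ht h => by
    refine (pow_le_pow_iff_left₀ hs (by positivity) two_ne_zero).1 (h.trans (le_of_eq (by ring)))
  have hN : (0 : ℝ) < Fintype.card (Fin n → Bool) := by exact_mod_cast Fintype.card_pos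
  have hui : ∀ i, ‖u i‖ ^ 2 ≤ a * (Fintype.card (Fin n → Bool) * p (x i) ^ 2) ∧
      Fintype.card (Fin n → Bool) * p (x i) ^ 2 ≤ a * ‖u i‖ ^ 2 := fun i => by
    have h1 := hTb fun ω => boolSign (ω i) • x i
    have h2 : ∀ ω : Fin n → Bool, p (boolSign (ω i) • x i) ^ 2 = p (x i) ^ 2 := fun ω => by
      rw [map_smul_eq_mul, mul_pow, Real.norm_eq_abs, sq_abs, pow_two (boolSign _),
        boolSign_mul_self, one_mul]
    simp only [h2, map_smul, Finset.sum_const, Finset.card_univ, nsmul_eq_mul] at h1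
    exact h1
  have hu0 : ∀ i, u i ≠ 0 := fun i h0 => by
    have := (hui i).2
    rw [h0, norm_zero, zero_pow two_ne_zero, mul_zero] at this
    have h3 : 0 < p (x i) := lt_of_le_of_ne (apply_nonneg p _) fun h => hx i (hp0 _ h.symm)
    exact absurd this (not_le.2 (by positivity))
  have huW : ∀ i, u i ∈ W := fun i =>
    W.sum_mem fun ω _ => W.smul_mem _ (hT₀W _ _)
  have huD := hD n u hu0 huW fun A => projBound_span_of fun α β hα hβ => by
    rw [Finsupp.linearCombination_apply, Finsupp.linearCombination_apply,
      Finsupp.sum_fintype _ _ (by simp), Finsupp.sum_fintype _ _ (by simp)]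
    refine hsq _ _ (norm_nonneg _) (norm_nonneg _) ((hR α).1.trans ?_)
    gcongr
    exact (hRproj α β A hα hβ).trans (hR _).2
  have huM : ∀ ω ω' : Fin n → Bool,
      ‖∑ i, boolSign (ω i) • u i‖ ≤ a * ‖∑ i, boolSign (ω' i) • u i‖ := fun ω ω' => by
    refine hsq _ _ (norm_nonneg _) (norm_nonneg _) ((hR fun i => boolSign (ω i)).1.trans ?_)
    gcongr
    have h1 := hRflip ω 1
    have h2 := hRflip ω' 1
    simp only [Pi.one_apply, mul_one] at h1 h2
    rw [h1, ← h2]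
    exact (hR _).2
  have hfin := sum_sq_comparable_of_unconditional u huM hD0 huD
  have hR1 := hR 1
  have hR1' : R 1 = ∑ ω : Fin n → Bool, p (∑ i, boolSign (ω i) • x i) ^ 2 := by simp [R]
  simp only [Pi.one_apply, one_smul, hR1'] at hR1
  have hsum1 : ∑ i, ‖u i‖ ^ 2 ≤ a * (Fintype.card (Fin n → Bool) * ∑ i, p (x i) ^ 2) := by
    rw [Finset.mul_sum, Finset.mul_sum]
    exact Finset.sum_le_sum fun i _ => (hui i).1
  have hsum2 : Fintype.card (Fin n → Bool) * ∑ i, p (x i) ^ 2 ≤ a * ∑ i, ‖u i‖ ^ 2 := by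
    rw [Finset.mul_sum, Finset.mul_sum]
    exact Finset.sum_le_sum fun i _ => (hui i).2
  constructor
  · calc _ ≤ a * ‖∑ i, u i‖ ^ 2 := hR1.2
      _ ≤ a * (a ^ 2 * D * (a * (Fintype.card (Fin n → Bool) * ∑ i, p (x i) ^ 2))) := by
        gcongr
        exact hfin.1.trans (by gcongr)
      _ = _ := by ring
  · calc _ ≤ a * ∑ i, ‖u i‖ ^ 2 := hsum2
      _ ≤ a * (a ^ 2 * D * (a * ∑ ω : Fin n → Bool, p (∑ i, boolSign (ω i) • x i) ^ 2)) := by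
        gcongr
        refine hfin.2.trans ?_
        gcongr
        exact hR1.1
      _ = _ := by ring

end Copies

/-! ### Minimality excludes asymptotically Hilbertian behaviour -/

section Minimality

variable {X : Type u} [NormedAddCommGroup X] [NormedSpace ℝ X]

/-- The finite-dimensional subspaces of `E` are not uniformly Hilbertian. -/
def Submodule.IsLarge (E : Submodule ℝ X) : Prop :=
  ∀ c : ℝ, ∃ G : Submodule ℝ X, FiniteDimensional ℝ G ∧ G ≤ E ∧ ¬ G.HilbertComparable c

theorem IsD2Large.isLarge_top (h : IsD2Large X) : (⊤ : Submodule ℝ X).IsLarge := fun c => by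
  obtain ⟨F, h1, h2⟩ := h.exists_not_hilbertComparable c
  exact ⟨F, h1, le_top, h2⟩

theorem Submodule.IsLarge.isD2Large {E : Submodule ℝ X} (h : E.IsLarge) : IsD2Large E := by
  refine isD2Large_of_forall_exists fun c => ?_
  obtain ⟨G, h1, h2, h3⟩ := h c
  refine ⟨G.comap E.subtype, ?_, fun h4 => h3 ?_⟩
  · exact FiniteDimensional.of_injective
      ((E.subtype.comp (G.comap E.subtype).subtype).codRestrict G fun x => x.2)
      fun x y hxy => Subtype.ext (Subtype.ext (congrArg (Subtype.val (p := (· ∈ G))) hxy))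
  · let f : G →ₗ[ℝ] G.comap E.subtype :=
      (G.subtype.codRestrict E fun x => h2 x.2).codRestrict _ fun x => x.2
    have h5 := _root_.HilbertComparable.comp h4 f
    exact h5

/-- A `d₂`-minimal space embeds in its large closed subspaces. -/
theorem IsD2Minimal.exists_embedding (h : IsD2Minimal X) {Z : Submodule ℝ X}
    (hZ : IsClosed (Z : Set X)) (hL : Z.IsLarge) :
    ∃ (Φ : X →ₗ[ℝ] X) (M : ℝ), 0 < M ∧ (∀ x, Φ x ∈ Z) ∧ ∀ x, ‖x‖ ≤ M * ‖Φ x‖ ∧ ‖Φ x‖ ≤ M * ‖x‖ := by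
  obtain ⟨Z', ⟨T⟩⟩ := h.2 Z hZ hL.isD2Large
  let M := ‖(T : X →L[ℝ] Z')‖ + ‖(T.symm : Z' →L[ℝ] X)‖ + 1
  refine ⟨Z.subtype ∘ₗ Z'.subtype ∘ₗ T.toLinearEquiv.toLinearMap, M, by positivity,
    fun x => by simp, fun x => ?_⟩
  have e : ‖(Z.subtype ∘ₗ Z'.subtype ∘ₗ T.toLinearEquiv.toLinearMap) x‖ = ‖T x‖ := rfl
  rw [e]
  constructor
  · calc ‖x‖ = ‖(T.symm : Z' →L[ℝ] X) (T x)‖ := by simp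
      _ ≤ ‖(T.symm : Z' →L[ℝ] X)‖ * ‖T x‖ := ContinuousLinearMap.le_opNorm _ _
      _ ≤ _ := by
        gcongr
        have := norm_nonneg (T : X →L[ℝ] Z')
        simp only [M]; linarith
  · calc ‖T x‖ ≤ ‖(T : X →L[ℝ] Z')‖ * ‖x‖ := (T : X →L[ℝ] Z').le_opNorm x
      _ ≤ _ := by
        gcongr
        have := norm_nonneg (T.symm : Z' →L[ℝ] X)
        simp only [M]; linarith

instance finiteDimensional_biSup_Ico (F : ℕ → Submodule ℝ X) [∀ i, FiniteDimensional ℝ (F i)]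
    (a b : ℕ) : FiniteDimensional ℝ (⨆ i ∈ Set.Ico a b, F i : Submodule ℝ X) := by
  have : (⨆ i ∈ Set.Ico a b, F i) = (Finset.Ico a b).sup F := by
    simp [Finset.sup_eq_iSup]
  rw [this]
  infer_instance

/-- A `d₂`-minimal space with a large decomposition is far from being asymptotically Hilbertian:
all the tails contain badly Hilbertian subspaces of a fixed dimension. -/
theorem IsD2Minimal.exists_finrank (hX : IsD2Minimal X) (F : ℕ → Submodule ℝ X)
    [∀ i, FiniteDimensional ℝ (F i)] {C : ℝ} (hC : IsSchauderDecomp F C)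
    (hlarge : ∀ (n : ℕ) (c : ℝ), ∃ b, ¬ (⨆ i ∈ Set.Ico n b, F i).HilbertComparable c) (K : ℝ) :
    ∃ m, ∀ n, ∃ G : Submodule ℝ X, FiniteDimensional ℝ G ∧ Module.finrank ℝ G = m ∧
      G ≤ ⨆ i ∈ Set.Ici n, F i ∧ ¬ G.HilbertComparable K := by
  wlog hK : 0 ≤ K generalizing K
  · obtain ⟨m, hm⟩ := this 0 le_rfl
    refine ⟨m, fun n => ?_⟩
    obtain ⟨G, h1, h2, h3, h4⟩ := hm n
    exact ⟨G, h1, h2, h3, fun h => h4 (h.mono (by linarith))⟩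
  by_contra! hcon
  -- Beyond ν m, every m-dimensional subspace is K-Hilbertian.
  choose ν hν using hcon
  have hc : ∀ a, ∃ c, 0 ≤ c ∧ (⨆ i ∈ Set.Ico 0 a, F i).HilbertComparable c :=
    fun a => Submodule.exists_hilbertComparable _
  choose c hc0 hc using hc
  -- E i a is bad even relative to `c a`, the Hilbertian constant of everything already placed
  -- before a.
  have hE := fun (i a : ℕ) => hX.1.exists_not_hilbertComparable (i * (c a + K + 1))
  choose E hEf hE using hE
  -- The next block starts late enough for all dimensions up to dim E i a, and ends at `b`, where it
  -- has become bad.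
  let a' : ℕ → ℕ → ℕ := fun i a =>
    max a ((Finset.range (Module.finrank ℝ (E i a) + 1)).sup ν)
  have hb := fun (i a : ℕ) => hlarge (a' i a) i
  choose b hb using hb
  let a : ℕ → ℕ := fun n => Nat.rec 0 (fun i s => max (a' i s) (b i s)) n
  have ha : ∀ i, a (i + 1) = max (a' i (a i)) (b i (a i)) := fun i => rfl
  have haa' : ∀ i, a i ≤ a' i (a i) := fun i => le_max_left _ _
  have hamono : Monotone a := monotone_nat_of_le_succ fun i =>
    (haa' i).trans ((le_max_left _ _).trans (ha i).ge)
  let H : ℕ → Submodule ℝ X := fun i => ⨆ j ∈ Set.Ico (a' i (a i)) (a (i + 1)), F j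
  have hH : ∀ i : ℕ, ¬ (H i).HilbertComparable i := fun i h => hb i (a i) (h.anti
    (biSup_mono fun j hj => ⟨hj.1, hj.2.trans_le ((le_max_right _ _).trans (ha i).ge)⟩))
  have hHle : ∀ i, H i ≤ ⨆ j ∈ Set.Ico (a i) (a (i + 1)), F j := fun i =>
    biSup_mono fun j hj => ⟨(haa' i).trans hj.1, hj.2⟩
  have hHC : IsSchauderDecomp H C := hC.blocks hamono hHle
  let Z := (⨆ i, H i).topologicalClosure
  have hZL : Z.IsLarge := fun r => by
    obtain ⟨i, hi⟩ := exists_nat_ge r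
    exact ⟨H i, inferInstance, (le_iSup H i).trans (Submodule.le_topologicalClosure _),
      fun h => hH i (h.mono hi)⟩
  obtain ⟨Φ, M, hM, hΦZ, hΦ⟩ := hX.exists_embedding (Submodule.isClosed_topologicalClosure _) hZL
  let A := (M + 1 / (2 * M)) * (1 + |C|)
  -- The embedding constant M is fixed now, so the badness factor i of E can be taken beyond all
  -- losses.
  obtain ⟨i, hi⟩ := exists_nat_ge (2 * (2 * M) ^ 2 * A ^ 2)
  refine hE i (a i) (HilbertComparable.mono (c := 2 * (2 * M) ^ 2 * A ^ 2 * (c (a i) + K)) ?_ ?_)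
  swap
  · have h0 := hc0 (a i)
    calc 2 * (2 * M) ^ 2 * A ^ 2 * (c (a i) + K) ≤ i * (c (a i) + K) := by gcongr
      _ ≤ i * (c (a i) + K + 1) := mul_le_mul_of_nonneg_left (by linarith) (Nat.cast_nonneg i)
  have := hEf i (a i)
  -- The perturbation moves the image of E into the algebraic sum, where vectors split into blocks;
  -- the error 1/(2M) keeps S bounded below by 1/(2M).
  obtain ⟨S, hSW, hS⟩ := LinearMap.exists_perturbation (⨆ i, H i)
    (Φ ∘ₗ (E i (a i)).subtype) (fun x => hΦZ _) (ε := 1 / (2 * M)) (by positivity)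
  have hS' : ∀ x : E i (a i), ‖(x : X)‖ ≤ 2 * M * ‖S x‖ ∧ ‖S x‖ ≤ (M + 1 / (2 * M)) * ‖(x : X)‖ := by
    intro x
    have h1 := hS x
    have h2 := hΦ x
    have h3 : ‖Φ x‖ ≤ ‖S x‖ + ‖S x - Φ x‖ := by
      have := norm_sub_le (S x) (S x - Φ x)
      simpa using this
    have h4 : ‖S x‖ ≤ ‖Φ x‖ + ‖S x - Φ x‖ := by
      have := norm_add_le (Φ x) (S x - Φ x)
      simpa using this
    change ‖S x - Φ x‖ ≤ _ * ‖(x : X)‖ at h1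
    constructor
    · have h5 : M * ‖S x - Φ x‖ ≤ ‖(x : X)‖ / 2 := by
        calc M * ‖S x - Φ x‖ ≤ M * (1 / (2 * M) * ‖(x : X)‖) := by gcongr
          _ = _ := by field_simp
      have h6 : M * ‖Φ x‖ ≤ M * (‖S x‖ + ‖S x - Φ x‖) := by gcongr
      linarith [h2.1]
    · linarith [h2.2]
  have hsup : ⨆ j, H j ≤ (⨆ j ∈ Set.Iio i, H j) ⊔ ⨆ j ∈ (Set.Iio i)ᶜ, H j := by
    refine iSup_le fun j => ?_
    rcases lt_or_ge j i with hj | hj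
    · exact (le_biSup H (show j ∈ Set.Iio i from hj)).trans le_sup_left
    · exact (le_biSup H (show j ∈ (Set.Iio i)ᶜ by simpa using hj)).trans le_sup_right
  obtain ⟨f, g, hf, hg, hfg⟩ := S.exists_eq_add_of_mem_sup fun x => hsup (hSW x)
  have hfC : ∀ x, ‖f x‖ ≤ |C| * ‖S x‖ := fun x => by
    refine (hHC i _ (hf x) _ (hg x)).trans ?_
    rw [← hfg]
    gcongr
    exact le_abs_self C
  have hgC : ∀ x, ‖g x‖ ≤ (1 + |C|) * ‖S x‖ := fun x => by
    have : g x = S x - f x := by rw [hfg]; abel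
    rw [this]
    refine (norm_sub_le _ _).trans ?_
    linarith [hfC x]
  have hfH : HilbertComparable (fun x => ‖f x‖) (c (a i)) := by
    refine (hc (a i)).comp_linearMap f fun x => ?_
    refine (iSup₂_le fun j hj => (hHle j).trans (biSup_mono fun k hk => ?_) :
      (⨆ j ∈ Set.Iio i, H j) ≤ _) (hf x)
    exact ⟨Nat.zero_le _, hk.2.trans_le (hamono (Nat.succ_le_of_lt hj))⟩
  have hgH : HilbertComparable (fun x => ‖g x‖) K := by
    refine Submodule.HilbertComparable.comp_linearMap (E := LinearMap.range g) ?_ g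
      fun x => LinearMap.mem_range_self g x
    -- The range of g has dimension at most dim E and lies in blocks i and later, which start after
    -- the corresponding value of ν.
    refine hν _ _ inferInstance rfl ?_
    rintro _ ⟨x, rfl⟩
    refine (iSup₂_le fun j hj => biSup_mono fun k hk => ?_ :
      (⨆ j ∈ (Set.Iio i)ᶜ, H j) ≤ _) (hg x)
    have hij : i ≤ j := by simpa using hj
    have h1 : ν (Module.finrank ℝ (LinearMap.range g)) ≤ a' i (a i) :=
      (Finset.le_sup (f := ν) (Finset.mem_range.2
        (Nat.lt_succ_of_le (LinearMap.finrank_range_le g)))).trans (le_max_right _ _)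
    have h2 : a' i (a i) ≤ a' j (a j) := by
      rcases hij.eq_or_lt with rfl | hij
      · exact le_rfl
      · exact (le_max_left _ _).trans ((ha i).ge.trans ((hamono (Nat.succ_le_of_lt hij)).trans
          (haa' j)))
    exact h1.trans (h2.trans hk.1)
  refine hfH.two_piece hgH (hc0 _) hK (fun x => norm_nonneg _) (fun x => norm_nonneg _)
    (fun x => norm_nonneg _) (fun x => ?_) (fun x => ?_) (fun x => ?_)
  · refine (hS' x).1.trans ?_
    rw [hfg]
    gcongr
    exact norm_add_le _ _
  · calc ‖f x‖ ≤ |C| * ‖S x‖ := hfC x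
      _ ≤ (1 + |C|) * ((M + 1 / (2 * M)) * ‖(x : X)‖) := by
        gcongr
        · linarith
        · exact (hS' x).2
      _ = _ := by ring
  · calc ‖g x‖ ≤ (1 + |C|) * ‖S x‖ := hgC x
      _ ≤ (1 + |C|) * ((M + 1 / (2 * M)) * ‖(x : X)‖) := by
        gcongr
        exact (hS' x).2
      _ = _ := by ring

end Minimality

/-! ### Mazur's construction of a bad decomposition -/

section Mazur

variable {X : Type u} [NormedAddCommGroup X] [NormedSpace ℝ X]

/-- Mazur's lemma: a finite-dimensional subspace is almost norming against the kernel of finitely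
many functionals. -/
theorem exists_finset_dual_norm_le (E : Submodule ℝ X) [FiniteDimensional ℝ E] :
    ∃ s : Finset (StrongDual ℝ X), ∀ e ∈ E, ∀ y, (∀ φ ∈ s, φ y = 0) → ‖e‖ ≤ 2 * ‖e + y‖ := by
  classical
  have hK : IsCompact ((↑) '' (Metric.sphere (0 : E) 1) : Set X) := by
    have := FiniteDimensional.proper ℝ E
    exact (isCompact_sphere _ _).image continuous_subtype_val
  -- Norming functionals of a finite 1/2-net of the unit sphere suffice.
  obtain ⟨t, htK, htf, ht⟩ := hK.finite_cover_balls (e := 1 / 2) (by norm_num)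
  have hφ : ∀ x : X, ∃ φ : StrongDual ℝ X, x ∈ t → ‖φ‖ = 1 ∧ φ x = 1 := by
    intro x
    by_cases hx : x ∈ t
    · obtain ⟨z, hz, rfl⟩ := htK hx
      have hz1 : ‖(z : X)‖ = 1 := by simpa using hz
      obtain ⟨g, hg1, hg2⟩ := exists_dual_vector ℝ (z : X) (by rw [hz1]; norm_num)
      exact ⟨g, fun _ => ⟨hg1, by rw [hg2, hz1]; simp⟩⟩
    · exact ⟨0, fun h => absurd h hx⟩
  choose φ hφ using hφ
  refine ⟨htf.toFinset.image φ, fun e he y hy => ?_⟩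
  rcases eq_or_ne e 0 with rfl | he0
  · simp
  have hen : 0 < ‖e‖ := norm_pos_iff.2 he0
  have hmem : ‖e‖⁻¹ • e ∈ ((↑) '' (Metric.sphere (0 : E) 1) : Set X) :=
    ⟨⟨‖e‖⁻¹ • e, E.smul_mem _ he⟩, by simp [norm_smul, hen.ne'], rfl⟩
  obtain ⟨x, hx, hxd⟩ := Set.mem_iUnion₂.1 (ht hmem)
  have h1 := hφ x hx
  have hy0 : φ x y = 0 := hy _ (Finset.mem_image_of_mem _ (by simpa using hx))
  have h2 : φ x (‖e‖⁻¹ • (e + y)) = 1 + φ x (‖e‖⁻¹ • e - x) := by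
    simp only [map_smul, map_add, map_sub, hy0, h1.2, add_zero]
    ring
  have h3 : |φ x (‖e‖⁻¹ • e - x)| ≤ 1 / 2 := by
    refine ((φ x).le_opNorm _).trans ?_
    rw [h1.1, one_mul, ← dist_eq_norm]
    exact (Metric.mem_ball.1 hxd).le
  have h4 : |φ x (‖e‖⁻¹ • (e + y))| ≤ ‖e‖⁻¹ * ‖e + y‖ := by
    refine ((φ x).le_opNorm _).trans ?_
    rw [h1.1, one_mul, norm_smul, norm_inv, norm_norm]
  have h5 : 1 / 2 ≤ ‖e‖⁻¹ * ‖e + y‖ := by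
    have := le_abs_self (φ x (‖e‖⁻¹ • (e + y)))
    have := neg_abs_le (φ x (‖e‖⁻¹ • e - x))
    linarith
  rw [inv_mul_eq_div, le_div_iff₀ hen] at h5
  linarith

/-- The common kernel of finitely many functionals of a large space is large. -/
theorem exists_not_hilbertComparable_of_finset_dual (hX : (⊤ : Submodule ℝ X).IsLarge)
    (s : Finset (StrongDual ℝ X)) (c : ℝ) :
    ∃ G : Submodule ℝ X, FiniteDimensional ℝ G ∧ (∀ φ ∈ s, ∀ x ∈ G, φ x = 0) ∧
      ¬ G.HilbertComparable c := by
  wlog hc : 0 ≤ c generalizing c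
  · obtain ⟨G, h1, h2, h3⟩ := this 0 le_rfl
    exact ⟨G, h1, h2, fun h => h3 (h.mono (by linarith))⟩
  by_contra! hcon
  let T : X →L[ℝ] (s → ℝ) := ContinuousLinearMap.pi fun φ => φ.1
  let Y : Submodule ℝ X := LinearMap.ker (T : X →ₗ[ℝ] (s → ℝ))
  have hYc : IsClosed (Y : Set X) := T.isClosed_ker
  have hYq : FiniteDimensional ℝ (X ⧸ Y) :=
    (LinearMap.quotKerEquivRange (T : X →ₗ[ℝ] (s → ℝ))).symm.finiteDimensional
  -- The kernel has finite codimension, so the identity is a finite-rank map f plus a projection g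
  -- onto the kernel. Uniformly Hilbertian subspaces of the kernel would then make all of X
  -- uniformly Hilbertian.
  obtain ⟨Q, hQ⟩ := Submodule.ClosedComplemented.of_finiteDimensional_quotient hYc
  let g : X →L[ℝ] X := Y.subtypeL.comp Q
  let f : X →L[ℝ] X := ContinuousLinearMap.id ℝ X - g
  have hfker : Y ≤ LinearMap.ker (f : X →ₗ[ℝ] X) := fun y hy => by
    have := hQ ⟨y, hy⟩
    simp [f, g, this]
  have hfr : FiniteDimensional ℝ (LinearMap.range (f : X →ₗ[ℝ] X)) := by
    have h1 : LinearMap.range (f : X →ₗ[ℝ] X) = LinearMap.range (Y.liftQ (f : X →ₗ[ℝ] X) hfker) :=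
      (Submodule.range_liftQ _ _ _).symm
    rw [h1]
    infer_instance
  obtain ⟨d, hd0, hd⟩ := Submodule.exists_hilbertComparable (LinearMap.range (f : X →ₗ[ℝ] X))
  let A := ‖f‖ + ‖g‖
  obtain ⟨E, hE, -, hEH⟩ := hX (2 * 1 ^ 2 * A ^ 2 * (d + c))
  have hf : HilbertComparable (fun x : E => ‖f x‖) d :=
    hd.comp_linearMap ((f : X →ₗ[ℝ] X) ∘ₗ E.subtype) fun x => LinearMap.mem_range_self _ _
  have hg : HilbertComparable (fun x : E => ‖g x‖) c := by
    refine Submodule.HilbertComparable.comp_linearMap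
      (E := LinearMap.range ((g : X →ₗ[ℝ] X) ∘ₗ E.subtype)) ?_ ((g : X →ₗ[ℝ] X) ∘ₗ E.subtype)
      fun x => LinearMap.mem_range_self _ _
    refine hcon _ inferInstance fun φ hφ x hx => ?_
    obtain ⟨z, rfl⟩ := hx
    have : T (g z) = 0 := (Q z).2
    exact congrFun this ⟨φ, hφ⟩
  refine hEH (hf.two_piece hg hd0 hc (fun x => norm_nonneg _) (fun x => norm_nonneg _)
    (fun x => norm_nonneg _) (fun x => ?_) (fun x => ?_) (fun x => ?_))
  · rw [one_mul]
    have : (x : X) = f x + g x := by simp [f]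
    calc ‖(x : X)‖ = ‖f x + g x‖ := by rw [← this]
      _ ≤ _ := norm_add_le _ _
  · refine (f.le_opNorm x).trans ?_
    gcongr
    simp [A]
  · refine (g.le_opNorm x).trans ?_
    gcongr
    simp [A]

/-- A large space contains a decomposition into finite-dimensional spaces which are worse and worse
Hilbertian. -/
theorem exists_isSchauderDecomp_of_isLarge (hX : (⊤ : Submodule ℝ X).IsLarge) :
    ∃ F : ℕ → Submodule ℝ X, (∀ i, FiniteDimensional ℝ (F i)) ∧ IsSchauderDecomp F 2 ∧
      ∀ n : ℕ, ¬ (F n).HilbertComparable n := by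
  classical
  have hpick := fun (s : Finset (StrongDual ℝ X)) (n : ℕ) =>
    exists_not_hilbertComparable_of_finset_dual hX s n
  choose pick hpf hps hpn using hpick
  have hmaz := fun E : {E : Submodule ℝ X // FiniteDimensional ℝ E} =>
    have := E.2
    exists_finset_dual_norm_le E.1
  choose maz hmaz using hmaz
  -- The state holds the functionals and the span so far. The new piece is taken in their common
  -- kernel, and functionals almost norming the enlarged span are then added.
  let step : ℕ → Finset (StrongDual ℝ X) × {E : Submodule ℝ X // FiniteDimensional ℝ E} →
      Finset (StrongDual ℝ X) × {E : Submodule ℝ X // FiniteDimensional ℝ E} := fun n z =>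
    let E' : {E : Submodule ℝ X // FiniteDimensional ℝ E} :=
      ⟨z.2.1 ⊔ pick z.1 n, by
        have := z.2.2
        have := hpf z.1 n
        infer_instance⟩
    (z.1 ∪ maz E', E')
  let st : ℕ → Finset (StrongDual ℝ X) × {E : Submodule ℝ X // FiniteDimensional ℝ E} := fun n =>
    Nat.rec (∅, ⟨⊥, inferInstance⟩) (fun n z => step n z) n
  have hst : ∀ n, st (n + 1) = step n (st n) := fun n => rfl
  have hs : Monotone fun n => (st n).1 := monotone_nat_of_le_succ fun n => by
    rw [hst]
    exact Finset.subset_union_left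
  have hE : Monotone fun n => (st n).2.1 := monotone_nat_of_le_succ fun n => by
    rw [hst]
    exact le_sup_left
  let F : ℕ → Submodule ℝ X := fun n => pick (st n).1 n
  have hFE : ∀ n, F n ≤ (st (n + 1)).2.1 := fun n => by
    rw [hst]
    exact le_sup_right
  refine ⟨F, fun i => hpf _ _, fun n x hx y hy => ?_, fun n => hpn _ _⟩
  have hx' : x ∈ (st n).2.1 :=
    (iSup₂_le fun i hi => (hFE i).trans (hE (Nat.succ_le_of_lt hi)) :
      (⨆ i ∈ Set.Iio n, F i) ≤ _) hx
  have hy' : ∀ φ ∈ (st n).1, φ y = 0 := fun φ hφ => by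
    have : (⨆ i ∈ (Set.Iio n)ᶜ, F i) ≤ LinearMap.ker (φ : X →ₗ[ℝ] ℝ) :=
      iSup₂_le fun i hi z hz => hps _ _ φ (hs (by simpa using hi) hφ) z hz
    exact this hy
  cases n with
  | zero =>
    have : x = 0 := by simpa [st] using hx'
    simp [this]
  | succ k =>
    refine hmaz (st (k + 1)).2 x hx' y fun φ hφ => hy' φ ?_
    rw [hst]
    exact Finset.mem_union_right _ hφ

end Mazur

/-! ### Pointwise limits of seminorms -/

section Limits

theorem Ultrafilter.exists_tendsto_of_abs_le {κ : Type*} (U : Ultrafilter κ) {f : κ → ℝ} {b : ℝ}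
    (hf : ∀ k, |f k| ≤ b) : ∃ l, Tendsto f U (𝓝 l) := by
  obtain ⟨l, -, hl⟩ := (isCompact_Icc (a := -b) (b := b)).ultrafilter_le_nhds (U.map f) (by
    rw [le_principal_iff]
    exact Filter.mem_map.2 (Filter.univ_mem' fun k => abs_le.1 (hf k)))
  exact ⟨l, hl⟩

theorem Seminorm.continuous_of_le_mul_norm {E : Type*} [NormedAddCommGroup E] [NormedSpace ℝ E]
    (p : Seminorm ℝ E) {b : ℝ} (h : ∀ x, p x ≤ b * ‖x‖) : Continuous p := by
  refine (LipschitzWith.of_dist_le_mul (K := b.toNNReal) fun x y => ?_).continuous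
  rw [Real.dist_eq, dist_eq_norm]
  refine (abs_sub_map_le_sub p x y).trans ((h _).trans ?_)
  gcongr
  exact Real.le_coe_toNNReal b

/-- Pointwise convergence of equicontinuous seminorms on a finite-dimensional space to a norm is
uniform up to multiplicative constants. -/
theorem eventually_comparable_of_tendsto {E : Type*} [NormedAddCommGroup E] [NormedSpace ℝ E]
    [FiniteDimensional ℝ E] {κ : Type*} {l : Filter κ} (q : κ → Seminorm ℝ E) (p : Seminorm ℝ E)
    {b β : ℝ} (hβ : 0 < β) (hq : ∀ k x, q k x ≤ b * ‖x‖) (hpb : ∀ x, p x ≤ b * ‖x‖)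
    (hp : ∀ x, β * ‖x‖ ≤ p x) (h : ∀ x, Tendsto (fun k => q k x) l (𝓝 (p x))) :
    ∀ᶠ k in l, ∀ x, q k x ≤ 2 * p x ∧ p x ≤ 2 * q k x := by
  have := FiniteDimensional.proper ℝ E
  -- On the unit sphere the difference of the seminorms is at most three errors of β/8, which is
  -- less than half of p because p is at least β there.
  let δ := β / (8 * (|b| + 1))
  have hδ : 0 < δ := by positivity
  have hbδ : |b| * δ ≤ β / 8 := by
    calc |b| * δ ≤ (|b| + 1) * δ := by gcongr; linarith
      _ = β / 8 := by simp only [δ]; field_simp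
  obtain ⟨t, -, htf, ht⟩ := (isCompact_sphere (0 : E) 1).finite_cover_balls hδ
  have hev : ∀ᶠ k in l, ∀ x ∈ t, |q k x - p x| < β / 8 :=
    (eventually_all_finite htf).2 fun x _ => by
      have := (Metric.tendsto_nhds.1 (h x)) (β / 8) (by positivity)
      simpa [Real.dist_eq] using this
  filter_upwards [hev] with k hk
  have hsph : ∀ x : E, ‖x‖ = 1 → q k x ≤ 2 * p x ∧ p x ≤ 2 * q k x := by
    intro x hx
    obtain ⟨y, hy, hxy⟩ := Set.mem_iUnion₂.1 (ht (by simpa using hx : x ∈ Metric.sphere (0 : E) 1))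
    have hxy' : ‖x - y‖ ≤ δ := by rw [← dist_eq_norm]; exact (Metric.mem_ball.1 hxy).le
    have hcl : ∀ r : Seminorm ℝ E, (∀ x, r x ≤ b * ‖x‖) → |r x - r y| ≤ β / 8 := fun r hr =>
      calc |r x - r y| ≤ r (x - y) := abs_sub_map_le_sub r x y
        _ ≤ b * ‖x - y‖ := hr _
        _ ≤ |b| * δ := by gcongr; exact le_abs_self b
        _ ≤ β / 8 := hbδ
    have h1 := abs_le.1 (hcl (q k) (hq k))
    have h2 := abs_le.1 (hcl p hpb)
    have h3 := abs_lt.1 (hk y hy)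
    have h4 := hp x
    rw [hx, mul_one] at h4
    constructor <;> linarith [h1.1, h1.2, h2.1, h2.2, h3.1, h3.2]
  intro x
  rcases eq_or_ne x 0 with rfl | hx
  · simp
  have hxn : 0 < ‖x‖ := norm_pos_iff.2 hx
  have h1 := hsph (‖x‖⁻¹ • x) (by rw [norm_smul, norm_inv, norm_norm, inv_mul_cancel₀ hxn.ne'])
  simp only [map_smul_eq_mul, norm_inv, norm_norm] at h1
  constructor
  · have := mul_le_mul_of_nonneg_left h1.1 hxn.le
    field_simp at this
    linarith
  · have := mul_le_mul_of_nonneg_left h1.2 hxn.le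
    field_simp at this
    linarith

end Limits

/-! ### Successive copies of one finite-dimensional norm -/

section FiniteDimensional

variable {X : Type u} [NormedAddCommGroup X] [NormedSpace ℝ X]

/-- Subspaces of the same finite dimension are uniformly isomorphic. -/
theorem exists_uniform_parametrization (X : Type u) [NormedAddCommGroup X] [NormedSpace ℝ X]
    (m : ℕ) : ∃ β : ℝ, 0 < β ∧ ∀ G : Submodule ℝ X,
    FiniteDimensional ℝ G → Module.finrank ℝ G = m → ∃ T : (Fin m → ℝ) →ₗ[ℝ] X,
      LinearMap.range T = G ∧ ∀ y, ‖T y‖ ≤ m * ‖y‖ ∧ ∀ i, β * |y i| ≤ ‖T y‖ := by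
  induction m with
  | zero =>
    refine ⟨1, one_pos, fun G hG h0 => ⟨0, ?_, fun y => ⟨by simp, fun i => i.elim0⟩⟩⟩
    rw [Submodule.finrank_eq_zero.1 h0, LinearMap.range_zero]
  | succ m ih =>
    obtain ⟨β, hβ, ih⟩ := ih
    -- Split off a unit vector x along its norming functional φ. The coordinate along x is at most
    -- ‖T y‖, so the remainder, in the kernel of φ, has norm at most 2‖T y‖; hence β is halved.
    refine ⟨min 1 (β / 2), by positivity, fun G hG hm => ?_⟩
    have hGn : G ≠ ⊥ := fun h => by rw [h, finrank_bot] at hm; omega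
    obtain ⟨x₀, hx₀G, hx₀⟩ := Submodule.exists_mem_ne_zero_of_ne_bot hGn
    let x := ‖x₀‖⁻¹ • x₀
    have hxn : ‖x‖ = 1 := by simp [x, norm_smul, hx₀]
    have hxG : x ∈ G := G.smul_mem _ hx₀G
    obtain ⟨φ, hφ1, hφ⟩ := exists_dual_vector ℝ x (by rw [hxn]; norm_num)
    have hφx : φ x = 1 := by rw [hφ, hxn]; simp
    let ψ : G →ₗ[ℝ] ℝ := (φ : X →ₗ[ℝ] ℝ) ∘ₗ G.subtype
    let G' : Submodule ℝ X := (LinearMap.ker ψ).map G.subtype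
    have hψ : LinearMap.range ψ = ⊤ := LinearMap.range_eq_top.2 fun r =>
      ⟨⟨r • x, G.smul_mem _ hxG⟩, by simp [ψ, hφx]⟩
    have hG' : Module.finrank ℝ G' = m := by
      have h1 := LinearMap.finrank_range_add_finrank_ker ψ
      rw [hψ, finrank_top, Module.finrank_self, hm] at h1
      rw [Submodule.finrank_map_subtype_eq]
      omega
    obtain ⟨T', hT'r, hT'⟩ := ih G' inferInstance hG'
    have hmem' : ∀ y, T' y ∈ G ∧ φ (T' y) = 0 := fun y => by
      have : T' y ∈ G' := hT'r ▸ LinearMap.mem_range_self T' y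
      obtain ⟨z, hz, hzy⟩ := this
      rw [← hzy]
      exact ⟨z.2, hz⟩
    let T : (Fin (m + 1) → ℝ) →ₗ[ℝ] X :=
      (LinearMap.proj 0).smulRight x + T' ∘ₗ LinearMap.funLeft ℝ ℝ Fin.succ
    have hT : ∀ y, T y = y 0 • x + T' (fun i => y i.succ) := fun y => rfl
    have htail : ∀ y : Fin (m + 1) → ℝ, ‖fun i : Fin m => y i.succ‖ ≤ ‖y‖ := fun y =>
      (pi_norm_le_iff_of_nonneg (norm_nonneg _)).2 fun i => norm_le_pi_norm y _
    refine ⟨T, le_antisymm ?_ fun z hz => ?_, fun y => ⟨?_, ?_⟩⟩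
    · rintro _ ⟨y, rfl⟩
      rw [hT]
      exact G.add_mem (G.smul_mem _ hxG) (hmem' _).1
    · have h1 : z - φ z • x ∈ G' := by
        refine ⟨⟨z - φ z • x, G.sub_mem hz (G.smul_mem _ hxG)⟩, ?_, rfl⟩
        simp [ψ, hφx]
      rw [← hT'r] at h1
      obtain ⟨y, hy⟩ := h1
      refine ⟨Fin.cons (φ z) y, ?_⟩
      rw [hT]
      simp [hy]
    · rw [hT]
      calc ‖y 0 • x + T' fun i => y i.succ‖ ≤ ‖y 0 • x‖ + ‖T' fun i => y i.succ‖ := norm_add_le _ _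
        _ ≤ ‖y‖ + m * ‖y‖ := by
          gcongr
          · rw [norm_smul, hxn, mul_one]
            exact norm_le_pi_norm y 0
          · exact ((hT' _).1).trans (by gcongr; exact htail y)
        _ = _ := by push_cast; ring
    · have h0 : |y 0| ≤ ‖T y‖ := by
        have h1 : φ (T y) = y 0 := by simp [hT, hφx, (hmem' _).2]
        rw [← h1]
        simpa [hφ1] using φ.le_opNorm (T y)
      have h1 : ‖T' fun i => y i.succ‖ ≤ 2 * ‖T y‖ := by
        have h2 : (T' fun i => y i.succ) = T y - y 0 • x := by rw [hT]; abel
        rw [h2]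
        refine (norm_sub_le _ _).trans ?_
        rw [norm_smul, hxn, mul_one, Real.norm_eq_abs]
        linarith
      intro i
      refine Fin.cases ?_ (fun j => ?_) i
      · calc min 1 (β / 2) * |y 0| ≤ 1 * |y 0| := by gcongr; exact min_le_left _ _
          _ ≤ _ := by linarith
      · calc min 1 (β / 2) * |y j.succ| ≤ β / 2 * |y j.succ| := by gcongr; exact min_le_right _ _
          _ ≤ _ := by
            have := (hT' fun i => y i.succ).2 j
            linarith

theorem exists_le_biSup_Ico {F : ℕ → Submodule ℝ X} {n : ℕ} {G : Submodule ℝ X}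
    [FiniteDimensional ℝ G] (hG : G ≤ ⨆ i ∈ Set.Ici n, F i) :
    ∃ b, G ≤ ⨆ i ∈ Set.Ico n b, F i := by
  have hmono : Monotone fun b => ⨆ i ∈ Set.Ico n b, F i := fun b b' hb =>
    biSup_mono fun i hi => ⟨hi.1, hi.2.trans_le hb⟩
  have hsup : (⨆ i ∈ Set.Ici n, F i) ≤ ⨆ b, ⨆ i ∈ Set.Ico n b, F i :=
    iSup₂_le fun i hi => (le_biSup F (show i ∈ Set.Ico n (i + 1) from ⟨hi, by simp⟩)).trans
      (le_iSup (fun b => ⨆ i ∈ Set.Ico n b, F i) (i + 1))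
  obtain ⟨s, hs⟩ := (Submodule.fg_iff_finiteDimensional G).2 inferInstance
  have : ∀ x : X, ∃ b, x ∈ s → x ∈ ⨆ i ∈ Set.Ico n b, F i := by
    intro x
    by_cases hx : x ∈ s
    · have h1 : x ∈ ⨆ b, ⨆ i ∈ Set.Ico n b, F i := hsup (hG (hs ▸ Submodule.subset_span hx))
      obtain ⟨b, hb⟩ := (Submodule.mem_iSup_of_directed _ hmono.directed_le).1 h1
      exact ⟨b, fun _ => hb⟩
    · exact ⟨0, fun h => absurd h hx⟩
  choose b hb using this
  refine ⟨s.sup b, hs ▸ Submodule.span_le.2 fun x hx => ?_⟩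
  exact hmono (Finset.le_sup (f := b) hx) (hb x hx)

/-- Passing to a subsequence, uniformly bounded embeddings of a finite-dimensional space induce
comparable norms. -/
theorem exists_subseq_comparable {E : Type*} [NormedAddCommGroup E] [NormedSpace ℝ E]
    [FiniteDimensional ℝ E] (T : ℕ → E →ₗ[ℝ] X) {b β : ℝ} (hβ : 0 < β)
    (hb : ∀ k y, ‖T k y‖ ≤ b * ‖y‖) (hT : ∀ k y, β * ‖y‖ ≤ ‖T k y‖) :
    ∃ p : Seminorm ℝ E, Continuous p ∧ (∀ x, β * ‖x‖ ≤ p x) ∧ (∀ x, p x ≤ b * ‖x‖) ∧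
      ∃ θ : ℕ → ℕ, StrictMono θ ∧ ∀ k y, ‖T (θ k) y‖ ≤ 2 * p y ∧ p y ≤ 2 * ‖T (θ k) y‖ := by
  -- The limit norm p is taken along a free ultrafilter. A property holding eventually along it
  -- holds for infinitely many k, hence along a subsequence.
  let U : Ultrafilter ℕ := hyperfilter ℕ
  have hlim : ∀ y, ∃ l, Tendsto (fun k => ‖T k y‖) U (𝓝 l) := fun y =>
    U.exists_tendsto_of_abs_le (b := b * ‖y‖) fun k => by simpa using hb k y
  choose r hr using hlim
  let p : Seminorm ℝ E := Seminorm.of r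
    (fun x y => le_of_tendsto_of_tendsto' (hr (x + y)) ((hr x).add (hr y)) fun k => by
      rw [map_add]; exact norm_add_le _ _)
    (fun c x => tendsto_nhds_unique (hr (c • x)) (((hr x).const_mul ‖c‖).congr fun k => by
      rw [map_smul, norm_smul]))
  have hpb : ∀ x, p x ≤ b * ‖x‖ := fun x => le_of_tendsto' (hr x) fun k => hb k x
  have hpβ : ∀ x, β * ‖x‖ ≤ p x := fun x => ge_of_tendsto' (hr x) fun k => hT k x
  refine ⟨p, p.continuous_of_le_mul_norm hpb, hpβ, hpb, ?_⟩
  have hev := eventually_comparable_of_tendsto (l := (U : Filter ℕ))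
    (fun k => (normSeminorm ℝ X).comp (T k)) p hβ hb hpb hpβ hr
  have hfr : ∃ᶠ k in atTop, ∀ y, ‖T k y‖ ≤ 2 * p y ∧ p y ≤ 2 * ‖T k y‖ :=
    hev.frequently.filter_mono Nat.hyperfilter_le_atTop
  exact extraction_of_frequently_atTop hfr

/-- A sequence of successive copies of a badly Hilbertian finite-dimensional norm. -/
theorem exists_successive_copies {F : ℕ → Submodule ℝ X} {K : ℝ} (hK : 0 ≤ K)
    (h : ∃ m, ∀ n, ∃ G : Submodule ℝ X, FiniteDimensional ℝ G ∧ Module.finrank ℝ G = m ∧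
      G ≤ ⨆ i ∈ Set.Ici n, F i ∧ ¬ G.HilbertComparable (16 * K)) (n₀ : ℕ) :
    ∃ (m : ℕ) (p : Seminorm ℝ (Fin m → ℝ)) (T : ℕ → (Fin m → ℝ) →ₗ[ℝ] X) (a : ℕ → ℕ),
      Continuous p ∧ (∃ β > 0, ∀ x, β * ‖x‖ ≤ p x) ∧ ¬ HilbertComparable p K ∧
      Monotone a ∧ n₀ ≤ a 0 ∧ (∀ k y, T k y ∈ ⨆ i ∈ Set.Ico (a k) (a (k + 1)), F i) ∧
      ∀ k y, ‖T k y‖ ≤ 2 * p y ∧ p y ≤ 2 * ‖T k y‖ := by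
  obtain ⟨m, hm⟩ := h
  choose G hGf hGm hGle hGH using hm
  choose b hb using fun n => exists_le_biSup_Ico (hGle n)
  let a : ℕ → ℕ := fun n => Nat.rec n₀ (fun _ s => max s (b s)) n
  have ha : ∀ k, a (k + 1) = max (a k) (b (a k)) := fun k => rfl
  have hamono : Monotone a := monotone_nat_of_le_succ fun k => by rw [ha]; exact le_max_left _ _
  obtain ⟨β, hβ, hpar⟩ := exists_uniform_parametrization X m
  choose T hTr hTb using fun k => hpar (G (a k)) (hGf _) (hGm _)
  have hTβ : ∀ k y, β * ‖y‖ ≤ ‖T k y‖ := fun k y => by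
    rw [mul_comm, ← le_div_iff₀ hβ]
    refine (pi_norm_le_iff_of_nonneg (by positivity)).2 fun i => ?_
    rw [le_div_iff₀ hβ, mul_comm]
    exact (hTb k y).2 i
  obtain ⟨p, hpc, hpβ, -, θ, hθ, hθT⟩ := exists_subseq_comparable T hβ (fun k y => (hTb k y).1) hTβ
  refine ⟨m, p, fun k => T (θ k), a ∘ θ, hpc, ⟨β, hβ, hpβ⟩, fun hH => ?_,
    hamono.comp hθ.monotone, hamono (Nat.zero_le _), fun k y => ?_, hθT⟩
  -- The factor 16 in the hypothesis is 2² · 2², the loss in passing from p to the copy T (θ 0).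
  · apply hGH (a (θ 0))
    rw [← hTr]
    refine Submodule.hilbertComparable_of_range _ ((hH.of_le_of_le hK (fun x => norm_nonneg _)
      (fun x => apply_nonneg p x) (fun x => (hθT 0 x).1) (fun x => (hθT 0 x).2)).mono ?_)
    norm_num
  · have h1 : T (θ k) y ∈ G (a (θ k)) := hTr (θ k) ▸ LinearMap.mem_range_self _ y
    refine (biSup_mono fun i hi => ?_ : (⨆ i ∈ Set.Ico (a (θ k)) (b (a (θ k))), F i) ≤ _)
      (hb _ h1)
    refine ⟨hi.1, hi.2.trans_le ((le_max_right _ _).trans ((ha (θ k)).ge.trans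
      (hamono (show θ k + 1 ≤ θ (k + 1) from Nat.succ_le_of_lt (hθ (Nat.lt_succ_self k))))))⟩

end FiniteDimensional

/-! ### Concatenation and uniform Hilbertian bounds -/

section Concatenation

variable {X : Type u} [NormedAddCommGroup X] [NormedSpace ℝ X]

theorem exists_block_index {N : ℕ → ℕ} (hN : StrictMono N) (h0 : N 0 = 0) :
    ∃ J : ℕ → ℕ, Monotone J ∧ ∀ j k, J k = j ↔ N j ≤ k ∧ k < N (j + 1) := by
  have hex : ∀ k, ∃ j, N j ≤ k ∧ k < N (j + 1) := by
    intro k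
    have h1 : N (Nat.findGreatest (fun j => N j ≤ k) k) ≤ k :=
      Nat.findGreatest_spec (P := fun j => N j ≤ k) (Nat.zero_le k) (by omega)
    refine ⟨_, h1, ?_⟩
    by_contra h2
    push Not at h2
    have h3 : Nat.findGreatest (fun j => N j ≤ k) k + 1 ≤ k := (hN.le_apply).trans h2
    have := Nat.le_findGreatest (P := fun j => N j ≤ k) h3 h2
    omega
  choose J hJ using hex
  have hlt : ∀ {j j' k k' : ℕ}, N j ≤ k → k' < N (j' + 1) → k ≤ k' → j ≤ j' := by
    intro j j' k k' h1 h2 h3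
    have : N j < N (j' + 1) := by omega
    exact Nat.lt_succ_iff.1 (hN.lt_iff_lt.1 this)
  refine ⟨J, fun k k' h => hlt (hJ k).1 (hJ k').2 h, fun j k => ⟨fun h => h ▸ hJ k, fun h => ?_⟩⟩
  exact le_antisymm (hlt (hJ k).1 h.2 le_rfl) (hlt h.1 (hJ k).2 le_rfl)

/-- Badly Hilbertian finite families located far away can be concatenated to a sequence. -/
theorem exists_concatenation {F : ℕ → Submodule ℝ X} {P : ∀ d : ℕ, (Fin d → X) → Prop}
    (h : ∀ n₀ j : ℕ, ∃ (d : ℕ) (u : Fin d → X), (∀ i, u i ≠ 0) ∧ (∀ i, u i ∈ ⨆ i ∈ Set.Ici n₀, F i) ∧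
      P d u ∧ ¬ (Submodule.span ℝ (Set.range u)).HilbertComparable j) :
    ∃ (d : ℕ → ℕ) (u : ∀ j, Fin (d j) → X) (a N J : ℕ → ℕ) (e : ℕ → X),
      Monotone a ∧ (∀ j, Submodule.span ℝ (Set.range (u j)) ≤ ⨆ i ∈ Set.Ico (a j) (a (j + 1)), F i) ∧
      (∀ j, P (d j) (u j)) ∧
      (∀ j : ℕ, ¬ (Submodule.span ℝ (Set.range (u j))).HilbertComparable j) ∧
      (∀ k, e k ≠ 0) ∧ (∀ j i, u j i ∈ Set.range e) ∧ Monotone J ∧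
      ∀ k, ∃ i : Fin (d (J k)), k = N (J k) + i ∧ e k = u (J k) i := by
  choose d u hu0 huF hP huH using h
  have hspan : ∀ n₀ j, Submodule.span ℝ (Set.range (u n₀ j)) ≤ ⨆ i ∈ Set.Ici n₀, F i := fun n₀ j => by
    rw [Submodule.span_le]
    rintro _ ⟨i, rfl⟩
    exact huF n₀ j i
  have hfd : ∀ n₀ j, FiniteDimensional ℝ (Submodule.span ℝ (Set.range (u n₀ j))) := fun n₀ j =>
    FiniteDimensional.span_of_finite ℝ (Set.finite_range _)
  choose b hb using fun n₀ j => exists_le_biSup_Ico (hspan n₀ j)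
  -- An empty family spans the zero space, which is trivially Hilbertian. Nonempty families make the
  -- positions N strictly increasing.
  have hd : ∀ n₀ j, 0 < d n₀ j := fun n₀ j => by
    rw [Nat.pos_iff_ne_zero]
    intro h0
    refine huH n₀ j ⟨0, fun x => ?_⟩
    have : IsEmpty (Fin (d n₀ j)) := by rw [h0]; infer_instance
    have hx := x.2
    simp only [Set.range_eq_empty, Submodule.span_empty, Submodule.mem_bot] at hx
    simp [hx]
  let a : ℕ → ℕ := fun n => Nat.rec 0 (fun j s => max s (b s j)) n
  have ha : ∀ j, a (j + 1) = max (a j) (b (a j) j) := fun j => rfl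
  have hamono : Monotone a := monotone_nat_of_le_succ fun k => by rw [ha]; exact le_max_left _ _
  let N : ℕ → ℕ := fun j => ∑ i ∈ Finset.range j, d (a i) i
  have hN1 : ∀ j, N (j + 1) = N j + d (a j) j := fun j => Finset.sum_range_succ _ _
  have hN : StrictMono N := strictMono_nat_of_lt_succ fun j => by
    rw [hN1]; exact Nat.lt_add_of_pos_right (hd _ _)
  obtain ⟨J, hJm, hJ⟩ := exists_block_index hN (by simp [N])
  have hJs : ∀ k, k - N (J k) < d (a (J k)) (J k) := fun k => by
    have := (hJ (J k) k).1 rfl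
    rw [hN1] at this
    omega
  refine ⟨fun j => d (a j) j, fun j => u (a j) j, a, N, J,
    fun k => u (a (J k)) (J k) ⟨k - N (J k), hJs k⟩, hamono, fun j => ?_, fun j => hP _ _,
    fun j => huH _ _, fun k => hu0 _ _ _, fun j i => ?_, hJm, fun k => ⟨⟨_, hJs k⟩, ?_, rfl⟩⟩
  · refine (hb (a j) j).trans (biSup_mono fun i hi => ⟨hi.1, hi.2.trans_le ?_⟩)
    rw [ha]
    exact le_max_right _ _
  · have h1 : J (N j + i) = j := (hJ _ _).2 ⟨by omega, by
      rw [hN1]; have : (i : ℕ) < d (a j) j := i.2; omega⟩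
    refine ⟨N j + i, ?_⟩
    have key : ∀ (j' : ℕ) (hj' : j' = j) (h : N j + i - N j' < d (a j') j'),
        u (a j') j' ⟨N j + i - N j', h⟩ = u (a j) j i := by
      rintro _ rfl h
      congr 1
      ext
      simp
    exact key _ h1 _
  · have := (hJ (J k) k).1 rfl
    simp only
    omega

/-- If no bound worked on any tail, the concatenation of ever worse families would be a basic
sequence whose span contains all of them, contradicting `H`. -/
theorem exists_uniform_hilbertComparable_schauder
    (H : ∀ e : ℕ → X, (∀ k, e k ≠ 0) → ∀ C, IsSchauderDecomp (fun i => Submodule.span ℝ {e i}) C →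
      ∃ c, (Submodule.span ℝ (Set.range e)).HilbertComparable c)
    {F : ℕ → Submodule ℝ X} {C : ℝ} (hF : IsSchauderDecomp F C) {C' : ℝ} (hC' : 0 ≤ C') :
    ∃ (n₀ : ℕ) (D : ℝ), 0 ≤ D ∧ ∀ (d : ℕ) (u : Fin d → X), (∀ i, u i ≠ 0) →
      (∀ i, u i ∈ ⨆ i ∈ Set.Ici n₀, F i) →
      (∀ r : ℕ, ProjBound (fun i => Submodule.span ℝ {u i}) {i : Fin d | (i : ℕ) < r} C') →
      (Submodule.span ℝ (Set.range u)).HilbertComparable D := by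
  by_contra! hcon
  obtain ⟨d, u, a, N, J, e, ha, hua, hP, huH, he, hue, hJ, hek⟩ := exists_concatenation
    (P := fun d u => ∀ r : ℕ, ProjBound (fun i => Submodule.span ℝ {u i})
      {i : Fin d | (i : ℕ) < r} C') fun n₀ j => hcon n₀ j (Nat.cast_nonneg j)
  have hG : IsSchauderDecomp (fun j => Submodule.span ℝ (Set.range (u j))) C :=
    hF.blocks ha hua
  set G := fun j => Submodule.span ℝ (Set.range (u j))
  have hGle : ∀ (A : Set ℕ) (j : ℕ), j ∈ A → G j ≤ ⨆ i ∈ A, G i := fun A j hj => le_biSup G hj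
  have heG : ∀ k, Submodule.span ℝ {e k} ≤ G (J k) := fun k => by
    obtain ⟨i, -, hi⟩ := hek k
    rw [Submodule.span_singleton_le_iff_mem, hi]
    exact Submodule.subset_span ⟨i, rfl⟩
  -- A cut inside block j combines the projection onto the earlier blocks, costing C, with a cut
  -- inside block j, costing C'; the part in block j is a difference of two block projections,
  -- costing 2C.
  have hdec : IsSchauderDecomp (fun i => Submodule.span ℝ {e i}) (C + C' * (2 * C)) := by
    intro n x hx y hy
    obtain ⟨j, hjn⟩ : ∃ j, J n = j := ⟨_, rfl⟩
    obtain ⟨r, hnr⟩ : ∃ r, n = N j + r := by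
      obtain ⟨i, hi, -⟩ := hek n
      exact ⟨i, hjn ▸ hi⟩
    have h1 : ⨆ k ∈ Set.Iio n, Submodule.span ℝ {e k} ≤ (⨆ i ∈ Set.Iio j, G i) ⊔
        ⨆ i ∈ {i : Fin (d j) | (i : ℕ) < r}, Submodule.span ℝ {u j i} := by
      refine iSup₂_le fun k hk => ?_
      rcases ((hJ (le_of_lt hk)).trans_eq hjn).lt_or_eq with hlt | heq
      · exact (heG k).trans ((hGle (Set.Iio j) _ hlt).trans le_sup_left)
      · obtain ⟨i, hi, hei⟩ := hek k
        rw [hei]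
        clear hei
        generalize J k = j' at i hi heq
        subst j'
        have hir : (i : ℕ) < r := by have : k < n := hk; omega
        exact (le_biSup (fun i => Submodule.span ℝ {u j i})
          (show i ∈ {i : Fin (d j) | (i : ℕ) < r} from hir)).trans le_sup_right
    have h2 : ⨆ k ∈ (Set.Iio n)ᶜ, Submodule.span ℝ {e k} ≤
        (⨆ i ∈ {i : Fin (d j) | (i : ℕ) < r}ᶜ, Submodule.span ℝ {u j i}) ⊔
        ⨆ i ∈ (Set.Iio (j + 1))ᶜ, G i := by
      refine iSup₂_le fun k hk => ?_
      have hk' : n ≤ k := by simpa using hk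
      rcases (hjn.symm.trans_le (hJ hk')).lt_or_eq with hlt | heq
      · exact (heG k).trans ((hGle (Set.Iio (j + 1))ᶜ _ (by
          simp; omega)).trans le_sup_right)
      · obtain ⟨i, hi, hei⟩ := hek k
        rw [hei]
        clear hei
        generalize J k = j' at i hi heq
        subst heq
        have hir : ¬ (i : ℕ) < r := by omega
        exact (le_biSup (fun i => Submodule.span ℝ {u j i})
          (show i ∈ {i : Fin (d j) | (i : ℕ) < r}ᶜ from hir)).trans le_sup_left
    obtain ⟨x1, hx1, x2, hx2, rfl⟩ := Submodule.mem_sup.1 (h1 hx)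
    obtain ⟨y1, hy1, y2, hy2, rfl⟩ := Submodule.mem_sup.1 (h2 hy)
    have hsub : ∀ A : Set (Fin (d j)), ⨆ i ∈ A, Submodule.span ℝ {u j i} ≤ G j := fun A =>
      iSup₂_le fun i _ => Submodule.span_mono (by simp)
    have hle : ∀ {j₁ j₂ : ℕ}, j₁ ≤ j₂ → (⨆ i ∈ (Set.Iio j₂)ᶜ, G i) ≤ ⨆ i ∈ (Set.Iio j₁)ᶜ, G i :=
      fun hj => biSup_mono fun i hi => by
        simp only [Set.compl_Iio, Set.mem_Ici] at hi ⊢; omega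
    have hjmem : G j ≤ ⨆ i ∈ (Set.Iio j)ᶜ, G i := hGle _ _ (by simp)
    have hjmem' : G j ≤ ⨆ i ∈ Set.Iio (j + 1), G i :=
      hGle _ _ (by simp)
    have e1 : ‖x1‖ ≤ C * ‖x1 + x2 + (y1 + y2)‖ := by
      have := hG j x1 hx1 (x2 + (y1 + y2)) (Submodule.add_mem _ (hjmem (hsub _ hx2))
        (Submodule.add_mem _ (hjmem (hsub _ hy1)) (hle (Nat.le_succ j) hy2)))
      rwa [← add_assoc] at this
    have e2 : ‖x1 + x2 + y1‖ ≤ C * ‖x1 + x2 + (y1 + y2)‖ := by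
      have := hG (j + 1) (x1 + x2 + y1) (Submodule.add_mem _ (Submodule.add_mem _
        ((biSup_mono fun i hi => Set.mem_Iio.2 ((Set.mem_Iio.1 hi).trans (Nat.lt_succ_self j)) :
          (⨆ i ∈ Set.Iio j, G i) ≤ _) hx1)
        (hjmem' (hsub _ hx2))) (hjmem' (hsub _ hy1))) y2 hy2
      rwa [add_assoc _ y1] at this
    have e3 : ‖x2‖ ≤ C' * ‖x2 + y1‖ := hP j r x2 hx2 y1 hy1
    have e4 : ‖x2 + y1‖ ≤ 2 * C * ‖x1 + x2 + (y1 + y2)‖ := by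
      have : x2 + y1 = (x1 + x2 + y1) - x1 := by abel
      rw [this]
      refine (norm_sub_le _ _).trans ?_
      linarith
    calc ‖x1 + x2‖ ≤ ‖x1‖ + ‖x2‖ := norm_add_le _ _
      _ ≤ C * ‖x1 + x2 + (y1 + y2)‖ + C' * (2 * C * ‖x1 + x2 + (y1 + y2)‖) :=
        add_le_add e1 (e3.trans (by gcongr))
      _ = _ := by ring
  obtain ⟨c, hc⟩ := H e he _ hdec
  obtain ⟨j, hj⟩ := exists_nat_ge c
  exact huH j ((hc.anti (Submodule.span_mono (by rintro _ ⟨i, rfl⟩; exact hue j i))).mono hj)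

/-- Norms of sums along the decomposition are comparable with square sums. -/
def IsL2Decomp (F : ℕ → Submodule ℝ X) (D : ℝ) : Prop :=
  ∀ x : ℕ → X, (∀ k, x k ∈ F k) → ∀ N : ℕ,
    ‖∑ k ∈ Finset.range N, x k‖ ^ 2 ≤ D * ∑ k ∈ Finset.range N, ‖x k‖ ^ 2 ∧
      ∑ k ∈ Finset.range N, ‖x k‖ ^ 2 ≤ D * ‖∑ k ∈ Finset.range N, x k‖ ^ 2

theorem exists_eq_sum_of_mem_iSup {F : ℕ → Submodule ℝ X} {x : X} (hx : x ∈ ⨆ i, F i) :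
    ∃ f : ℕ → X, (∀ i, f i ∈ F i) ∧ ∃ N₀, ∀ N ≥ N₀, ∑ i ∈ Finset.range N, f i = x := by
  obtain ⟨f, hf, rfl⟩ := (Submodule.mem_iSup_iff_exists_finsupp F x).1 hx
  refine ⟨f, hf, f.support.sup id + 1, fun N hN => ?_⟩
  rw [Finsupp.sum]
  refine (Finset.sum_subset (fun i hi => ?_) fun i _ hi => by simpa using hi).symm
  have : i ≤ f.support.sup id := Finset.le_sup (f := id) hi
  simp
  omega

/-- The concatenation argument again, now for arbitrary index sets. Simultaneous projections inside
infinitely many blocks are controlled because the blocks form ℓ₂-decompositions, where bounds on the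
single blocks pass to their sum. -/
theorem exists_uniform_hilbertComparable_uncond
    (H : ∀ e : ℕ → X, (∀ k, e k ≠ 0) → ∀ C, IsUncondDecomp (fun i => Submodule.span ℝ {e i}) C →
      ∃ c, (Submodule.span ℝ (Set.range e)).HilbertComparable c)
    {F : ℕ → Submodule ℝ X} {C : ℝ} (hC : 0 ≤ C)
    (hF : ∀ (G : ℕ → Submodule ℝ X) (a : ℕ → ℕ), Monotone a →
      (∀ j, G j ≤ ⨆ i ∈ Set.Ico (a j) (a (j + 1)), F i) → IsL2Decomp G C) {C' : ℝ} (hC' : 0 ≤ C') :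
    ∃ (n₀ : ℕ) (D : ℝ), 0 ≤ D ∧ ∀ (d : ℕ) (u : Fin d → X), (∀ i, u i ≠ 0) →
      (∀ i, u i ∈ ⨆ i ∈ Set.Ici n₀, F i) →
      IsUncondDecomp (fun i => Submodule.span ℝ {u i}) C' →
      (Submodule.span ℝ (Set.range u)).HilbertComparable D := by
  by_contra! hcon
  obtain ⟨d, u, a, N, J, e, ha, hua, hP, huH, he, hue, hJ, hek⟩ := exists_concatenation
    (P := fun d u => IsUncondDecomp (fun i => Submodule.span ℝ {u i}) C')
      fun n₀ j => hcon n₀ j (Nat.cast_nonneg j)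
  have hG := hF (fun j => Submodule.span ℝ (Set.range (u j))) a ha hua
  have hdec : IsUncondDecomp (fun i => Submodule.span ℝ {e i}) (C * C') := by
    intro A x hx y hy
    let S : ∀ j, Set (Fin (d j)) := fun j => {i | N j + i ∈ A}
    have h1 : ⨆ k ∈ A, Submodule.span ℝ {e k} ≤ ⨆ j, ⨆ i ∈ S j, Submodule.span ℝ {u j i} := by
      refine iSup₂_le fun k hk => ?_
      obtain ⟨i, hi, hei⟩ := hek k
      rw [hei]
      exact (le_biSup (fun i => Submodule.span ℝ {u (J k) i})
        (show i ∈ S (J k) by rw [hi] at hk; exact hk)).trans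
        (le_iSup (fun j => ⨆ i ∈ S j, Submodule.span ℝ {u j i}) (J k))
    have h2 : ⨆ k ∈ Aᶜ, Submodule.span ℝ {e k} ≤ ⨆ j, ⨆ i ∈ (S j)ᶜ, Submodule.span ℝ {u j i} := by
      refine iSup₂_le fun k hk => ?_
      obtain ⟨i, hi, hei⟩ := hek k
      rw [hei]
      exact (le_biSup (fun i => Submodule.span ℝ {u (J k) i})
        (show i ∈ (S (J k))ᶜ by rw [hi] at hk; exact hk)).trans
        (le_iSup (fun j => ⨆ i ∈ (S j)ᶜ, Submodule.span ℝ {u j i}) (J k))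
    obtain ⟨f, hf, n1, hn1⟩ := exists_eq_sum_of_mem_iSup (h1 hx)
    obtain ⟨g, hg, n2, hn2⟩ := exists_eq_sum_of_mem_iSup (h2 hy)
    rw [← hn1 (max n1 n2) (le_max_left _ _), ← hn2 (max n1 n2) (le_max_right _ _)]
    set n := max n1 n2
    have hsub : ∀ (j : ℕ) (B : Set (Fin (d j))), ⨆ i ∈ B, Submodule.span ℝ {u j i} ≤
        Submodule.span ℝ (Set.range (u j)) := fun j B =>
      iSup₂_le fun i _ => Submodule.span_mono (by simp)
    have e1 := (hG f (fun j => hsub j _ (hf j)) n).1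
    have e2 := (hG (fun j => f j + g j) (fun j => Submodule.add_mem _ (hsub j _ (hf j))
      (hsub j _ (hg j))) n).2
    rw [← Finset.sum_add_distrib]
    refine (pow_le_pow_iff_left₀ (norm_nonneg _) (by positivity) two_ne_zero).1 ?_
    calc ‖∑ i ∈ Finset.range n, f i‖ ^ 2 ≤ C * ∑ i ∈ Finset.range n, ‖f i‖ ^ 2 := e1
      _ ≤ C * ∑ i ∈ Finset.range n, (C' * ‖f i + g i‖) ^ 2 := by
        gcongr with i
        exact hP i (S i) _ (hf i) _ (hg i)
      _ = C * C' ^ 2 * ∑ i ∈ Finset.range n, ‖f i + g i‖ ^ 2 := by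
        simp only [mul_pow, ← Finset.mul_sum]; ring
      _ ≤ C * C' ^ 2 * (C * ‖∑ i ∈ Finset.range n, (f i + g i)‖ ^ 2) := by gcongr
      _ = _ := by ring
  obtain ⟨c, hc⟩ := H e he _ hdec
  obtain ⟨j, hj⟩ := exists_nat_ge c
  exact huH j ((hc.anti (Submodule.span_mono (by rintro _ ⟨i, rfl⟩; exact hue j i))).mono hj)

end Concatenation

/-! ### Iterated ultrafilter limits and suppression of coordinates -/

section IteratedLimits

variable {X : Type u} [NormedAddCommGroup X] [NormedSpace ℝ X]
variable {V : Type*} [NormedAddCommGroup V] [NormedSpace ℝ V]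

/-- Convex Lipschitz functions do not decrease under asymptotic perturbation by differences of a
bounded sequence. -/
theorem ConvexOn.le_of_tendsto_differences {g : X → ℝ} (hg : ConvexOn ℝ Set.univ g)
    (hgl : ∀ x y, |g x - g y| ≤ ‖x - y‖) {v : ℕ → X} {b : ℝ} (hv : ∀ k, ‖v k‖ ≤ b)
    (U : Ultrafilter ℕ) {x : X} {ℓ : ℝ}
    (h : Tendsto (fun k : ℕ × ℕ => g (x + (v k.1 - v k.2)))
      (U.bind fun k => U.map fun l => (k, l) : Ultrafilter (ℕ × ℕ)) (𝓝 ℓ)) : g x ≤ ℓ := by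
  refine le_of_forall_pos_le_add fun ε hε => ?_
  have h1 : ∀ᶠ k : ℕ in (U : Filter ℕ), ∀ᶠ l : ℕ in (U : Filter ℕ),
      g (x + (v k - v l)) < ℓ + ε / 2 :=
    h.eventually (gt_mem_nhds (by linarith : ℓ < ℓ + ε / 2))
  -- From a good k one can step to a good l with the value at x + (v k - v l) still small. The
  -- resulting chain has telescoping differences, so its average is x plus a term of norm at most
  -- 2b/n, and convexity bounds g there.
  let good : Set ℕ := {k | ∀ᶠ l : ℕ in (U : Filter ℕ), g (x + (v k - v l)) < ℓ + ε / 2}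
  have hstep : ∀ k : good, ∃ l : good, g (x + (v k - v l)) < ℓ + ε / 2 := fun k => by
    obtain ⟨l, hl1, hl2⟩ := (h1.and k.2).exists
    exact ⟨⟨l, hl1⟩, hl2⟩
  choose f hf using hstep
  obtain ⟨k₀, hk₀⟩ := h1.exists
  let κ : ℕ → good := fun i => f^[i] ⟨k₀, hk₀⟩
  have hκ : ∀ i, g (x + (v (κ i) - v (κ (i + 1)))) < ℓ + ε / 2 := fun i => by
    simp only [κ, Function.iterate_succ_apply']
    exact hf _
  obtain ⟨n, hn⟩ := exists_nat_gt (4 * b / ε)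
  have hb : 0 ≤ b := (norm_nonneg _).trans (hv 0)
  have hn0 : (0 : ℝ) < n := lt_of_le_of_lt (by positivity) hn
  have hJ := hg.map_sum_le (t := Finset.range n) (w := fun _ => (n : ℝ)⁻¹)
    (p := fun i => x + (v (κ i) - v (κ (i + 1)))) (fun _ _ => by positivity)
    (by simp [hn0.ne']) (fun _ _ => Set.mem_univ _)
  have hsum : ∑ i ∈ Finset.range n, (n : ℝ)⁻¹ • (x + (v (κ i) - v (κ (i + 1)))) =
      x + (n : ℝ)⁻¹ • (v (κ 0) - v (κ n)) := by
    rw [← Finset.smul_sum, Finset.sum_add_distrib,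
      Finset.sum_range_sub' (fun i => v (κ i)), smul_add]
    simp only [Finset.sum_const, Finset.card_range, ← Nat.cast_smul_eq_nsmul ℝ, smul_smul]
    rw [inv_mul_cancel₀ hn0.ne', one_smul]
  rw [hsum] at hJ
  have hle : ∑ i ∈ Finset.range n, (n : ℝ)⁻¹ • g (x + (v (κ i) - v (κ (i + 1)))) ≤ ℓ + ε / 2 := by
    calc _ ≤ ∑ i ∈ Finset.range n, (n : ℝ)⁻¹ * (ℓ + ε / 2) :=
          Finset.sum_le_sum fun i _ => by
            rw [smul_eq_mul]; exact mul_le_mul_of_nonneg_left (hκ i).le (by positivity)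
      _ = _ := by simp [hn0.ne']
  have hl := (abs_le.1 (hgl x (x + (n : ℝ)⁻¹ • (v (κ 0) - v (κ n))))).2
  have hnorm : ‖x - (x + (n : ℝ)⁻¹ • (v (κ 0) - v (κ n)))‖ ≤ ε / 2 := by
    rw [sub_add_cancel_left, norm_neg, norm_smul, Real.norm_of_nonneg (by positivity),
      inv_mul_le_iff₀ hn0]
    rw [div_lt_iff₀ hε] at hn
    have := norm_sub_le (v (κ 0)) (v (κ n))
    have := hv (κ 0)
    have := hv (κ n)
    linarith
  linarith

/-- The `N`-fold iterate of an ultrafilter. -/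
noncomputable def Ultrafilter.iter {κ : Type*} (W : Ultrafilter κ) : ∀ N, Ultrafilter (Fin N → κ)
  | 0 => pure Fin.elim0
  | N + 1 => W.bind fun k => (Ultrafilter.iter W N).map (Fin.cons k)

theorem Ultrafilter.eventually_iter_succ {κ : Type*} (W : Ultrafilter κ) (N : ℕ)
    (P : (Fin (N + 1) → κ) → Prop) :
    (∀ᶠ s in (W.iter (N + 1) : Filter (Fin (N + 1) → κ)), P s) ↔
      ∀ᶠ k in (W : Filter κ), ∀ᶠ s in (W.iter N : Filter (Fin N → κ)), P (Fin.cons k s) :=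
  Iff.rfl

/-- The iterated limit of the norms `‖x + ∑ i, S (s i) (y i)‖`. -/
noncomputable def iterLim {κ : Type*} (W : Ultrafilter κ) (S : κ → V →ₗ[ℝ] X) {N : ℕ}
    (y : Fin N → V) (x : X) : ℝ :=
  limUnder (W.iter N : Filter (Fin N → κ)) fun s : Fin N → κ => ‖x + ∑ i, S (s i) (y i)‖

variable {κ : Type*} {W : Ultrafilter κ} {S : κ → V →ₗ[ℝ] X} {b : ℝ}

theorem norm_sum_apply_le (hb : 0 ≤ b) (hS : ∀ k y, ‖S k y‖ ≤ b * ‖y‖) {N : ℕ} (y : Fin N → V)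
    (s : Fin N → κ) : ‖∑ i, S (s i) (y i)‖ ≤ N * b * ‖y‖ := by
  refine (norm_sum_le _ _).trans ?_
  calc ∑ i, ‖S (s i) (y i)‖ ≤ ∑ i : Fin N, b * ‖y‖ :=
        Finset.sum_le_sum fun i _ => (hS _ _).trans (by gcongr; exact norm_le_pi_norm y i)
    _ = _ := by simp [mul_assoc]

theorem tendsto_iterLim (hb : 0 ≤ b) (hS : ∀ k y, ‖S k y‖ ≤ b * ‖y‖) {N : ℕ} (y : Fin N → V)
    (x : X) : Tendsto (fun s : Fin N → κ => ‖x + ∑ i, S (s i) (y i)‖) (W.iter N : Filter (Fin N → κ)) (𝓝 (iterLim W S y x)) := by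
  refine tendsto_nhds_limUnder (Ultrafilter.exists_tendsto_of_abs_le _
    (b := ‖x‖ + N * b * ‖y‖) fun s => ?_)
  rw [abs_of_nonneg (norm_nonneg _)]
  exact (norm_add_le _ _).trans (by gcongr; exact norm_sum_apply_le hb hS y s)

/-- The first coordinate carries the outermost limit. This recursion allows induction on the number
of coordinates. -/
theorem tendsto_iterLim_succ (hb : 0 ≤ b) (hS : ∀ k y, ‖S k y‖ ≤ b * ‖y‖) {N : ℕ}
    (y : Fin (N + 1) → V) (x : X) :
    Tendsto (fun k => iterLim W S (Fin.tail y) (x + S k (y 0))) W (𝓝 (iterLim W S y x)) := by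
  rw [Metric.tendsto_nhds]
  intro ε hε
  have h := (Metric.tendsto_nhds.1 (tendsto_iterLim (W := W) hb hS y x)) (ε / 2) (by positivity)
  rw [Ultrafilter.eventually_iter_succ] at h
  filter_upwards [h] with k hk
  have hlim := (tendsto_iterLim (W := W) hb hS (Fin.tail y) (x + S k (y 0))).dist
    (tendsto_const_nhds (x := iterLim W S y x))
  refine (le_of_tendsto hlim (hk.mono fun s hs => ?_)).trans_lt (half_lt_self hε)
  rw [Fin.sum_univ_succ] at hs
  simpa [Fin.tail, add_assoc] using hs.le

theorem abs_iterLim_sub_le (hb : 0 ≤ b) (hS : ∀ k y, ‖S k y‖ ≤ b * ‖y‖) {N : ℕ} (y : Fin N → V)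
    (x x' : X) : |iterLim W S y x - iterLim W S y x'| ≤ ‖x - x'‖ := by
  refine le_of_tendsto ((tendsto_iterLim (W := W) hb hS y x).sub
    (tendsto_iterLim hb hS y x')).abs (Eventually.of_forall fun s => ?_)
  refine (abs_norm_sub_norm_le _ _).trans (le_of_eq ?_)
  congr 1
  abel

/-- With the Lipschitz bound, this makes the inner limit, as a function of x, an admissible g in the
hypothesis `hW` below. -/
theorem convexOn_iterLim (hb : 0 ≤ b) (hS : ∀ k y, ‖S k y‖ ≤ b * ‖y‖) {N : ℕ} (y : Fin N → V) :
    ConvexOn ℝ Set.univ (iterLim W S y) := by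
  refine ⟨convex_univ, fun x _ x' _ t t' ht ht' htt => ?_⟩
  refine le_of_tendsto_of_tendsto' (tendsto_iterLim (W := W) hb hS y _)
    (((tendsto_iterLim hb hS y x).const_smul t).add
      ((tendsto_iterLim hb hS y x').const_smul t')) fun s => ?_
  have : t • x + t' • x' + ∑ i, S (s i) (y i) =
      t • (x + ∑ i, S (s i) (y i)) + t' • (x' + ∑ i, S (s i) (y i)) := by
    simp only [smul_add]
    conv_lhs => rw [← one_smul ℝ (∑ i, S (s i) (y i)), ← htt, add_smul]
    abel
  rw [this]
  refine (norm_add_le _ _).trans (le_of_eq ?_)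
  rw [norm_smul, norm_smul, Real.norm_of_nonneg ht, Real.norm_of_nonneg ht', smul_eq_mul,
    smul_eq_mul]

/-- Iterated limits decrease when coordinates are suppressed. -/
theorem iterLim_suppress_le (hb : 0 ≤ b) (hS : ∀ k y, ‖S k y‖ ≤ b * ‖y‖)
    (hW : ∀ g : X → ℝ, ConvexOn ℝ Set.univ g → (∀ x y, |g x - g y| ≤ ‖x - y‖) → ∀ y x ℓ,
      Tendsto (fun k => g (x + S k y)) W (𝓝 ℓ) → g x ≤ ℓ) :
    ∀ {N : ℕ} (A : Fin N → Prop) [DecidablePred A] (y : Fin N → V) (x : X),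
      iterLim W S (fun i => if A i then y i else 0) x ≤ iterLim W S y x
  | 0, A, _, y, x => by
    rw [Subsingleton.elim (fun i => if A i then y i else 0) y]
  | N + 1, A, _, y, x => by
    have h1 := tendsto_iterLim_succ (W := W) hb hS y x
    have h2 := tendsto_iterLim_succ (W := W) hb hS (fun i => if A i then y i else 0) x
    have ih := iterLim_suppress_le hb hS hW (fun i => A (Fin.succ i)) (Fin.tail y)
    by_cases h0 : A 0
    · refine le_of_tendsto_of_tendsto' h2 h1 fun k => ?_
      simp only [h0, if_true]
      exact ih _
    -- With the first coordinate suppressed, the inner limit no longer depends on k; `hW` says that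
    -- restoring that coordinate cannot decrease the limit.
    · simp only [h0, if_false, map_zero, add_zero] at h2
      rw [tendsto_nhds_unique h2 tendsto_const_nhds]
      exact (ih x).trans (hW _ (convexOn_iterLim hb hS _) (abs_iterLim_sub_le hb hS _) _ _ _ h1)

/-- The iterated limit as a seminorm on `V ^ N`. -/
noncomputable def iterSeminorm (W : Ultrafilter κ) (hb : 0 ≤ b) (hS : ∀ k y, ‖S k y‖ ≤ b * ‖y‖)
    (N : ℕ) : Seminorm ℝ (Fin N → V) :=
  Seminorm.of (fun y => iterLim W S y 0)
    (fun y y' => le_of_tendsto_of_tendsto' (tendsto_iterLim hb hS _ _)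
      ((tendsto_iterLim hb hS y 0).add (tendsto_iterLim hb hS y' 0)) fun s => by
        simpa [Finset.sum_add_distrib] using norm_add_le _ _)
    fun t y => tendsto_nhds_unique (tendsto_iterLim hb hS _ _)
      (((tendsto_iterLim hb hS y 0).const_mul ‖t‖).congr fun s => by
        simp [← Finset.smul_sum, norm_smul])

/-- For the limit seminorm, suppression costs nothing. Suppressing all coordinates but one also
bounds it below, so on the finite-dimensional space V^N convergence is uniform up to a factor 2;
using it twice gives 4. -/
theorem eventually_iter_norm_suppress_le [FiniteDimensional ℝ V] (hb : 0 ≤ b)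
    (hS : ∀ k y, ‖S k y‖ ≤ b * ‖y‖)
    (hW : ∀ g : X → ℝ, ConvexOn ℝ Set.univ g → (∀ x y, |g x - g y| ≤ ‖x - y‖) → ∀ y x ℓ,
      Tendsto (fun k => g (x + S k y)) W (𝓝 ℓ) → g x ≤ ℓ)
    {β : ℝ} (hβ : 0 < β) (hβS : ∀ᶠ k in (W : Filter κ), ∀ y, β * ‖y‖ ≤ ‖S k y‖) (N : ℕ) :
    ∀ᶠ s in (W.iter N : Filter (Fin N → κ)), ∀ (A : Fin N → Prop) [DecidablePred A] (y : Fin N → V),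
      ‖∑ i, S (s i) (if A i then y i else 0)‖ ≤ 4 * ‖∑ i, S (s i) (y i)‖ := by
  have hcoord : ∀ {N : ℕ} (i : Fin N), ∀ᶠ s in (W.iter N : Filter (Fin N → κ)),
      ∀ y, β * ‖y‖ ≤ ‖S (s i) y‖ := by
    intro N
    induction N with
    | zero => exact fun i => i.elim0
    | succ N ih =>
      intro i
      rw [Ultrafilter.eventually_iter_succ]
      refine Fin.cases ?_ (fun i => ?_) i
      · filter_upwards [hβS] with k hk
        exact Eventually.of_forall fun s => by simpa using hk
      · exact Eventually.of_forall fun k => by simpa using ih i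
  let q : (Fin N → κ) → Seminorm ℝ (Fin N → V) := fun s =>
    (normSeminorm ℝ X).comp (∑ i, (S (s i)).comp (LinearMap.proj i))
  have hq : ∀ s y, q s y = ‖∑ i, S (s i) (y i)‖ := fun s y => by simp [q]
  have hqb : ∀ s y, q s y ≤ N * b * ‖y‖ := fun s y => by
    rw [hq]; exact norm_sum_apply_le hb hS y s
  let P := iterSeminorm W hb hS N
  have hP : ∀ y, P y = iterLim W S y 0 := fun y => rfl
  have hqP : ∀ y, Tendsto (fun s : Fin N → κ => q s y) (W.iter N : Filter (Fin N → κ)) (𝓝 (P y)) := fun y => by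
    simpa [hq, hP] using tendsto_iterLim (W := W) hb hS y 0
  have hsupp : ∀ (A : Fin N → Prop) [DecidablePred A] (y : Fin N → V),
      P (fun i => if A i then y i else 0) ≤ P y := fun A _ y => iterLim_suppress_le hb hS hW A y 0
  have hPβ : ∀ y, β * ‖y‖ ≤ P y := by
    intro y
    rw [mul_comm, ← le_div_iff₀ hβ]
    refine (pi_norm_le_iff_of_nonneg (by have := apply_nonneg P y; positivity)).2 fun i => ?_
    rw [le_div_iff₀ hβ, mul_comm]
    refine le_trans ?_ (hsupp (fun j => j = i) y)
    refine ge_of_tendsto (hqP _) ((hcoord i).mono fun s hs => ?_)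
    rw [hq, Finset.sum_eq_single i]
    · simpa using hs (y i)
    · intro j _ hj; simp [hj]
    · simp
  filter_upwards [eventually_comparable_of_tendsto q P hβ hqb
    (fun y => le_of_tendsto' (hqP y) fun s => hqb s y) hPβ hqP] with s hs A _ y
  have h1 := (hs (fun i => if A i then y i else 0)).1
  have h2 := (hs y).2
  have h3 := hsupp A y
  rw [hq] at h1 h2
  linarith

end IteratedLimits

/-! ### ℓ₂-sums from differences of copies -/

section Copies

variable {X : Type u} [NormedAddCommGroup X] [NormedSpace ℝ X]
variable {V : Type*} [NormedAddCommGroup V] [NormedSpace ℝ V]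

/-- Later indices are chosen along inner limits, hence eventually beyond all earlier ones; the
chosen differences therefore live on successive blocks. -/
theorem eventually_iter_chain {U : Ultrafilter ℕ} (hU : (U : Filter ℕ) ≤ atTop) :
    ∀ N b, ∀ᶠ s in ((Ultrafilter.iter (U.bind fun k => U.map fun l => (k, l)) N :
      Ultrafilter (Fin N → ℕ × ℕ)) : Filter (Fin N → ℕ × ℕ)),
      ∀ i, b ≤ (s i).1 ∧ (s i).1 < (s i).2 ∧ ∀ j, i < j → (s i).2 < (s j).1
  | 0, b => Eventually.of_forall fun s i => i.elim0
  | N + 1, b => by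
    rw [Ultrafilter.eventually_iter_succ]
    change ∀ᶠ k in (U : Filter ℕ), ∀ᶠ l in (U : Filter ℕ), _
    filter_upwards [hU (eventually_ge_atTop b)] with k hk
    filter_upwards [hU (eventually_gt_atTop k)] with l hl
    filter_upwards [eventually_iter_chain hU N (l + 1)] with s hs i
    refine Fin.cases ⟨hk, hl, fun j => ?_⟩ (fun i => ?_) i
    · refine Fin.cases (fun h => absurd h (lt_irrefl _)) (fun j _ => ?_) j
      exact (hs j).1
    · refine ⟨?_, (hs i).2.1, fun j => ?_⟩
      · have := (hs i).1
        simp only [Fin.cons_succ]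
        omega
      · refine Fin.cases (fun h => absurd h (by simp)) (fun j h => ?_) j
        exact (hs i).2.2 j (by simpa using h)

/-- Successive blocks form a basic family with constant C, so `hu` makes their span D-Hilbertian.
Suppression with constant b gives sign changes with constant 2b, and averaging over signs yields the
ℓ₂ estimate. -/
theorem sum_sq_comparable_of_suppress {F : ℕ → Submodule ℝ X} {C D b : ℝ}
    (hF : IsSchauderDecomp F C) (hC : 1 ≤ C) (hD : 0 ≤ D) {a : ℕ → ℕ} (ha : Monotone a) {n₀ : ℕ}
    (hn₀ : n₀ ≤ a 0)
    (hu : ∀ (d : ℕ) (u : Fin d → X), (∀ i, u i ≠ 0) → (∀ i, u i ∈ ⨆ i ∈ Set.Ici n₀, F i) →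
      (∀ r : ℕ, ProjBound (fun i => Submodule.span ℝ {u i}) {i : Fin d | (i : ℕ) < r} C) →
      (Submodule.span ℝ (Set.range u)).HilbertComparable D)
    {N : ℕ} {k l : Fin N → ℕ} (hkl : ∀ i, k i < l i) (hlk : ∀ i j, i < j → l i < k j)
    {x : Fin N → X} (hx0 : ∀ i, x i ≠ 0)
    (hx : ∀ i, x i ∈ ⨆ j ∈ Set.Ico (a (k i)) (a (l i + 1)), F j)
    (hs : ∀ (A : Fin N → Prop) [DecidablePred A] (t : Fin N → ℝ),
      ‖∑ i, (if A i then t i else 0) • x i‖ ≤ b * ‖∑ i, t i • x i‖) :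
    ‖∑ i, x i‖ ^ 2 ≤ (2 * b) ^ 2 * D * ∑ i, ‖x i‖ ^ 2 ∧
      ∑ i, ‖x i‖ ^ 2 ≤ (2 * b) ^ 2 * D * ‖∑ i, x i‖ ^ 2 := by
  refine sum_sq_comparable_of_unconditional x (fun ω ω' => ?_) hD (hu N x hx0 (fun i => ?_) ?_)
  · have h1 := hs (fun i => ω i = ω' i) (fun i => boolSign (ω' i))
    have h2 := hs (fun i => ω i ≠ ω' i) (fun i => boolSign (ω' i))
    have : ∑ i, boolSign (ω i) • x i = ∑ i, (if ω i = ω' i then boolSign (ω' i) else 0) • x i -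
        ∑ i, (if ω i ≠ ω' i then boolSign (ω' i) else 0) • x i := by
      rw [← Finset.sum_sub_distrib]
      refine Finset.sum_congr rfl fun i _ => ?_
      rw [← sub_smul]
      congr 1
      cases ω i <;> cases ω' i <;> simp [boolSign]
    rw [this]
    refine (norm_sub_le _ _).trans ?_
    linarith
  · refine (biSup_mono fun j hj => ?_ : _ ≤ ⨆ i ∈ Set.Ici n₀, F i) (hx i)
    exact hn₀.trans ((ha (Nat.zero_le _)).trans hj.1)
  · intro r
    have hxle : ∀ (B : Set ℕ) (i : Fin N), Set.Ico (a (k i)) (a (l i + 1)) ⊆ B →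
        Submodule.span ℝ {x i} ≤ ⨆ j ∈ B, F j := fun B i hB => by
      rw [Submodule.span_singleton_le_iff_mem]
      exact (biSup_mono fun j hj => hB hj : _ ≤ ⨆ i ∈ B, F i) (hx i)
    intro y hy z hz
    by_cases hr : r < N
    · refine hF (a (k ⟨r, hr⟩)) y ?_ z ?_
      · refine (iSup₂_le fun i hi => hxle _ i fun j hj => ?_ :
          _ ≤ ⨆ j ∈ Set.Iio (a (k ⟨r, hr⟩)), F j) hy
        exact hj.2.trans_le (ha (hlk i ⟨r, hr⟩ hi))
      · refine (iSup₂_le fun i hi => hxle _ i fun j hj => ?_ :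
          _ ≤ ⨆ j ∈ (Set.Iio (a (k ⟨r, hr⟩)))ᶜ, F j) hz
        simp only [Set.compl_Iio, Set.mem_Ici]
        refine (ha ?_).trans hj.1
        rcases (not_lt.1 hi : r ≤ i).lt_or_eq with h | h
        · exact ((hkl _).trans (hlk ⟨r, hr⟩ i h)).le
        · exact (congrArg k (Fin.ext h : (⟨r, hr⟩ : Fin N) = i)).le
    · have : {i : Fin N | (i : ℕ) < r}ᶜ = ∅ := by
        ext i
        simp only [Set.mem_compl_iff, Set.mem_empty_iff_false, iff_false, not_not]
        exact i.2.trans_le (not_lt.1 hr)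
      rw [this] at hz
      simp only [Set.mem_empty_iff_false, iSup_false, iSup_bot, Submodule.mem_bot] at hz
      rw [hz, add_zero]
      nlinarith [norm_nonneg y]

/-- Differences of successive copies of a finite-dimensional space can be chosen to span an
`ℓ₂`-sum. -/
theorem exists_l2_copies [FiniteDimensional ℝ V] [Nontrivial V] {F : ℕ → Submodule ℝ X} {C D : ℝ}
    (hF : IsSchauderDecomp F C) (hC : 1 ≤ C) (hD : 0 ≤ D) {a : ℕ → ℕ} (ha : Monotone a) {n₀ : ℕ}
    (hn₀ : n₀ ≤ a 0)
    (hu : ∀ (d : ℕ) (u : Fin d → X), (∀ i, u i ≠ 0) → (∀ i, u i ∈ ⨆ i ∈ Set.Ici n₀, F i) →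
      (∀ r : ℕ, ProjBound (fun i => Submodule.span ℝ {u i}) {i : Fin d | (i : ℕ) < r} C) →
      (Submodule.span ℝ (Set.range u)).HilbertComparable D)
    (p : Seminorm ℝ V) (hp : Continuous p) {β : ℝ} (hβ : 0 < β) (hβp : ∀ x, β * ‖x‖ ≤ p x)
    (T : ℕ → V →ₗ[ℝ] X) (hT : ∀ k y, T k y ∈ ⨆ i ∈ Set.Ico (a k) (a (k + 1)), F i)
    (hTp : ∀ k y, ‖T k y‖ ≤ 2 * p y ∧ p y ≤ 2 * ‖T k y‖) (N : ℕ) :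
    ∃ S : Fin N → V →ₗ[ℝ] X, (∀ k y, S k y ∈ ⨆ i ∈ Set.Ici n₀, F i) ∧ ∀ y : Fin N → V,
      ‖∑ k, S k (y k)‖ ^ 2 ≤ (1024 * C ^ 2 * D) * ∑ k, p (y k) ^ 2 ∧
      ∑ k, p (y k) ^ 2 ≤ (1024 * C ^ 2 * D) * ‖∑ k, S k (y k)‖ ^ 2 := by
  obtain ⟨γ, hγ, hpγ⟩ : ∃ γ, 0 ≤ γ ∧ ∀ y, p y ≤ γ * ‖y‖ := by
    obtain ⟨γ, hγ, h⟩ := Seminorm.bound_of_continuous_normedSpace p hp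
    exact ⟨γ, hγ.le, h⟩
  set U : Ultrafilter ℕ := hyperfilter ℕ
  have hU : (U : Filter ℕ) ≤ atTop := Nat.hyperfilter_le_atTop
  -- Differences satisfy the convexity hypothesis of the suppression lemma by telescoping, which
  -- single copies need not do.
  let R : ℕ × ℕ → V →ₗ[ℝ] X := fun k => T k.1 - T k.2
  set W : Ultrafilter (ℕ × ℕ) := U.bind fun k => U.map fun l => (k, l)
  have hRp : ∀ k y, ‖R k y‖ ≤ 4 * p y := fun k y => by
    have := norm_sub_le (T k.1 y) (T k.2 y)
    have := (hTp k.1 y).1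
    have := (hTp k.2 y).1
    simp only [R, LinearMap.sub_apply]
    linarith
  have hRb : ∀ k y, ‖R k y‖ ≤ 4 * γ * ‖y‖ := fun k y => by
    have := hRp k y
    have := hpγ y
    linarith
  have hTblock : ∀ k y (B : Set ℕ), Set.Ico (a k) (a (k + 1)) ⊆ B → T k y ∈ ⨆ i ∈ B, F i :=
    fun k y B hB => (biSup_mono fun i hi => hB hi : _ ≤ ⨆ i ∈ B, F i) (hT k y)
  -- The initial projection cutting between the two blocks recovers T k.1 y from the difference.
  have hpR : ∀ k : ℕ × ℕ, k.1 < k.2 → ∀ y, p y ≤ 2 * C * ‖R k y‖ := fun k hk y => by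
    have h1 := hF (a (k.1 + 1)) (T k.1 y) (hTblock _ _ _ fun i hi => hi.2) (-T k.2 y)
      (Submodule.neg_mem _ (hTblock _ _ _ fun i hi => by
        simpa using (ha (Nat.succ_le_of_lt hk)).trans hi.1))
    rw [← sub_eq_add_neg] at h1
    have h2 := (hTp k.1 y).2
    simp only [R, LinearMap.sub_apply]
    linarith
  have hW : ∀ g : X → ℝ, ConvexOn ℝ Set.univ g → (∀ x y, |g x - g y| ≤ ‖x - y‖) → ∀ y x ℓ,
      Tendsto (fun k => g (x + R k y)) W (𝓝 ℓ) → g x ≤ ℓ := fun g hg hgl y x ℓ h =>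
    hg.le_of_tendsto_differences hgl (v := fun k => T k y) (b := 2 * p y) (fun k => (hTp k y).1) U h
  have hβR : ∀ᶠ k in (W : Filter (ℕ × ℕ)), ∀ y, β / (2 * C) * ‖y‖ ≤ ‖R k y‖ := by
    have : ∀ᶠ k in (W : Filter (ℕ × ℕ)), k.1 < k.2 := by
      change ∀ᶠ k in (U : Filter ℕ), ∀ᶠ l in (U : Filter ℕ), k < l
      exact Eventually.of_forall fun k => hU (eventually_gt_atTop k)
    filter_upwards [this] with k hk y
    rw [div_mul_eq_mul_div, div_le_iff₀ (by positivity), mul_comm _ (2 * C)]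
    exact (hβp y).trans (hpR k hk y)
  obtain ⟨s, hs, hchain⟩ := ((eventually_iter_norm_suppress_le (W := W) (S := R)
    (by positivity) hRb hW (by positivity) hβR N).and (eventually_iter_chain hU N 0)).exists
  refine ⟨fun i => R (s i), fun i y => Submodule.sub_mem _ ?_ ?_, fun y => ?_⟩
  · exact hTblock _ _ _ fun i hi => hn₀.trans ((ha (Nat.zero_le _)).trans hi.1)
  · exact hTblock _ _ _ fun i hi => hn₀.trans ((ha (Nat.zero_le _)).trans hi.1)
  have hRc : ∀ k, Continuous (R k) := fun k => LinearMap.continuous_of_finiteDimensional _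
  have hcl : IsClosed {y : Fin N → V | ‖∑ k, R (s k) (y k)‖ ^ 2 ≤
      (1024 * C ^ 2 * D) * ∑ k, p (y k) ^ 2 ∧
      ∑ k, p (y k) ^ 2 ≤ (1024 * C ^ 2 * D) * ‖∑ k, R (s k) (y k)‖ ^ 2} := by
    have h1 : Continuous fun y : Fin N → V => ‖∑ k, R (s k) (y k)‖ ^ 2 := by
      have := fun k => (hRc (s k)).comp (continuous_apply (A := fun _ : Fin N => V) k)
      exact (continuous_finsetSum _ fun k _ => this k).norm.pow 2
    have h2 : Continuous fun y : Fin N → V => ∑ k, p (y k) ^ 2 :=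
      continuous_finsetSum _ fun k _ => (hp.comp (continuous_apply k)).pow 2
    exact (isClosed_le h1 (h2.const_mul _)).inter (isClosed_le h2 (h1.const_mul _))
  have hdense : Dense (Set.univ.pi fun _ : Fin N => ({0}ᶜ : Set V)) := by
    refine dense_pi _ fun i _ => ?_
    have := Module.punctured_nhds_neBot ℝ V 0
    exact dense_compl_singleton 0
  refine hcl.closure_subset_iff.2 (fun y hy => ?_) (hdense y)
  have hy0 : ∀ i, y i ≠ 0 := fun i => hy i trivial
  -- Here b = 4 gives the factor 64 D. The comparison of the differences with p costs 16 in one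
  -- direction and 4C² in the other, and 1024 C² D covers both.
  have key := sum_sq_comparable_of_suppress hF hC hD ha hn₀ hu (k := fun i => (s i).1)
    (l := fun i => (s i).2) (fun i => (hchain i).2.1) (fun i j => (hchain i).2.2 j)
    (x := fun i => R (s i) (y i)) (b := 4) (fun i h0 => ?_) (fun i => ?_) (fun A _ t => ?_)
  · have e1 : ∑ i, ‖R (s i) (y i)‖ ^ 2 ≤ 16 * ∑ i, p (y i) ^ 2 := by
      rw [Finset.mul_sum]
      refine Finset.sum_le_sum fun i _ => ?_
      calc ‖R (s i) (y i)‖ ^ 2 ≤ (4 * p (y i)) ^ 2 := by gcongr; exact hRp _ _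
        _ = _ := by ring
    have e2 : ∑ i, p (y i) ^ 2 ≤ 4 * C ^ 2 * ∑ i, ‖R (s i) (y i)‖ ^ 2 := by
      rw [Finset.mul_sum]
      refine Finset.sum_le_sum fun i _ => ?_
      calc p (y i) ^ 2 ≤ (2 * C * ‖R (s i) (y i)‖) ^ 2 :=
            pow_le_pow_left₀ (apply_nonneg _ _) (hpR _ (hchain i).2.1 _) 2
        _ = _ := by ring
    have hC2 : 1 ≤ C ^ 2 := one_le_pow₀ hC
    constructor
    · calc _ ≤ (2 * 4) ^ 2 * D * ∑ i, ‖R (s i) (y i)‖ ^ 2 := key.1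
        _ ≤ (2 * 4) ^ 2 * D * (16 * ∑ i, p (y i) ^ 2) := by gcongr
        _ = 1024 * D * (1 * ∑ i, p (y i) ^ 2) := by ring
        _ ≤ 1024 * D * (C ^ 2 * ∑ i, p (y i) ^ 2) := by gcongr
        _ = _ := by ring
    · calc _ ≤ 4 * C ^ 2 * ∑ i, ‖R (s i) (y i)‖ ^ 2 := e2
        _ ≤ 4 * C ^ 2 * ((2 * 4) ^ 2 * D * ‖∑ i, R (s i) (y i)‖ ^ 2) := by
          gcongr; exact key.2
        _ = 256 * (C ^ 2 * D * ‖∑ i, R (s i) (y i)‖ ^ 2) := by ring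
        _ ≤ 1024 * (C ^ 2 * D * ‖∑ i, R (s i) (y i)‖ ^ 2) := by gcongr; norm_num
        _ = _ := by ring
  · have h1 := hβp (y i)
    have h2 := hpR _ (hchain i).2.1 (y i)
    rw [h0, norm_zero, mul_zero] at h2
    have := mul_pos hβ (norm_pos_iff.2 (hy0 i))
    linarith
  · refine Submodule.sub_mem _ ?_ ?_
    · exact hTblock _ _ _ fun j hj => ⟨hj.1, hj.2.trans_le (ha (by have := (hchain i).2.1; omega))⟩
    · exact hTblock _ _ _ fun j hj => ⟨(ha (hchain i).2.1.le).trans hj.1, hj.2⟩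
  · have := hs A (fun i => t i • y i)
    simpa [ite_smul, apply_ite] using this

end Copies

/-! ### The case of basic sequences -/

section SchauderCase

variable {X : Type u} [NormedAddCommGroup X] [NormedSpace ℝ X]

theorem IsD2Minimal.exists_schauderDecomp_not_hilbertComparable (hX : IsD2Minimal X) :
    ∃ (e : ℕ → X) (C : ℝ), (∀ k, e k ≠ 0) ∧ IsSchauderDecomp (fun i => Submodule.span ℝ {e i}) C ∧
      ∀ c, ¬ (Submodule.span ℝ (Set.range e)).HilbertComparable c := by
  by_contra! hcon
  have H : ∀ e : ℕ → X, (∀ k, e k ≠ 0) → ∀ C,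
      IsSchauderDecomp (fun i => Submodule.span ℝ {e i}) C →
      ∃ c, (Submodule.span ℝ (Set.range e)).HilbertComparable c := fun e he C h => hcon e C he h
  obtain ⟨F, hFfd, hF, hFl⟩ := exists_isSchauderDecomp_of_isLarge hX.1.isLarge_top
  have hlarge : ∀ (n : ℕ) (c : ℝ), ∃ b, ¬ (⨆ i ∈ Set.Ico n b, F i).HilbertComparable c := by
    intro n c
    obtain ⟨j, hj⟩ := exists_nat_ge c
    refine ⟨max n j + 1, fun h => hFl (max n j) ((h.anti (le_biSup F ?_)).mono ?_)⟩
    · exact ⟨le_max_left _ _, Nat.lt_succ_self _⟩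
    · exact hj.trans (by exact_mod_cast le_max_right _ _)
  -- The order of choices matters. D₁ bounds basic families of constant 2 and fixes the ℓ₂ constant
  -- a; D₂ bounds basic families of constant a; both fix K. Only then is a norm chosen that is not
  -- K-Hilbertian.
  obtain ⟨n₁, D₁, hD₁, h₁⟩ := exists_uniform_hilbertComparable_schauder H hF (C' := 2) (by norm_num)
  set a : ℝ := 1024 * 2 ^ 2 * D₁ + 1
  have ha1 : 1 ≤ a := le_add_of_nonneg_left (by positivity)
  obtain ⟨n₂, D₂, hD₂, h₂⟩ := exists_uniform_hilbertComparable_schauder H hF (C' := a)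
    (by linarith)
  set K := (a ^ 4 * D₂) ^ 2
  obtain ⟨m, p, T, A, hp, ⟨β, hβ, hβp⟩, hpK, hA, hA0, hTA, hTp⟩ := exists_successive_copies
    (K := K) (by positivity) (hX.exists_finrank F hF hlarge (16 * K)) (max n₁ n₂)
  have htail : ∀ n, n ≤ max n₁ n₂ → (⨆ i ∈ Set.Ici (max n₁ n₂), F i) ≤ ⨆ i ∈ Set.Ici n, F i :=
    fun n hn => biSup_mono fun i hi => hn.trans hi
  have hnt : Nontrivial (Fin m → ℝ) := by
    by_contra hne
    rw [not_nontrivial_iff_subsingleton] at hne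
    refine hpK ⟨0, fun x => ?_⟩
    simp [Subsingleton.elim x 0]
  refine hpK (hilbertComparable_of_copies p hp (fun x hx => ?_) ha1 hD₂
    (⨆ i ∈ Set.Ici (max n₁ n₂), F i) (fun N => ?_) fun d u hu0 huW hu => ?_)
  · have := hβp x
    rw [hx] at this
    exact norm_le_zero_iff.1 (nonpos_of_mul_nonpos_right this hβ)
  · obtain ⟨S, hSW, hS⟩ := exists_l2_copies hF (by norm_num) hD₁ hA hA0
      (fun d u hu0 huW hu => h₁ d u hu0 (fun i => htail _ (le_max_left _ _) (huW i)) hu)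
      p hp hβ hβp T hTA hTp N
    refine ⟨S, hSW, fun y => ⟨(hS y).1.trans ?_, (hS y).2.trans ?_⟩⟩
    · gcongr; simp [a]
    · gcongr; simp [a]
  · exact h₂ d u hu0 (fun i => htail _ (le_max_right _ _) (huW i)) fun r => hu _

end SchauderCase

/-! ### Uniform bounds for an unconditional FDD -/

section UFDD

theorem Summable.exists_norm_sum_le {X : Type*} [NormedAddCommGroup X] {f : ℕ → X} (hf : Summable f) :
    ∃ M, ∀ A : Finset ℕ, ‖∑ i ∈ A, f i‖ ≤ M := by
  obtain ⟨s, hs⟩ := hf.vanishing (Metric.ball_mem_nhds 0 one_pos)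
  refine ⟨∑ i ∈ s, ‖f i‖ + 1, fun A => ?_⟩
  rw [← Finset.sum_inter_add_sum_sdiff A s]
  refine (norm_add_le _ _).trans (add_le_add ?_ ?_)
  · exact (norm_sum_le _ _).trans (Finset.sum_le_sum_of_subset_of_nonneg
      Finset.inter_subset_right fun _ _ _ => norm_nonneg _)
  · exact (mem_ball_zero_iff.1 (hs _ Finset.sdiff_disjoint)).le

theorem SeriesConvergesTo.of_summable {X : Type u} [NormedAddCommGroup X] {w : ℕ → X} {x : X} (h : SeriesConvergesTo w x)
    (hs : Summable w) : HasSum w x := by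
  obtain ⟨y, hy⟩ := hs
  rwa [tendsto_nhds_unique h hy.tendsto_sum_nat]

variable {X : Type u} [NormedAddCommGroup X] [NormedSpace ℝ X]

theorem exists_eq_sum_of_mem_biSup {F : ℕ → Submodule ℝ X} {A : Set ℕ} {x : X}
    (hx : x ∈ ⨆ i ∈ A, F i) :
    ∃ f : ℕ → X, (∀ i, f i ∈ F i) ∧ (∀ i ∉ A, f i = 0) ∧
      ∃ N₀, ∀ N ≥ N₀, ∑ i ∈ Finset.range N, f i = x := by
  obtain ⟨f, hf, h⟩ := exists_eq_sum_of_mem_iSup hx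
  refine ⟨f, fun i => ?_, fun i hi => ?_, h⟩
  · exact (iSup_le fun _ => le_rfl : ⨆ _ : i ∈ A, F i ≤ F i) (hf i)
  · have := hf i
    simpa [hi] using this

theorem IsFDD.topologicalClosure_iSup {F : ℕ → Submodule ℝ X} (hF : IsFDD F) :
    (⨆ i, F i).topologicalClosure = ⊤ := by
  refine eq_top_iff.2 fun x _ => ?_
  obtain ⟨w, ⟨hw, hx⟩, -⟩ := hF.existsUnique_expansion x
  exact mem_closure_of_tendsto hx (Eventually.of_forall fun n =>
    Submodule.sum_mem _ fun i _ => (le_iSup F i) (hw i))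

/-- Closed graph theorem for the map sending x to the family of its finite partial sums over all
finite sets, in ℓ_∞. It takes values there because a summable family has bounded finite sums. -/
theorem IsUFDD.exists_norm_sum_le [CompleteSpace X] {F : ℕ → Submodule ℝ X} (hF : IsUFDD F) :
    ∃ C, ∀ w : ℕ → X, (∀ i, w i ∈ F i) → ∀ x, SeriesConvergesTo w x → ∀ A : Finset ℕ,
      ‖∑ i ∈ A, w i‖ ≤ C * ‖x‖ := by
  choose w hw hwu using hF.existsUnique_expansion
  have hadd : ∀ x y, w (x + y) = w x + w y := fun x y =>
    (hwu (x + y) (w x + w y) ⟨fun n => Submodule.add_mem _ ((hw x).1 n) ((hw y).1 n), by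
      simpa [SeriesConvergesTo, Finset.sum_add_distrib] using (hw x).2.add (hw y).2⟩).symm
  have hsmul : ∀ (c : ℝ) x, w (c • x) = c • w x := fun c x =>
    (hwu (c • x) (c • w x) ⟨fun n => Submodule.smul_mem _ _ ((hw x).1 n), by
      simpa [SeriesConvergesTo, Finset.smul_sum] using (hw x).2.const_smul c⟩).symm
  have hsum : ∀ x, HasSum (w x) x := fun x =>
    (hw x).2.of_summable (hF.unconditional _ (hw x).1 ⟨x, (hw x).2⟩)
  have hmem : ∀ x, Memℓp (fun A : Finset ℕ => ∑ i ∈ A, w x i) ∞ := fun x => by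
    obtain ⟨M, hM⟩ := (hsum x).summable.exists_norm_sum_le
    exact memℓp_infty ⟨M, by rintro _ ⟨A, rfl⟩; exact hM A⟩
  let g : X →ₗ[ℝ] lp (fun _ : Finset ℕ => X) ∞ :=
    { toFun := fun x => ⟨_, hmem x⟩
      map_add' := fun x y => by
        ext A
        change ∑ i ∈ A, w (x + y) i = ∑ i ∈ A, w x i + ∑ i ∈ A, w y i
        simp [hadd, Finset.sum_add_distrib]
      map_smul' := fun c x => by
        ext A
        simp [hsmul, Finset.smul_sum] }
  have hg : ∀ x A, (g x : Finset ℕ → X) A = ∑ i ∈ A, w x i := fun x A => rfl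
  have hcont : Continuous g := by
    refine LinearMap.continuous_of_seq_closed_graph g fun u x y hu hy => ?_
    have hpt : ∀ A, Tendsto (fun n => ∑ i ∈ A, w (u n) i) atTop (𝓝 ((y : Finset ℕ → X) A)) := by
      intro A
      rw [tendsto_iff_norm_sub_tendsto_zero] at hy ⊢
      refine squeeze_zero (fun _ => norm_nonneg _) (fun n => ?_) hy
      exact lp.norm_apply_le_norm ENNReal.top_ne_zero (g (u n) - y) A
    -- The limit family consists of the finite sums of its singleton values v i, which stay in the
    -- closed spaces F i. Convergence is uniform over finite sets, so Σ v i converges to x, and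
    -- uniqueness of the expansion identifies it.
    let v : ℕ → X := fun i => (y : Finset ℕ → X) {i}
    have hv : ∀ A, (y : Finset ℕ → X) A = ∑ i ∈ A, v i := fun A => by
      refine tendsto_nhds_unique (hpt A) (tendsto_finsetSum _ fun i _ => ?_)
      simpa using hpt {i}
    have hvF : ∀ i, v i ∈ F i := fun i => by
      have := hF.finiteDimensional i
      refine (Submodule.closed_of_finiteDimensional (F i)).mem_of_tendsto (hpt {i})
        (Eventually.of_forall fun n => ?_)
      simpa using (hw (u n)).1 i
    have hvx : SeriesConvergesTo v x := by
      rw [SeriesConvergesTo, Metric.tendsto_atTop]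
      intro ε hε
      obtain ⟨n, hn1, hn2⟩ := ((Metric.tendsto_nhds.1 hu (ε / 3) (by positivity)).and
        (Metric.tendsto_nhds.1 hy (ε / 3) (by positivity))).exists
      obtain ⟨N, hN⟩ := Metric.tendsto_atTop.1 (hw (u n)).2 (ε / 3) (by positivity)
      refine ⟨N, fun k hk => ?_⟩
      have h1 := hN k hk
      have h2 : dist (∑ i ∈ Finset.range k, v i) (∑ i ∈ Finset.range k, w (u n) i) < ε / 3 := by
        rw [← hv, dist_comm, dist_eq_norm]
        exact (lp.norm_apply_le_norm ENNReal.top_ne_zero (g (u n) - y) (Finset.range k)).trans_lt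
          (by rwa [← dist_eq_norm])
      have h3 := dist_triangle4 (∑ i ∈ Finset.range k, v i) (∑ i ∈ Finset.range k, w (u n) i) (u n) x
      linarith
    ext A
    rw [hg, hv, hwu x v ⟨hvF, hvx⟩]
  refine ⟨‖(⟨g, hcont⟩ : X →L[ℝ] lp (fun _ : Finset ℕ => X) ∞)‖, fun v hv x hx A => ?_⟩
  rw [hwu x v ⟨hv, hx⟩, ← hg]
  exact (lp.norm_apply_le_norm ENNReal.top_ne_zero (g x) A).trans
    ((⟨g, hcont⟩ : X →L[ℝ] lp (fun _ : Finset ℕ => X) ∞).le_opNorm x)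

theorem IsUFDD.exists_isUncondDecomp [CompleteSpace X] {F : ℕ → Submodule ℝ X} (hF : IsUFDD F) :
    ∃ C, IsUncondDecomp F C := by
  classical
  obtain ⟨C, hC⟩ := hF.exists_norm_sum_le
  refine ⟨C, fun A x hx y hy => ?_⟩
  obtain ⟨f, hf, hfA, N₁, hN₁⟩ := exists_eq_sum_of_mem_biSup hx
  obtain ⟨g, hg, hgA, N₂, hN₂⟩ := exists_eq_sum_of_mem_biSup hy
  have hconv : SeriesConvergesTo (fun i => f i + g i) (x + y) := by
    refine tendsto_const_nhds.congr' ?_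
    filter_upwards [eventually_ge_atTop N₁, eventually_ge_atTop N₂] with N h1 h2
    rw [Finset.sum_add_distrib, hN₁ N h1, hN₂ N h2]
  have := hC _ (fun i => Submodule.add_mem _ (hf i) (hg i)) _ hconv
    ((Finset.range N₁).filter fun i => i ∈ A)
  rw [Finset.sum_filter] at this
  convert this using 2
  rw [← hN₁ N₁ le_rfl]
  refine Finset.sum_congr rfl fun i _ => ?_
  split_ifs with h
  · rw [hgA i (by simpa using h), add_zero]
  · exact hfA i h

/-- Dropping the first n spaces removes only a finite-dimensional, hence Hilbertian, part. If the
rest were uniformly Hilbertian, every finite-dimensional E, perturbed into the algebraic sum and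
split at n, would be so too. -/
theorem IsSchauderDecomp.exists_not_hilbertComparable_Ico {F : ℕ → Submodule ℝ X}
    [∀ i, FiniteDimensional ℝ (F i)] {C : ℝ} (hF : IsSchauderDecomp F C)
    (hdense : (⨆ i, F i).topologicalClosure = ⊤) (hX : (⊤ : Submodule ℝ X).IsLarge) (n : ℕ)
    (c : ℝ) : ∃ b, ¬ (⨆ i ∈ Set.Ico n b, F i).HilbertComparable c := by
  wlog hc : 0 ≤ c generalizing c
  · obtain ⟨b, hb⟩ := this 0 le_rfl
    exact ⟨b, fun h => hb (h.mono (by linarith))⟩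
  by_contra! hcon
  have hfd := finiteDimensional_biSup_Ico F 0 n
  obtain ⟨d, hd0, hd⟩ := Submodule.exists_hilbertComparable
    (⨆ i ∈ Set.Ico 0 n, F i : Submodule ℝ X)
  obtain ⟨E, hE, -, hEH⟩ := hX (2 ^ 2 * 2 ^ 2 * (2 * 1 ^ 2 * (1 + |C|) ^ 2 * (d + c)))
  obtain ⟨S, hSF, hS⟩ := LinearMap.exists_perturbation (⨆ i, F i) E.subtype
    (fun x => by rw [hdense]; trivial) (ε := 1 / 2) (by norm_num)
  have hS1 : ∀ x : E, ‖(x : X)‖ ≤ 2 * ‖S x‖ := fun x => by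
    have h1 := hS x
    have h2 := norm_sub_norm_le (x : X) (S x)
    rw [norm_sub_rev] at h2
    simp only [Submodule.subtype_apply, Submodule.coe_norm] at h1 ⊢
    linarith
  have hS2 : ∀ x : E, ‖S x‖ ≤ 2 * ‖(x : X)‖ := fun x => by
    have h1 := hS x
    have h2 := norm_sub_norm_le (S x) (x : X)
    simp only [Submodule.subtype_apply, Submodule.coe_norm] at h1 ⊢
    have := norm_nonneg (x : X)
    linarith
  have hsup : (⨆ i, F i) ≤ (⨆ i ∈ Set.Iio n, F i) ⊔ ⨆ i ∈ (Set.Iio n)ᶜ, F i := iSup_le fun i => by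
    by_cases hi : i ∈ Set.Iio n
    · exact (le_biSup F hi).trans le_sup_left
    · exact (le_biSup F (show i ∈ (Set.Iio n)ᶜ from hi)).trans le_sup_right
  obtain ⟨f, g, hf, hg, hfg⟩ := S.exists_eq_add_of_mem_sup fun x => hsup (hSF x)
  have hfC : ∀ x, ‖f x‖ ≤ (1 + |C|) * ‖S x‖ := fun x => by
    have h1 := hF n (f x) (hf x) (g x) (hg x)
    rw [← hfg] at h1
    have := mul_le_mul_of_nonneg_right (le_abs_self C) (norm_nonneg (S x))
    have := norm_nonneg (S x)
    linarith
  have hgC : ∀ x, ‖g x‖ ≤ (1 + |C|) * ‖S x‖ := fun x => by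
    have h1 := hF n (f x) (hf x) (g x) (hg x)
    rw [← hfg] at h1
    have := mul_le_mul_of_nonneg_right (le_abs_self C) (norm_nonneg (S x))
    have h2 : g x = S x - f x := by rw [hfg]; abel
    have := norm_sub_le (S x) (f x)
    rw [h2]
    linarith
  have hfH : HilbertComparable (fun x => ‖f x‖) d := hd.comp_linearMap f fun x =>
    (biSup_mono fun i hi => ⟨Nat.zero_le _, hi⟩ : (⨆ i ∈ Set.Iio n, F i) ≤ _) (hf x)
  have hgH : HilbertComparable (fun x => ‖g x‖) c := by
    have hle : LinearMap.range g ≤ ⨆ i ∈ Set.Ici n, F i := by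
      rintro _ ⟨x, rfl⟩
      simpa using hg x
    obtain ⟨b, hb⟩ := exists_le_biSup_Ico hle
    exact (hcon b).comp_linearMap g fun x => hb (LinearMap.mem_range_self g x)
  have hSH : HilbertComparable (fun x => ‖S x‖) (2 * 1 ^ 2 * (1 + |C|) ^ 2 * (d + c)) :=
    hfH.two_piece hgH hd0 hc (fun x => norm_nonneg _) (fun x => norm_nonneg _)
      (fun x => norm_nonneg _) (fun x => by rw [one_mul, hfg]; exact norm_add_le _ _) hfC hgC
  exact hEH (hSH.of_le_of_le (by positivity) (fun x => norm_nonneg _) (fun x => norm_nonneg _)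
    hS1 hS2)

end UFDD

/-! ### ℓ₂-decompositions -/

section L2Decomp

variable {X : Type u} [NormedAddCommGroup X] [NormedSpace ℝ X]

/-- Two signed sums of the same vectors are u + v and u - v, where u collects the indices with equal
signs. The projections onto both index sets are bounded by C, so changing signs costs 2C. -/
theorem IsUncondDecomp.sum_sq_comparable {F : ℕ → Submodule ℝ X} {C c : ℝ}
    (h : IsUncondDecomp F C) {s : Finset ℕ} {x : ℕ → X} (hx : ∀ i, x i ∈ F i) (hc : 0 ≤ c)
    (hH : (Submodule.span ℝ (x '' s)).HilbertComparable c) :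
    ‖∑ i ∈ s, x i‖ ^ 2 ≤ (2 * C) ^ 2 * c * ∑ i ∈ s, ‖x i‖ ^ 2 ∧
      ∑ i ∈ s, ‖x i‖ ^ 2 ≤ (2 * C) ^ 2 * c * ‖∑ i ∈ s, x i‖ ^ 2 := by
  have hr : Set.range (fun i : s => x i) = x '' s := by
    rw [Set.image_eq_range]; rfl
  rw [← hr] at hH
  rw [← Finset.sum_coe_sort s, ← Finset.sum_coe_sort s]
  refine sum_sq_comparable_of_unconditional (fun i : s => x i) (fun ω ω' => ?_) hc hH
  let A : Set ℕ := {i | ∃ h : i ∈ s, ω ⟨i, h⟩ = ω' ⟨i, h⟩}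
  let u : X := ∑ i : s, if ω i = ω' i then boolSign (ω' i) • x i else 0
  let v : X := ∑ i : s, if ω i = ω' i then 0 else boolSign (ω' i) • x i
  have hu : u ∈ ⨆ i ∈ A, F i := Submodule.sum_mem _ fun i _ => by
    split_ifs with hi
    · exact Submodule.smul_mem _ _ ((le_biSup F (show (i : ℕ) ∈ A from ⟨i.2, hi⟩)) (hx i))
    · exact Submodule.zero_mem _
  have hv : v ∈ ⨆ i ∈ Aᶜ, F i := Submodule.sum_mem _ fun i _ => by
    split_ifs with hi
    · exact Submodule.zero_mem _
    · exact Submodule.smul_mem _ _ ((le_biSup F (show (i : ℕ) ∈ Aᶜ from fun ⟨_, h⟩ => hi h)) (hx i))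
  have h1 := h A u hu v hv
  have h2 := h Aᶜ v hv u (by rwa [compl_compl])
  have e1 : ∑ i : s, boolSign (ω' i) • x i = u + v := by
    rw [← Finset.sum_add_distrib]
    exact Finset.sum_congr rfl fun i _ => by split_ifs <;> simp
  have e2 : ∑ i : s, boolSign (ω i) • x i = u - v := by
    rw [← Finset.sum_sub_distrib]
    refine Finset.sum_congr rfl fun i _ => ?_
    cases ω i <;> cases ω' i <;> simp [boolSign]
  rw [e1, e2]
  rw [add_comm v u] at h2
  have := norm_sub_le u v
  linarith

/-- If every tail violated every ℓ₂ estimate, violating vectors on consecutive index blocks would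
form a single unconditional sequence. Its span would be Hilbertian by `H`, which gives an ℓ₂
estimate with one constant for all blocks. -/
theorem exists_isL2Decomp_tail
    (H : ∀ e : ℕ → X, (∀ k, e k ≠ 0) → ∀ C, IsUncondDecomp (fun i => Submodule.span ℝ {e i}) C →
      ∃ c, (Submodule.span ℝ (Set.range e)).HilbertComparable c)
    {F : ℕ → Submodule ℝ X} {C : ℝ} (hF : IsUncondDecomp F C) (hne : ∀ i, F i ≠ ⊥) :
    ∃ (n₀ : ℕ) (D : ℝ), 0 ≤ D ∧ IsL2Decomp (fun i => F (n₀ + i)) D := by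
  classical
  by_contra! hcon
  have hviol : ∀ n₀ j : ℕ, ∃ x : ℕ → X, (∀ k, x k ∈ F (n₀ + k)) ∧ ∃ N : ℕ,
      ¬ (‖∑ k ∈ Finset.range N, x k‖ ^ 2 ≤ j * ∑ k ∈ Finset.range N, ‖x k‖ ^ 2 ∧
      ∑ k ∈ Finset.range N, ‖x k‖ ^ 2 ≤ j * ‖∑ k ∈ Finset.range N, x k‖ ^ 2) := by
    intro n₀ j
    have := hcon n₀ j (Nat.cast_nonneg j)
    rw [IsL2Decomp] at this
    push Not at this
    obtain ⟨x, hx, N, hN⟩ := this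
    exact ⟨x, hx, N, fun h => (hN h.1).not_ge h.2⟩
  choose x hxF M hM using hviol
  have hMpos : ∀ n₀ j, 0 < M n₀ j := fun n₀ j => by
    rw [Nat.pos_iff_ne_zero]
    intro h
    exact hM n₀ j (by simp [h])
  let N : ℕ → ℕ := fun n => Nat.rec 0 (fun j s => s + M s j) n
  have hN1 : ∀ j, N (j + 1) = N j + M (N j) j := fun j => rfl
  have hN : StrictMono N := strictMono_nat_of_lt_succ fun j => by
    rw [hN1]; exact Nat.lt_add_of_pos_right (hMpos _ _)
  obtain ⟨J, -, hJ⟩ := exists_block_index hN rfl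
  choose v hvF hv0 using fun i => Submodule.exists_mem_ne_zero_of_ne_bot (hne i)
  let z : ℕ → X := fun k => x (N (J k)) (J k) (k - N (J k))
  -- Zero terms are replaced by nonzero vectors of F k, as `H` needs a sequence without zeros; the
  -- violating vectors remain in the span.
  let e : ℕ → X := fun k => if z k = 0 then v k else z k
  have hzF : ∀ k, z k ∈ F k := fun k => by
    have h1 := hxF (N (J k)) (J k) (k - N (J k))
    rwa [Nat.add_sub_cancel' ((hJ (J k) k).1 rfl).1] at h1
  have he0 : ∀ k, e k ≠ 0 := fun k => by
    simp only [e]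
    split_ifs with h
    · exact hv0 k
    · exact h
  have heF : ∀ k, e k ∈ F k := fun k => by
    simp only [e]
    split_ifs
    · exact hvF k
    · exact hzF k
  obtain ⟨c, hc⟩ := H e he0 C (hF.mono (fun i => by
    rw [Submodule.span_singleton_le_iff_mem]; exact heF i) le_rfl)
  obtain ⟨j, hj⟩ := exists_nat_ge ((2 * C) ^ 2 * max c 0)
  have hFj : IsUncondDecomp (fun i => F (N j + i)) C :=
    hF.blocks (a := fun i => N j + i) (fun i i' h => Nat.add_le_add_left h _) fun i =>
      le_biSup F (show N j + i ∈ Set.Ico (N j + i) (N j + (i + 1)) by simp)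
  have key := hFj.sum_sq_comparable (s := Finset.range (M (N j) j)) (hxF (N j) j)
    (le_max_right c 0) ((Submodule.HilbertComparable.anti (hc.mono (le_max_left c 0)) (Submodule.span_le.2 (by
      rintro _ ⟨i, hi, rfl⟩
      have hJi : J (N j + i) = j := (hJ _ _).2 ⟨Nat.le_add_right _ _, by
        rw [hN1]; exact Nat.add_lt_add_left (by simpa using hi) _⟩
      have hz : z (N j + i) = x (N j) j i := by simp [z, hJi]
      by_cases h0 : x (N j) j i = 0
      · rw [h0]; exact Submodule.zero_mem _
      · refine Submodule.subset_span ⟨N j + i, ?_⟩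
        simp [e, hz, h0]))))
  exact hM (N j) j ⟨key.1.trans (by gcongr), key.2.trans (by gcongr)⟩

theorem norm_sum_sq_of_pairwise {X : Type*} [NormedAddCommGroup X] {ι : Type*} (s : Finset ι) (z : ι → X)
    (h : ∀ i ∈ s, ∀ j ∈ s, i ≠ j → z i = 0 ∨ z j = 0) :
    ‖∑ i ∈ s, z i‖ ^ 2 = ∑ i ∈ s, ‖z i‖ ^ 2 := by
  by_cases h0 : ∃ i ∈ s, z i ≠ 0
  · obtain ⟨i, hi, hz⟩ := h0
    have h1 : ∀ j ∈ s, j ≠ i → z j = 0 := fun j hj hji => (h j hj i hi hji).resolve_right hz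
    rw [Finset.sum_eq_single i h1 fun hn => absurd hi hn,
      Finset.sum_eq_single i (fun j hj hji => by simp [h1 j hj hji]) fun hn => absurd hi hn]
  · push Not at h0
    rw [Finset.sum_eq_zero h0, Finset.sum_eq_zero fun i hi => by simp [h0 i hi]]
    simp

/-- Expand the block vectors along F and use the ℓ₂ estimate twice, for the whole sum and inside
each block; hence D². -/
theorem IsL2Decomp.blocks {F G : ℕ → Submodule ℝ X} {D : ℝ} (hF : IsL2Decomp F D) (hD : 0 ≤ D)
    {a : ℕ → ℕ} (ha : Monotone a) (hG : ∀ j, G j ≤ ⨆ i ∈ Set.Ico (a j) (a (j + 1)), F i) :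
    IsL2Decomp G (D ^ 2) := by
  intro x hx N
  choose f hf hf0 N₀ hN₀ using fun j => exists_eq_sum_of_mem_biSup (hG j (hx j))
  have hfx : ∀ j n, a (j + 1) ≤ n → ∑ k ∈ Finset.range n, f j k = x j := fun j n hn => by
    rw [← hN₀ j _ (le_max_left _ n)]
    refine Finset.sum_subset (by simp) fun k _ hk => hf0 j k fun hk' => hk ?_
    exact Finset.mem_range.2 (hk'.2.trans_le hn)
  have hpair : ∀ k, ∀ i ∈ Finset.range N, ∀ j ∈ Finset.range N, i ≠ j → f i k = 0 ∨ f j k = 0 := by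
    intro k i _ j _ hij
    by_contra! hne
    have hi := not_imp_comm.1 (hf0 i k) hne.1
    have hj := not_imp_comm.1 (hf0 j k) hne.2
    rcases hij.lt_or_gt with h | h
    · exact absurd (hi.2.trans_le ((ha h).trans hj.1)) (lt_irrefl _)
    · exact absurd (hj.2.trans_le ((ha h).trans hi.1)) (lt_irrefl _)
  have hsum : ∑ j ∈ Finset.range N, x j =
      ∑ k ∈ Finset.range (a N), ∑ j ∈ Finset.range N, f j k := by
    rw [Finset.sum_comm]
    exact Finset.sum_congr rfl fun j hj => (hfx j _ (ha (Finset.mem_range.1 hj))).symm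
  have hsq : ∑ k ∈ Finset.range (a N), ‖∑ j ∈ Finset.range N, f j k‖ ^ 2 =
      ∑ j ∈ Finset.range N, ∑ k ∈ Finset.range (a N), ‖f j k‖ ^ 2 := by
    rw [Finset.sum_comm]
    -- The index intervals are disjoint, so for each k at most one block has a nonzero component
    -- there.
    exact Finset.sum_congr rfl fun k _ => norm_sum_sq_of_pairwise _ _ (hpair k)
  have h1 := hF (fun k => ∑ j ∈ Finset.range N, f j k)
    (fun k => Submodule.sum_mem _ fun j _ => hf j k) (a N)
  simp only [hsq, ← hsum] at h1
  have h2 : ∀ j ∈ Finset.range N, ‖x j‖ ^ 2 ≤ D * ∑ k ∈ Finset.range (a N), ‖f j k‖ ^ 2 ∧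
      ∑ k ∈ Finset.range (a N), ‖f j k‖ ^ 2 ≤ D * ‖x j‖ ^ 2 := fun j hj => by
    have := hF (f j) (hf j) (a N)
    rwa [hfx j _ (ha (Finset.mem_range.1 hj))] at this
  constructor
  · refine h1.1.trans ?_
    rw [sq D, mul_assoc]
    refine mul_le_mul_of_nonneg_left ?_ hD
    rw [Finset.mul_sum]
    exact Finset.sum_le_sum fun j hj => (h2 j hj).2
  · refine le_trans ?_ ((mul_le_mul_of_nonneg_left h1.2 hD).trans (le_of_eq (by ring)))
    rw [Finset.mul_sum]
    exact Finset.sum_le_sum fun j hj => (h2 j hj).1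

theorem IsL2Decomp.sum_fin {G : ℕ → Submodule ℝ X} {D : ℝ} (hG : IsL2Decomp G D) {N : ℕ}
    {x : Fin N → X} (hx : ∀ i : Fin N, x i ∈ G i) :
    ‖∑ i, x i‖ ^ 2 ≤ D * ∑ i, ‖x i‖ ^ 2 ∧ ∑ i, ‖x i‖ ^ 2 ≤ D * ‖∑ i, x i‖ ^ 2 := by
  have := hG (fun k => if h : k < N then x ⟨k, h⟩ else 0) (fun k => by
    split_ifs with h
    · exact hx ⟨k, h⟩
    · exact Submodule.zero_mem _) N
  simpa [Finset.sum_range] using this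

end L2Decomp

/-! ### The case of unconditional sequences -/

section UnconditionalCase

variable {X : Type u} [NormedAddCommGroup X] [NormedSpace ℝ X]

theorem IsD2Minimal.exists_uncondDecomp_not_hilbertComparable [CompleteSpace X]
    (hX : IsD2Minimal X) {F : ℕ → Submodule ℝ X} (hF : IsUFDD F) :
    ∃ (e : ℕ → X) (C : ℝ), (∀ k, e k ≠ 0) ∧ IsUncondDecomp (fun i => Submodule.span ℝ {e i}) C ∧
      ∀ c, ¬ (Submodule.span ℝ (Set.range e)).HilbertComparable c := by
  by_contra! hcon
  have H : ∀ e : ℕ → X, (∀ k, e k ≠ 0) → ∀ C,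
      IsUncondDecomp (fun i => Submodule.span ℝ {e i}) C →
      ∃ c, (Submodule.span ℝ (Set.range e)).HilbertComparable c := fun e he C h => hcon e C he h
  have hfd := hF.finiteDimensional
  obtain ⟨C, hC⟩ := hF.exists_isUncondDecomp
  have hlarge := hC.isSchauderDecomp.exists_not_hilbertComparable_Ico hF.topologicalClosure_iSup
    hX.1.isLarge_top
  obtain ⟨n₀, D, hD, hL2⟩ := exists_isL2Decomp_tail H hC hF.ne_bot
  -- D² is the ℓ₂ constant of blocks of the tail and 4 the squared distortion between p and its
  -- copies. The successive copies themselves already form ℓ₂-sums, so no differences or limits are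
  -- needed.
  set a : ℝ := 4 * D ^ 2 + 1
  have ha1 : 1 ≤ a := le_add_of_nonneg_left (by positivity)
  obtain ⟨n₁, D₁, hD₁, h₁⟩ := exists_uniform_hilbertComparable_uncond H (sq_nonneg D)
    (fun G A hA hG => hL2.blocks hD hA hG) (C' := a) (by linarith)
  set K := (a ^ 4 * D₁) ^ 2
  have hfr := hX.exists_finrank F hC.isSchauderDecomp hlarge (16 * K)
  have htail : ∀ n, (⨆ i ∈ Set.Ici (n₀ + n), F i) ≤ ⨆ i ∈ Set.Ici n, F (n₀ + i) := fun n =>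
    iSup₂_le fun i hi => by
      obtain ⟨k, rfl⟩ := Nat.exists_eq_add_of_le ((Nat.le_add_right n₀ n).trans hi)
      exact le_biSup (fun i => F (n₀ + i)) (show k ∈ Set.Ici n from Nat.le_of_add_le_add_left hi)
  obtain ⟨m, p, T, A, hp, ⟨β, hβ, hβp⟩, hpK, hA, hA0, hTA, hTp⟩ := exists_successive_copies
    (F := fun i => F (n₀ + i)) (K := K) (by positivity) (by
      obtain ⟨m, hm⟩ := hfr
      refine ⟨m, fun n => ?_⟩
      obtain ⟨G, hG1, hG2, hG3, hG4⟩ := hm (n₀ + n)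
      exact ⟨G, hG1, hG2, hG3.trans (htail n), hG4⟩) n₁
  refine hpK (hilbertComparable_of_copies p hp (fun x hx => ?_) ha1 hD₁
    (⨆ i ∈ Set.Ici n₁, F (n₀ + i)) (fun N => ⟨fun k => T k, fun k y => ?_, fun y => ?_⟩) h₁)
  · have := hβp x
    rw [hx] at this
    exact norm_le_zero_iff.1 (nonpos_of_mul_nonpos_right this hβ)
  · exact (biSup_mono fun i hi => hA0.trans ((hA (Nat.zero_le _)).trans hi.1) :
      _ ≤ ⨆ i ∈ Set.Ici n₁, F (n₀ + i)) (hTA k y)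
  · have key := (hL2.blocks hD hA (fun j => le_rfl)).sum_fin (x := fun k : Fin N => T k (y k))
      fun k => hTA k (y k)
    have e1 : ∑ k : Fin N, ‖T k (y k)‖ ^ 2 ≤ 4 * ∑ k : Fin N, p (y k) ^ 2 := by
      rw [Finset.mul_sum]
      refine Finset.sum_le_sum fun k _ => ?_
      calc ‖T k (y k)‖ ^ 2 ≤ (2 * p (y k)) ^ 2 := by gcongr; exact (hTp _ _).1
        _ = _ := by ring
    have e2 : ∑ k : Fin N, p (y k) ^ 2 ≤ 4 * ∑ k : Fin N, ‖T k (y k)‖ ^ 2 := by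
      rw [Finset.mul_sum]
      refine Finset.sum_le_sum fun k _ => ?_
      calc p (y k) ^ 2 ≤ (2 * ‖T k (y k)‖) ^ 2 :=
            pow_le_pow_left₀ (apply_nonneg _ _) (hTp _ _).2 2
        _ = _ := by ring
    constructor
    · calc _ ≤ D ^ 2 * ∑ k : Fin N, ‖T k (y k)‖ ^ 2 := key.1
        _ ≤ D ^ 2 * (4 * ∑ k : Fin N, p (y k) ^ 2) := by gcongr
        _ = (4 * D ^ 2) * ∑ k : Fin N, p (y k) ^ 2 := by ring
        _ ≤ _ := by gcongr; simp [a]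
    · calc _ ≤ 4 * ∑ k : Fin N, ‖T k (y k)‖ ^ 2 := e2
        _ ≤ 4 * (D ^ 2 * ‖∑ k : Fin N, T k (y k)‖ ^ 2) := by gcongr; exact key.2
        _ = (4 * D ^ 2) * ‖∑ k : Fin N, T k (y k)‖ ^ 2 := by ring
        _ ≤ _ := by gcongr; simp [a]

end UnconditionalCase

/-! ### Closed spans of the bad sequences -/

theorem theorem6p7 (X : Type u) [NormedAddCommGroup X] [NormedSpace ℝ X] [CompleteSpace X]
    (hX : IsD2Minimal X) :
    (∃ Y : Submodule ℝ X, IsClosed (Y : Set X) ∧ ¬ IsHilbertian Y ∧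
      Nonempty (SchauderBasis ℝ Y)) ∧
    ((∃ F : ℕ → Submodule ℝ X, IsUFDD F) →
      ∃ Y : Submodule ℝ X, IsClosed (Y : Set X) ∧ ¬ IsHilbertian Y ∧
        Nonempty (UnconditionalSchauderBasis ℕ ℝ Y)) := by
  constructor
  · obtain ⟨e, C, he, hC, hH⟩ := hX.exists_schauderDecomp_not_hilbertComparable
    refine ⟨(Submodule.span ℝ (Set.range e)).topologicalClosure,
      Submodule.isClosed_topologicalClosure _, fun h => ?_, exists_schauderBasis he hC⟩
    obtain ⟨c, hc⟩ := exists_hilbertComparable_of_isHilbertian_of_le h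
      (Submodule.le_topologicalClosure _)
    exact hH c hc
  · rintro ⟨F, hF⟩
    obtain ⟨e, C, he, hC, hH⟩ := hX.exists_uncondDecomp_not_hilbertComparable hF
    refine ⟨(Submodule.span ℝ (Set.range e)).topologicalClosure,
      Submodule.isClosed_topologicalClosure _, fun h => ?_, exists_unconditionalSchauderBasis he hC⟩
    obtain ⟨c, hc⟩ := exists_hilbertComparable_of_isHilbertian_of_le h
      (Submodule.le_topologicalClosure _)
    exact hH c hc
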